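/- Let $n\ge 1$ and let $\mathbf{H}_n=\mathbb{R}^{2n+1}$ be the Heisenberg group with group law $(x,y,\tau)\circ(x',y',\tau')=\big(x+x',\,y+y',\,\tau+\tau'+\tfrac12(x\cdot y'-x'\cdot y)\big)$, with Lebesgue measure, left-invariant vector fields $X_j=\partial_{x_j}-\tfrac{y_j}{2}\partial_\tau$, $Y_j=\partial_{y_j}+\tfrac{x_j}{2}\partial_\tau$ ($1\le j\le n$), sub-Laplacian $\Delta_H=\sum_{j=1}^n(X_j^2+Y_j^2)$, horizontal gradient $\nabla_H v=(X_1v,\dots,X_nv,Y_1v,\dots,Y_nv)$ and homogeneous dimension $Q=2n+2$. Let $H^1(\mathbf{H}_n)$ be the space of real-valued $v\in L^2(\mathbf{H}_n)$ whose distributional derivatives $X_jv,Y_jv$ all belong to $L^2(\mathbf{H}_n)$, with $\|v\|_{H^1}=\|v\|_{L^2}+\|\nabla_H v\|_{L^2}$. There is a constant $C>0$, depending only on $n$, such that the following holds. Let $(u_0,u_1)\in H^1(\mathbf{H}_n)\times L^2(\mathbf{H}_n)$ and let $u\in\mathcal{C}([0,\infty),H^1(\mathbf{H}_n))\cap\mathcal{C}^1([0,\infty),L^2(\mathbf{H}_n))$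 solve, in the sense of distributions, the damped wave equation $\partial_t^2u-\Delta_Hu+\partial_tu=0$ for $t>0$ with $u(0)=u_0$, $\partial_tu(0)=u_1$. Then for all $t\ge 0$ $$\|u(t)\|_{L^2}\le C\big(\|u_0\|_{L^2}+\|u_1\|_{L^2}\big),$$ $$\|\nabla_Hu(t)\|_{L^2}\le C(1+t)^{-1/2}\big(\|u_0\|_{H^1}+\|u_1\|_{L^2}\big),$$ $$\|\partial_tu(t)\|_{L^2}\le C(1+t)^{-1}\big(\|u_0\|_{H^1}+\|u_1\|_{L^2}\big).$$ If in addition $u_0,u_1\in L^1(\mathbf{H}_n)$, then for all $t\ge0$ $$\|u(t)\|_{L^2}\le C(1+t)^{-Q/4}\big(\|u_0\|_{L^1}+\|u_0\|_{L^2}+\|u_1\|_{L^1}+\|u_1\|_{L^2}\big),$$ $$\|\nabla_Hu(t)\|_{L^2}\le C(1+t)^{-Q/4-1/2}\big(\|u_0\|_{L^1}+\|\nabla_Hu_0\|_{L^2}+\|u_1\|_{L^1}+\|u_1\|_{L^2}\big),$$ $$\|\partial_tu(t)\|_{L^2}\le C(1+t)^{-Q/4-1}\big(\|u_0\|_{L^1}+\|\nabla_Hu_0\|_{L^2}+\|u_1\|_{L^1}+\|u_1\|_{L^2}\big).$$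 -/

import Mathlib

open MeasureTheory Set
open scoped ContDiff

noncomputable section

namespace Heisenberg

/-- The underlying space `ℝⁿ × ℝⁿ × ℝ` of the Heisenberg group, with points `(x, y, τ)`. Its `volume`
is Lebesgue measure, which is the Haar measure of the group law `mul`. -/
abbrev H (n : ℕ) : Type := (Fin n → ℝ) × (Fin n → ℝ) × ℝ

/-- The group law
`(x, y, τ) ∘ (x', y', τ') = (x + x', y + y', τ + τ' + (x ⬝ y' - x' ⬝ y) / 2)`. -/
def mul {n : ℕ} (p q : H n) : H n :=
  (p.1 + q.1, p.2.1 + q.2.1,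
    p.2.2 + q.2.2 + (1 / 2) * ((∑ j, p.1 j * q.2.1 j) - ∑ j, q.1 j * p.2.1 j))

/-- The coefficient field of `X_j = ∂_{x_j} - (y_j / 2) ∂_τ`. -/
def vecX {n : ℕ} (j : Fin n) (p : H n) : H n := (Pi.single j 1, 0, -(p.2.1 j / 2))

/-- The coefficient field of `Y_j = ∂_{y_j} + (x_j / 2) ∂_τ`. -/
def vecY {n : ℕ} (j : Fin n) (p : H n) : H n := (0, Pi.single j 1, p.1 j / 2)

/-- `X_j` is the left-invariant vector field generated by the `j`-th `x`-direction. -/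
theorem hasDerivAt_mul_x {n : ℕ} (j : Fin n) (p : H n) :
    HasDerivAt (fun s : ℝ => mul p (s • (Pi.single j 1, 0, 0))) (vecX j p) 0 := by
  have e : (fun s : ℝ => mul p (s • (Pi.single j 1, 0, 0))) = fun s : ℝ => p + s • vecX j p := by
    funext s
    refine Prod.ext rfl (Prod.ext rfl ?_)
    simp [mul, vecX, Pi.single_apply]
    ring
  rw [e]
  simpa using ((hasDerivAt_id (0 : ℝ)).smul_const (vecX j p)).const_add p

/-- `Y_j` is the left-invariant vector field generated by the `j`-th `y`-direction. -/
theorem hasDerivAt_mul_y {n : ℕ} (j : Fin n) (p : H n) :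
    HasDerivAt (fun s : ℝ => mul p (s • (0, Pi.single j 1, 0))) (vecY j p) 0 := by
  have e : (fun s : ℝ => mul p (s • (0, Pi.single j 1, 0))) = fun s : ℝ => p + s • vecY j p := by
    funext s
    refine Prod.ext rfl (Prod.ext rfl ?_)
    simp [mul, vecY, Pi.single_apply]
    ring
  rw [e]
  simpa using ((hasDerivAt_id (0 : ℝ)).smul_const (vecY j p)).const_add p

/-- The first order differential operator on functions given by the vector field `Z`. -/
def along {n : ℕ} (Z : H n → H n) (φ : H n → ℝ) : H n → ℝ := fun p => fderiv ℝ φ p (Z p)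

/-- The sub-Laplacian `∑_j (X_j² + Y_j²)`, acting on smooth functions. -/
def subLaplacian {n : ℕ} (φ : H n → ℝ) : H n → ℝ := fun p =>
  ∑ j, (along (vecX j) (along (vecX j) φ) p + along (vecY j) (along (vecY j) φ) p)

/-- Real-valued `L²` on the Heisenberg group. -/
abbrev L2 (n : ℕ) : Type := Lp ℝ 2 (volume : Measure (H n))

/-- Test functions: smooth with compact support. -/
def IsTest {n : ℕ} (φ : H n → ℝ) : Prop := ContDiff ℝ ∞ φ ∧ HasCompactSupport φ

/-- `Z v = w` in the sense of distributions, for `Z` one of the fields `X_j`, `Y_j`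
(whose formal adjoint is `-Z`). -/
def IsWeakDeriv {n : ℕ} (Z : H n → H n) (v w : L2 n) : Prop :=
  ∀ φ : H n → ℝ, IsTest φ → ∫ p, w p * φ p = ∫ p, v p * (-along Z φ p)

/-- Weak derivatives in `L²` are unique, so that `weakDeriv` below is well defined. -/
theorem IsWeakDeriv.unique {n : ℕ} {Z : H n → H n} {v w w' : L2 n}
    (h : IsWeakDeriv Z v w) (h' : IsWeakDeriv Z v w') : w = w' := by
  have hl : ∀ f : L2 n, LocallyIntegrable f volume := fun f =>
    (Lp.memLp f).locallyIntegrable (by norm_num)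
  have key := ae_eq_zero_of_integral_contDiff_smul_eq_zero (μ := (volume : Measure (H n)))
    (f := fun p => w p - w' p) ((hl w).sub (hl w')) (fun g hg hc => by
      have i : ∀ f : L2 n, Integrable (fun p => f p * g p) volume := fun f => by
        simpa [mul_comm] using (hl f).integrable_smul_right_of_hasCompactSupport hg.continuous hc
      have e := (h g ⟨hg, hc⟩).trans (h' g ⟨hg, hc⟩).symm
      have : (fun p => g p • (w p - w' p)) = fun p => w p * g p - w' p * g p := by
        funext p; simp only [smul_eq_mul]; ring
      rw [this, integral_sub (i w) (i w'), e, sub_self])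
  refine Lp.ext ?_
  filter_upwards [key] with p hp using sub_eq_zero.mp hp

open Classical in
/-- The weak derivative `Z v`, if it exists in `L²`, and `0` otherwise. -/
def weakDeriv {n : ℕ} (Z : H n → H n) (v : L2 n) : L2 n :=
  if h : ∃ w, IsWeakDeriv Z v w then h.choose else 0

/-- `v ∈ H¹`: all the weak derivatives `X_j v`, `Y_j v` exist in `L²`. -/
def MemH1 {n : ℕ} (v : L2 n) : Prop :=
  ∀ j, (∃ w, IsWeakDeriv (vecX j) v w) ∧ ∃ w, IsWeakDeriv (vecY j) v w

/-- The `L²` norm of the horizontal gradient of `v ∈ H¹`. -/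
def gradNorm {n : ℕ} (v : L2 n) : ℝ :=
  Real.sqrt (∑ j, (‖weakDeriv (vecX j) v‖ ^ 2 + ‖weakDeriv (vecY j) v‖ ^ 2))

/-- The `L¹` norm (used only for integrable `v`). -/
def L1norm {n : ℕ} (v : L2 n) : ℝ := ∫ p, |v p|

/-- The time derivative of `u` on `[0, ∞)` (one-sided at `0`), as an `L²`-valued function. -/
def dt {n : ℕ} (u : ℝ → L2 n) (t : ℝ) : L2 n := derivWithin u (Ici 0) t

/-- `u ∈ C([0,∞), H¹) ∩ C¹([0,∞), L²)`; continuity into `H¹` means that `u` and all the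
`X_j u`, `Y_j u` are continuous into `L²`. -/
structure EnergyClass {n : ℕ} (u : ℝ → L2 n) : Prop where
  memH1 : ∀ t, 0 ≤ t → MemH1 (u t)
  contX : ∀ j, ContinuousOn (fun t => weakDeriv (vecX j) (u t)) (Ici 0)
  contY : ∀ j, ContinuousOn (fun t => weakDeriv (vecY j) (u t)) (Ici 0)
  diff : DifferentiableOn ℝ u (Ici 0)
  cont_dt : ContinuousOn (dt u) (Ici 0)

/-- `u` solves `∂ₜ² u - Δ_H u + ∂ₜ u = 0` for `t > 0`, with `u(0) = u₀`, `∂ₜ u(0) = u₁`. The equation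
holds in the sense of distributions on the group: for each test function `φ`,
`d/dt ⟨∂ₜ u, φ⟩ = ⟨u, Δ_H φ⟩ - ⟨∂ₜ u, φ⟩`. -/
structure IsSolution {n : ℕ} (u₀ u₁ : L2 n) (u : ℝ → L2 n) : Prop where
  energy : EnergyClass u
  equation : ∀ φ : H n → ℝ, IsTest φ → ∀ t, 0 < t →
    HasDerivAt (fun s => ∫ p, dt u s p * φ p)
      ((∫ p, u t p * subLaplacian φ p) - ∫ p, dt u t p * φ p) t
  init : u 0 = u₀
  init_dt : dt u 0 = u₁

/-- The homogeneous dimension `Q = 2n + 2`. -/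
def Q (n : ℕ) : ℝ := 2 * n + 2

end Heisenberg

end

/-! Write `A` for minus the sub-Laplacian. Everything is expressed through the bounded operator `D =
A (1 + A)⁻¹ = 1 - J J*`, where `J` embeds the form domain `H¹` into `L²`. It satisfies `0 ≤ D ≤ 1`,
and the positivity of `D ^ a (1 - D) ^ b exp (-t D)` replaces the spectral theorem. Applying `(1 +
A)⁻¹` to the damped wave equation, with `w = ∂ₜ u`, gives `((1 - D) w)' = -D u - (1 - D) w`.

At each frequency `d` the energy `(1 - d)(u + w)² / 2 + (1 - d) w² / 2 + d u²` decays at least like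
`exp (-d t / 2)`. The operator form, `heat_energy_antitoneOn` with its corollary `energy_le`, bounds
the solution at time `T` by the heat flow `exp (-T D / 2)` of its data, with an arbitrary weight `D
^ j`. Each factor `D` against the heat flow gains a factor `(1 + t)⁻¹`
(`one_add_mul_heatForm_succ_le`), so decay of `⟪exp (-t D) f, f⟫` at rate `(1 + t) ^ (-a)` improves
to rate `a + j` with the weight `D ^ j`.

Unbounded quantities are recovered from geometric series. The squared gradient norm is `⟪A u, u⟫ =
∑_{i ≥ 1} ⟪D ^ i u, u⟫`, and `‖D w‖² = ∑_{i ≥ 2} ⟪D ^ i (1 - D) w, w⟫`. On the data side all but `a`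
terms of the series telescope in the `H¹` norm, which is where `u₀ ∈ H¹` enters. The remaining part
`(1 - D) w` solves a damped first order equation with source `-D u` and inherits the decay of `D u`.
This yields rates `a`, `a + 1`, `a + 2` for the squared norms of `u`, its gradient and `w`
(`norm_sq_decay`, `exists_energy_decay`).

For general data `a = 0`. For integrable data `a = n + 1 = Q / 2`, by Nash's argument
(`heatForm_nash`, `heatForm_decay_of_nash`). The Nash inequality comes from comparing `f` with its
right translates over a box of volume `r ^ Q`, and the `L¹` bound on the flow is dual to the `L^∞`
contractivity of the resolvent, proved by truncation. Finally, density of test functions in `H¹`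
(`eq_zero_of_inner_sobolevTest`) turns the distributional equation into a strong one for `J* w`; it
follows from a Liouville theorem for mollified functions. -/

/-! ### Bounded symmetric operators between `0` and `1` -/

section Operators

open scoped RealInnerProductSpace

variable {E : Type*} [NormedAddCommGroup E] [InnerProductSpace ℝ E]

/-- A symmetric bounded operator `D` with `0 ≤ D ≤ 1` in the sense of quadratic forms. -/
structure IsUnitInterval (D : E →L[ℝ] E) : Prop where
  symm : ∀ x y, ⟪D x, y⟫ = ⟪x, D y⟫
  nonneg : ∀ x, 0 ≤ ⟪D x, x⟫
  le_one : ∀ x, ⟪D x, x⟫ ≤ ⟪x, x⟫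

/-- The semigroup `exp (-t D)`. -/
noncomputable def heat (D : E →L[ℝ] E) (t : ℝ) : E →L[ℝ] E := NormedSpace.exp (t • (-D))

theorem heat_zero (D : E →L[ℝ] E) : heat D 0 = 1 := by simp [heat]

theorem nonneg_conj {S T : E →L[ℝ] E} (hS : ∀ x y, ⟪S x, y⟫ = ⟪x, S y⟫)
    (hT : ∀ x, 0 ≤ ⟪T x, x⟫) (x : E) : 0 ≤ ⟪(S * T * S) x, x⟫ := by
  simpa [hS] using hT (S x)

variable {D : E →L[ℝ] E}

namespace IsUnitInterval

theorem one_sub (hD : IsUnitInterval D) : IsUnitInterval (1 - D) where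
  symm x y := by simp [inner_sub_left, inner_sub_right, hD.symm]
  nonneg x := by simpa [inner_sub_left] using hD.le_one x
  le_one x := by simpa [inner_sub_left] using hD.nonneg x

theorem pow_symm (hD : IsUnitInterval D) (k : ℕ) (x y : E) : ⟪(D ^ k) x, y⟫ = ⟪x, (D ^ k) y⟫ := by
  induction k generalizing x y with
  | zero => simp
  | succ k ih => rw [pow_succ, mul_apply_eq_comp, ih, hD.symm, ← mul_apply_eq_comp,
      ← pow_succ', pow_succ]

/-- This is `D (1 - D) = D (1 - D) D + (1 - D) D (1 - D)`, a sum of two conjugates of nonnegative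
operators. -/
theorem mul_one_sub_nonneg (hD : IsUnitInterval D) (x : E) : 0 ≤ ⟪(D * (1 - D)) x, x⟫ := by
  have h1 := hD.one_sub.nonneg (D x)
  have h2 := hD.nonneg ((1 - D) x)
  simp only [mul_apply_eq_comp, sub_apply, one_apply_eq_self,
    map_sub, inner_sub_left, inner_sub_right] at *
  have := hD.symm x (D x)
  have := hD.symm (D x) (D x)
  have := hD.symm (D x) x
  linarith

theorem norm_sq_apply_le (hD : IsUnitInterval D) (x : E) : ‖D x‖ ^ 2 ≤ ⟪D x, x⟫ := by
  have h := hD.mul_one_sub_nonneg x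
  simp only [mul_apply_eq_comp, sub_apply, one_apply_eq_self,
    map_sub, inner_sub_left] at h
  rw [hD.symm (D x) x, real_inner_self_eq_norm_sq] at h
  linarith

/-- Two factors `D` can be moved to either side of `D ^ a M`, which conjugates it by `D`. Only the
parity of the exponent matters, hence the two base cases. -/
theorem nonneg_pow_mul (hD : IsUnitInterval D) {M : E →L[ℝ] E} (hc : Commute D M)
    (h0 : ∀ x, 0 ≤ ⟪M x, x⟫) (h1 : ∀ x, 0 ≤ ⟪(D * M) x, x⟫) (a : ℕ) (x : E) :
    0 ≤ ⟪(D ^ a * M) x, x⟫ := by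
  induction a using Nat.twoStepInduction generalizing x with
  | zero => simpa using h0 x
  | one => simpa using h1 x
  | more a ih _ =>
    have e : D ^ (a + 2) * M = D * (D ^ a * M) * D := by
      rw [mul_assoc, mul_assoc, ← hc.eq, pow_succ, pow_succ', ← mul_assoc (D ^ a), ← mul_assoc]
      simp only [mul_assoc]
    rw [e]
    exact nonneg_conj hD.symm ih x

/-- This stands in for functional calculus: `d ^ a (1 - d) ^ b ≥ 0` on `[0, 1]`. The two-step
induction is run for `1 - D`, then for `D`. -/
theorem nonneg_pow_mul_pow (hD : IsUnitInterval D) (a b : ℕ) (x : E) :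
    0 ≤ ⟪(D ^ a * (1 - D) ^ b) x, x⟫ := by
  have hc : Commute D (1 - D) := (Commute.one_right D).sub_right (Commute.refl D)
  refine hD.nonneg_pow_mul (hc.pow_right b) (fun x => ?_) (fun x => ?_) a x
  · simpa using hD.one_sub.nonneg_pow_mul (Commute.one_right (1 - D)) (fun x => by simp)
      (fun x => by simpa using hD.one_sub.nonneg x) b x
  · rw [(hc.pow_right b).eq]
    exact hD.one_sub.nonneg_pow_mul hc.symm hD.nonneg
      (fun x => by rw [← hc.eq]; exact hD.mul_one_sub_nonneg x) b x

end IsUnitInterval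

theorem heat_commute {D M : E →L[ℝ] E} (h : Commute M D) (t : ℝ) : Commute M (heat D t) :=
  ((h.neg_right).smul_right t).exp_right

/-- The quadratic form of `D ^ j * exp (-t D)`. -/
noncomputable def heatForm (D : E →L[ℝ] E) (j : ℕ) (t : ℝ) (x : E) : ℝ := ⟪(D ^ j * heat D t) x, x⟫

theorem heatForm_zero_zero (D : E →L[ℝ] E) (x : E) : heatForm D 0 0 x = ‖x‖ ^ 2 := by
  simp [heatForm, heat_zero]

theorem heatForm_sub (D : E →L[ℝ] E) (j : ℕ) (t : ℝ) (x : E) :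
    heatForm D j t x - heatForm D (j + 1) t x = ⟪(D ^ j * (1 - D) ^ 1 * heat D t : E →L[ℝ] E) x, x⟫ := by
  rw [heatForm, heatForm, ← inner_sub_left, ← sub_apply]
  congr 2
  rw [pow_one, mul_sub, sub_mul, mul_one, pow_succ]

variable [CompleteSpace E]

theorem heat_add (D : E →L[ℝ] E) (s t : ℝ) : heat D (s + t) = heat D s * heat D t := by
  let _ := NormedAlgebra.restrictScalars ℚ ℝ (E →L[ℝ] E)
  rw [heat, heat, heat, add_smul, NormedSpace.exp_add_of_commute]
  exact ((Commute.refl (-D)).smul_left s).smul_right t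

theorem hasDerivAt_heat (D : E →L[ℝ] E) (t : ℝ) : HasDerivAt (heat D) (-(D * heat D t)) t := by
  have := hasDerivAt_exp_smul_const' (𝕂 := ℝ) (-D) t
  rwa [neg_mul] at this

theorem IsUnitInterval.heat_symm (hD : IsUnitInterval D) (t : ℝ) (x y : E) :
    ⟪heat D t x, y⟫ = ⟪x, heat D t y⟫ := by
  have h : IsSelfAdjoint (t • (-D)) := by
    refine (ContinuousLinearMap.isSelfAdjoint_iff_isSymmetric).2 fun x y => ?_
    simp [inner_smul_left, inner_smul_right, hD.symm]
  exact (ContinuousLinearMap.isSelfAdjoint_iff_isSymmetric.1 h.exp) x y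

/-- The heat operator is a square: one half-time factor goes to each side, leaving a conjugate of `D
^ a (1 - D) ^ b`. -/
theorem IsUnitInterval.nonneg_heat (hD : IsUnitInterval D) (a b : ℕ) (t : ℝ) (x : E) :
    0 ≤ ⟪(D ^ a * (1 - D) ^ b * heat D t) x, x⟫ := by
  have hc : Commute D (1 - D) := (Commute.one_right D).sub_right (Commute.refl D)
  have hM : Commute (D ^ a * (1 - D) ^ b) D :=
    ((Commute.refl D).pow_left a).mul_left (hc.symm.pow_left b)
  have e : D ^ a * (1 - D) ^ b * heat D t = heat D (t / 2) * (D ^ a * (1 - D) ^ b) * heat D (t / 2) := by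
    rw [← (heat_commute hM _).eq, mul_assoc _ (heat D _), ← heat_add, add_halves]
  rw [e]
  exact nonneg_conj (hD.heat_symm _) (hD.nonneg_pow_mul_pow a b) x

theorem heatForm_nonneg (hD : IsUnitInterval D) (j : ℕ) (t : ℝ) (x : E) : 0 ≤ heatForm D j t x := by
  simpa [heatForm] using hD.nonneg_heat j 0 t x

theorem heatForm_succ_le (hD : IsUnitInterval D) (j : ℕ) (t : ℝ) (x : E) :
    heatForm D (j + 1) t x ≤ heatForm D j t x := by
  have := hD.nonneg_heat j 1 t x
  rw [← heatForm_sub] at this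
  linarith

theorem hasDerivAt_heatForm (D : E →L[ℝ] E) (j : ℕ) (t : ℝ) (x : E) :
    HasDerivAt (fun t => heatForm D j t x) (-heatForm D (j + 1) t x) t := by
  have h := (((hasDerivAt_heat D t).const_mul (D ^ j)).clm_apply (hasDerivAt_const t x)).inner ℝ
    (hasDerivAt_const t x)
  refine h.congr_deriv ?_
  simp [heatForm, pow_succ]

theorem heatForm_antitone (hD : IsUnitInterval D) (j : ℕ) (x : E) :
    Antitone fun t => heatForm D j t x :=
  antitone_of_hasDerivAt_nonpos (fun t => hasDerivAt_heatForm D j t x)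
    fun t => neg_nonpos.2 (heatForm_nonneg hD _ t x)

theorem heatForm_zero_eq (hD : IsUnitInterval D) (t : ℝ) (x : E) :
    heatForm D 0 t x = ‖heat D (t / 2) x‖ ^ 2 := by
  rw [heatForm, pow_zero, one_mul, ← real_inner_self_eq_norm_sq, ← hD.heat_symm,
    ← mul_apply_eq_comp, ← heat_add, add_halves]

/-- The form at level `j + 1` is minus the time derivative of the form at level `j` and is itself
decreasing. Hence `t / 2` times its value at `t` is at most the drop of level `j` over `[t / 2, t]`.
The summand `1` in `1 + t` is covered by `D ≤ 1`. -/
theorem one_add_mul_heatForm_succ_le (hD : IsUnitInterval D) (j : ℕ) {t : ℝ} (ht : 0 ≤ t) (x : E) :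
    (1 + t) * heatForm D (j + 1) t x ≤ 3 * heatForm D j (t / 2) x := by
  have h : AntitoneOn (fun s => heatForm D j s x + (s - t / 2) * heatForm D (j + 1) s x)
      (Icc (t / 2) t) := by
    have hd : ∀ s, HasDerivAt (fun s => heatForm D j s x + (s - t / 2) * heatForm D (j + 1) s x)
        (-((s - t / 2) * heatForm D (j + 2) s x)) s := fun s => by
      refine ((hasDerivAt_heatForm D j s x).add
        (((hasDerivAt_id s).sub_const (t / 2)).mul (hasDerivAt_heatForm D (j + 1) s x))).congr_deriv ?_
      simp
    refine antitoneOn_of_deriv_nonpos (convex_Icc _ _)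
      (fun s _ => (hd s).continuousAt.continuousWithinAt)
      (fun s _ => (hd s).differentiableAt.differentiableWithinAt) fun s hs => ?_
    rw [interior_Icc] at hs
    rw [(hd s).deriv, neg_nonpos]
    exact mul_nonneg (by linarith [hs.1]) (heatForm_nonneg hD _ _ _)
  have h1 := h (left_mem_Icc.2 (by linarith)) (right_mem_Icc.2 (by linarith)) (by linarith)
  have h2 := heatForm_succ_le hD j t x
  have h3 : heatForm D j t x ≤ heatForm D j (t / 2) x := heatForm_antitone hD j x (by linarith)
  have h4 := heatForm_nonneg hD j t x
  simp only [sub_self, zero_mul, add_zero] at h1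
  linarith

/-- The constant is chosen before the space and the operator, since the bound is needed both on `L²`
and on the form domain. Each step of the induction costs `3` and a halving of time. -/
theorem exists_heatForm_decay (a j : ℕ) : ∃ C : ℝ, 0 < C ∧
    ∀ {E : Type*} [NormedAddCommGroup E] [InnerProductSpace ℝ E] [CompleteSpace E]
      {D : E →L[ℝ] E}, IsUnitInterval D → ∀ (x : E) (B : ℝ),
      (∀ t, 0 ≤ t → heatForm D 0 t x * (1 + t) ^ a ≤ B) →
      ∀ t, 0 ≤ t → heatForm D j t x * (1 + t) ^ (a + j) ≤ C * B := by
  induction j with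
  | zero => exact ⟨1, one_pos, fun _ x B h t ht => by simpa using h t ht⟩
  | succ j ih =>
    obtain ⟨C, hC, h⟩ := ih
    refine ⟨3 * 2 ^ (a + j) * C, by positivity, fun hD x B hB t ht => ?_⟩
    have h1 := one_add_mul_heatForm_succ_le hD j ht x
    have h2 := h hD x B hB (t / 2) (by positivity)
    have h3 : (1 + t) ^ (a + j) ≤ 2 ^ (a + j) * (1 + t / 2) ^ (a + j) := by
      rw [← mul_pow]
      exact pow_le_pow_left₀ (by positivity) (by linarith) _
    have h4 := heatForm_nonneg hD j (t / 2) x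
    calc _ = (1 + t) * heatForm _ (j + 1) t x * (1 + t) ^ (a + j) := by ring
      _ ≤ 3 * heatForm _ j (t / 2) x * (2 ^ (a + j) * (1 + t / 2) ^ (a + j)) := by gcongr
      _ = 3 * 2 ^ (a + j) * (heatForm _ j (t / 2) x * (1 + t / 2) ^ (a + j)) := by ring
      _ ≤ 3 * 2 ^ (a + j) * (C * B) := by gcongr
      _ = _ := by ring

/-- If `1 - D` is injective then `D ^ N` tends weakly to `0`. -/
theorem IsUnitInterval.tendsto_pow (hD : IsUnitInterval D) (hi : ∀ x, D x = x → x = 0) (x : E) :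
    Filter.Tendsto (fun N : ℕ => ⟪(D ^ N) x, x⟫) Filter.atTop (nhds 0) := by
  have hanti : Antitone fun N : ℕ => ⟪(D ^ N) x, x⟫ := antitone_nat_of_succ_le fun N => by
    simpa [heatForm, heat_zero] using heatForm_succ_le hD N 0 x
  have hnn : ∀ N : ℕ, 0 ≤ ⟪(D ^ N) x, x⟫ := fun N => by
    simpa [heatForm, heat_zero] using heatForm_nonneg hD N 0 x
  obtain ⟨L, hL⟩ : ∃ L, Filter.Tendsto (fun N : ℕ => ⟪(D ^ N) x, x⟫) Filter.atTop (nhds L) :=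
    ⟨_, tendsto_atTop_ciInf hanti ⟨0, by rintro _ ⟨N, rfl⟩; exact hnn N⟩⟩
  -- By symmetry the distances between iterates depend only on the scalar sequence `⟪(D ^ k) x, x⟫`.
  -- It converges, so the iterates are Cauchy and their limit is a fixed point of `D`.
  have hdist : ∀ M N : ℕ, dist ((D ^ M) x) ((D ^ N) x) ^ 2 =
      ⟪(D ^ (M + M)) x, x⟫ - 2 * ⟪(D ^ (M + N)) x, x⟫ + ⟪(D ^ (N + N)) x, x⟫ := fun M N => by
    have key : ∀ a b : ℕ, ⟪(D ^ (a + b)) x, x⟫ = ⟪(D ^ a) x, (D ^ b) x⟫ := fun a b => by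
      rw [add_comm a b, pow_add, mul_apply_eq_comp, hD.pow_symm]
    rw [dist_eq_norm, norm_sub_sq_real, key, key, key, real_inner_self_eq_norm_sq,
      real_inner_self_eq_norm_sq]
  have hcauchy : CauchySeq fun N : ℕ => (D ^ N) x := by
    rw [Metric.cauchySeq_iff']
    intro ε hε
    have hc := hL.cauchySeq
    rw [Metric.cauchySeq_iff] at hc
    obtain ⟨N, hN⟩ := hc (ε ^ 2 / 4) (by positivity)
    refine ⟨N, fun M hM => ?_⟩
    have h1 := hN (M + M) (by linarith) (M + N) (by linarith)
    have h2 := hN (N + N) (by linarith) (M + N) (by linarith)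
    rw [Real.dist_eq, abs_lt] at h1 h2
    have h3 := hdist M N
    refine lt_of_pow_lt_pow_left₀ 2 hε.le ?_
    nlinarith [sq_nonneg ε, pow_pos hε 2]
  obtain ⟨y, hy⟩ := cauchySeq_tendsto_of_complete hcauchy
  have hDy : D y = y := by
    refine tendsto_nhds_unique ((D.continuous.tendsto y).comp hy) ?_
    refine ((Filter.tendsto_add_atTop_iff_nat 1).2 hy).congr fun N => ?_
    simp [pow_succ']
  rw [hi y hDy] at hy
  have := Filter.Tendsto.inner (𝕜 := ℝ) hy (tendsto_const_nhds (x := x))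
  simpa using this

end Operators

/-! ### The damped wave equation in terms of the resolvent -/

section Energy

open scoped RealInnerProductSpace Topology

variable {E : Type*} [NormedAddCommGroup E] [InnerProductSpace ℝ E]

/-- Here `q` is only continuous and just `R q` is differentiable, as for `w`, whose derivative
exists only after applying `1 - D`. Symmetry factors the increment of the quadratic form as `⟪M (R
q(s) - R q(t)), q(s) + q(t)⟫`, so no difference quotient of `q` appears. -/
theorem hasDerivAt_inner_of_symm {M : ℝ → E →L[ℝ] E} {M' R : E →L[ℝ] E} {q : ℝ → E} {z : E} {t : ℝ}
    (hM : HasDerivAt M M' t) (hs : ∀ x y, ⟪M t (R x), y⟫ = ⟪x, M t (R y)⟫) (hq : ContinuousAt q t)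
    (hRq : HasDerivAt (fun s => R (q s)) z t) :
    HasDerivAt (fun s => ⟪M s (R (q s)), q s⟫) (⟪M' (R (q t)), q t⟫ + 2 * ⟪M t z, q t⟫) t := by
  rw [hasDerivAt_iff_tendsto_slope] at hM hRq ⊢
  have hq' : Filter.Tendsto q (𝓝[≠] t) (𝓝 (q t)) := hq.tendsto.mono_left nhdsWithin_le_nhds
  have hR : Filter.Tendsto (fun s => R (q s)) (𝓝[≠] t) (𝓝 (R (q t))) := (R.continuous.tendsto _).comp hq'
  have h0 : Filter.Tendsto (fun s => slope M t s (R (q s))) (𝓝[≠] t) (𝓝 (M' (R (q t)))) :=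
    (isBoundedBilinearMap_apply.continuous.tendsto (M', R (q t))).comp (Filter.Tendsto.prodMk_nhds hM hR)
  have h1 := Filter.Tendsto.inner (𝕜 := ℝ) h0 hq'
  have h2 := Filter.Tendsto.inner (𝕜 := ℝ) (((M t).continuous.tendsto _).comp hRq)
    (hq'.add (tendsto_const_nhds (x := q t)))
  have h3 := h1.add h2
  have e : ⟪M' (R (q t)), q t⟫ + 2 * ⟪M t z, q t⟫ = ⟪M' (R (q t)), q t⟫ + ⟪M t z, q t + q t⟫ := by
    rw [inner_add_right]; ring
  rw [e]
  refine h3.congr fun s => ?_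
  simp only [slope_def_module, Function.comp, smul_apply, sub_apply, map_smul, map_sub,
    inner_smul_left, inner_sub_left, inner_add_right, RCLike.conj_to_real, smul_eq_mul]
  rw [hs (q s) (q t), real_inner_comm (M t (R (q t))) (q s)]
  ring

variable [CompleteSpace E] {D : E →L[ℝ] E}

/-- Without the weight, the derivative of the energy is `-⟪D u, u⟫ - ⟪(1 - D) w, w⟫`. The backward
heat weight `exp (-(T - t) D / 2)` adds `D / 2` times the energy, and the dissipation absorbs this.
-/
theorem heat_energy_antitoneOn (hD : IsUnitInterval D) {u w : ℝ → E}
    (hu : ContinuousOn u (Ici 0)) (hw : ContinuousOn w (Ici 0))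
    (hu' : ∀ t, 0 < t → HasDerivAt u (w t) t)
    (hw' : ∀ t, 0 < t → HasDerivAt (fun t => (1 - D) (w t)) (-(D (u t)) - (1 - D) (w t)) t)
    (j : ℕ) (T : ℝ) :
    AntitoneOn (fun t =>
      (1 / 2) * ⟪(D ^ j * heat D ((T - t) / 2)) ((1 - D) (u t + w t)), u t + w t⟫ +
      (1 / 2) * ⟪(D ^ j * heat D ((T - t) / 2)) ((1 - D) (w t)), w t⟫ +
      ⟪(D ^ j * heat D ((T - t) / 2)) (D (u t)), u t⟫) (Icc 0 T) := by
  set M : ℝ → E →L[ℝ] E := fun t => D ^ j * heat D ((T - t) / 2) with hMdef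
  have hG : ∀ t, HasDerivAt (fun t => heat D ((T - t) / 2)) ((1 / 2 : ℝ) • (D * heat D ((T - t) / 2))) t := by
    intro t
    have := (hasDerivAt_heat D ((T - t) / 2)).scomp t (((hasDerivAt_id t).const_sub T).div_const 2)
    refine this.congr_deriv ?_
    rw [smul_neg, ← neg_smul]
    norm_num
  have hcM : ∀ t, Commute D (M t) := fun t =>
    (Commute.pow_right (Commute.refl D) j).mul_right (heat_commute (Commute.refl D) _)
  have hM : ∀ t, HasDerivAt M ((1 / 2 : ℝ) • (D * M t)) t := by
    intro t
    refine ((hG t).const_mul (D ^ j)).congr_deriv ?_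
    rw [mul_smul_comm, hMdef, ← mul_assoc, ← mul_assoc, ← pow_succ, ← pow_succ']
  have hMc : Continuous M := continuous_iff_continuousAt.2 fun t => (hM t).continuousAt
  have hcM' : ∀ t x, M t (D x) = D (M t x) := fun t x => by
    rw [← mul_apply_eq_comp, ← (hcM t).eq]; rfl
  have hMs : ∀ t x y, ⟪M t x, y⟫ = ⟪x, M t y⟫ := fun t x y => by
    have hc : Commute (D ^ j) (heat D ((T - t) / 2)) :=
      heat_commute (Commute.pow_left (Commute.refl D) j) _
    calc ⟪M t x, y⟫ = ⟪x, (heat D ((T - t) / 2) * D ^ j) y⟫ := by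
          rw [hMdef]
          change ⟪(D ^ j) (heat D ((T - t) / 2) x), y⟫ = ⟪x, heat D ((T - t) / 2) ((D ^ j) y)⟫
          rw [hD.pow_symm, hD.heat_symm]
      _ = _ := by rw [← hc.eq]
  have hMDs : ∀ t x y, ⟪M t (D x), y⟫ = ⟪x, M t (D y)⟫ := fun t x y => by
    rw [hcM', hD.symm, hMs, hcM' t y]
  have hMRs : ∀ t x y, ⟪M t ((1 - D) x), y⟫ = ⟪x, M t ((1 - D) y)⟫ := fun t x y => by
    simp only [sub_apply, one_apply_eq_self, map_sub, inner_sub_left,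
      inner_sub_right, hMs t x y, hMDs t x y]
  have hcont : ∀ (S : E →L[ℝ] E) (q : ℝ → E), ContinuousOn q (Ici 0) →
      ContinuousOn (fun t => ⟪M t (S (q t)), q t⟫) (Icc 0 T) := fun S q hq => by
    replace hq := hq.mono (Icc_subset_Ici_self : Icc 0 T ⊆ _)
    exact (hMc.continuousOn.clm_apply (S.continuous.comp_continuousOn hq)).inner hq
  have hd : ∀ t, 0 < t → HasDerivAt (fun t =>
      (1 / 2) * ⟪M t ((1 - D) (u t + w t)), u t + w t⟫ +
      (1 / 2) * ⟪M t ((1 - D) (w t)), w t⟫ + ⟪M t (D (u t)), u t⟫) 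
      ((1 / 2) * (⟪((1 / 2 : ℝ) • (D * M t)) ((1 - D) (u t + w t)), u t + w t⟫ +
          2 * ⟪M t (-D (u t)), u t + w t⟫) +
        (1 / 2) * (⟪((1 / 2 : ℝ) • (D * M t)) ((1 - D) (w t)), w t⟫ +
          2 * ⟪M t (-(D (u t)) - (1 - D) (w t)), w t⟫) +
        (⟪((1 / 2 : ℝ) • (D * M t)) (D (u t)), u t⟫ + 2 * ⟪M t (D (w t)), u t⟫)) t := by
    intro t ht
    have hwc : ContinuousAt w t := hw.continuousAt (Ici_mem_nhds ht)
    have huc : ContinuousAt u t := (hu' t ht).continuousAt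
    have h1 : HasDerivAt (fun s => (1 - D) (u s + w s)) (-D (u t)) t := by
      have := (((1 - D : E →L[ℝ] E).hasFDerivAt.comp_hasDerivAt t (hu' t ht)).add (hw' t ht))
      refine (this.congr_deriv ?_).congr_of_eventuallyEq (Filter.Eventually.of_forall fun s => ?_)
      · abel
      · simp only [map_add]; rfl
    exact (((hasDerivAt_inner_of_symm (hM t) (hMRs t) (huc.add hwc) h1).const_mul _).add
      ((hasDerivAt_inner_of_symm (hM t) (hMRs t) hwc (hw' t ht)).const_mul _)).add
      (hasDerivAt_inner_of_symm (hM t) (hMDs t) huc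
        (D.hasFDerivAt.comp_hasDerivAt t (hu' t ht)))
  refine antitoneOn_of_deriv_nonpos (convex_Icc _ _) ?_ ?_ ?_
  · exact ((continuousOn_const.mul (hcont _ _ (hu.add hw))).add
      (continuousOn_const.mul (hcont _ _ hw))).add (hcont _ _ hu)
  · rw [interior_Icc]
    exact fun t ht => (hd t ht.1).differentiableAt.differentiableWithinAt
  · rw [interior_Icc]
    intro t ht
    rw [(hd t ht.1).deriv]
    generalize u t = x
    generalize w t = y
    -- With `r = 1 - d`, `x = u t` and `y = w t`, minus the derivative is, at frequency `d` and up
    -- to the weight, `d² x² / 2 + d r x² / 2 + r² y² + d r y² / 4 + d r (x - y)² / 4`. The facts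
    -- `p2`, `p11`, `p02` are the positivity of `d²`, `d r`, `r²` under the weight.
    have p2 : ∀ x, 0 ≤ ⟪M t (D (D x)), x⟫ := fun x => by
      have := hD.nonneg_heat (j + 2) 0 ((T - t) / 2) x
      rw [pow_zero, mul_one, add_comm, pow_add, mul_assoc] at this
      rw [hcM', hcM']
      simpa [hMdef, pow_succ] using this
    have p11 : ∀ x, 0 ≤ ⟪M t (D x), x⟫ - ⟪M t (D (D x)), x⟫ := fun x => by
      have := hD.nonneg_heat (j + 1) 1 ((T - t) / 2) x
      rw [← heatForm_sub, heatForm, heatForm] at this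
      have e : ∀ k, (D ^ (j + k) * heat D ((T - t) / 2)) = D ^ k * M t := fun k => by
        rw [add_comm, pow_add, mul_assoc]
      rw [add_assoc, e, e] at this
      rw [hcM', hcM', hcM']
      simpa [pow_succ] using this
    have p02 : ∀ x, 0 ≤ ⟪M t x, x⟫ - 2 * ⟪M t (D x), x⟫ + ⟪M t (D (D x)), x⟫ := fun x => by
      have := hD.nonneg_heat j 2 ((T - t) / 2) x
      have e : D ^ j * (1 - D) ^ 2 * heat D ((T - t) / 2) = M t - (2 : ℝ) • (D * M t) + D * (D * M t) := by
        have hc : Commute (D ^ j) ((1 - D) ^ 2) :=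
          ((Commute.one_right _).sub_right (Commute.pow_left (Commute.refl D) j)).pow_right 2
        rw [hc.eq, mul_assoc]
        change (1 - D) ^ 2 * M t = _
        rw [two_smul]
        noncomm_ring
      rw [e] at this
      simpa [inner_add_left, inner_sub_left, inner_smul_left, hcM'] using this
    have s1 : ⟪M t (D x), y⟫ = ⟪M t (D y), x⟫ := by rw [hMDs, real_inner_comm]
    have s2 : ⟪M t (D (D x)), y⟫ = ⟪M t (D (D y)), x⟫ := by
      rw [hMDs, hcM' t (D y), hD.symm, real_inner_comm]
    have a1 := p2 x
    have a2 := p11 x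
    have a3 := p11 y
    have a4 := p11 (x - y)
    have a5 := p02 y
    have a6 := p2 y
    clear hd hcont hMRs hMDs hMs p02 p11 p2 hw' hu' hM
    simp only [sub_apply, smul_apply, mul_apply_eq_comp, ← hcM' t,
      one_apply_eq_self, map_sub, map_add, map_neg, inner_add_left,
      inner_add_right, inner_sub_left, inner_sub_right, inner_smul_left, inner_neg_left,
      RCLike.conj_to_real] at a1 a2 a3 a4 a5 a6 s1 s2 ⊢
    linarith

/-- The weight is `D ^ j` at `t = T` and `D ^ j exp (-T D / 2)` at `t = 0`. The parallelogram law,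
used for `u ± w` at time `0` and for `(u + w) ± w` at time `T`, compares the energy with the squares
of `u` and `w` separately; `11` is a convenient constant. -/
theorem energy_le (hD : IsUnitInterval D) {u w : ℝ → E}
    (hu : ContinuousOn u (Ici 0)) (hw : ContinuousOn w (Ici 0))
    (hu' : ∀ t, 0 < t → HasDerivAt u (w t) t)
    (hw' : ∀ t, 0 < t → HasDerivAt (fun t => (1 - D) (w t)) (-(D (u t)) - (1 - D) (w t)) t)
    (j : ℕ) {T : ℝ} (hT : 0 ≤ T) :
    heatForm D j 0 (u T) + (heatForm D j 0 (w T) - heatForm D (j + 1) 0 (w T)) ≤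
      11 * (heatForm D j (T / 2) (u 0) +
        (heatForm D j (T / 2) (w 0) - heatForm D (j + 1) (T / 2) (w 0))) := by
  have h := heat_energy_antitoneOn hD hu hw hu' hw' j T (left_mem_Icc.2 hT) (right_mem_Icc.2 hT) hT
  simp only [sub_self, sub_zero, zero_div] at h
  have hc : ∀ t, Commute D (heat D t) := heat_commute (Commute.refl D)
  have e1 : ∀ t x, ⟪(D ^ j * heat D t) (D x), x⟫ = heatForm D (j + 1) t x := fun t x => by
    rw [heatForm, pow_succ, mul_assoc, (hc t).eq, ← mul_assoc]; rfl
  have e2 : ∀ t x, ⟪(D ^ j * heat D t) ((1 - D) x), x⟫ = heatForm D j t x - heatForm D (j + 1) t x :=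
    fun t x => by
    rw [sub_apply, map_sub, inner_sub_left, e1]; rfl
  simp only [e1, e2] at h
  have par : ∀ k t x y, heatForm D k t (x + y) + heatForm D k t (x - y) =
      2 * heatForm D k t x + 2 * heatForm D k t y := fun k t x y => by
    simp only [heatForm, map_add, map_sub, inner_add_left, inner_add_right, inner_sub_left,
      inner_sub_right]
    ring
  have f1 := par j (T / 2) (u 0) (w 0)
  have f2 := par (j + 1) (T / 2) (u 0) (w 0)
  have f3 := par j 0 (u T + w T) (w T)
  have f4 := par (j + 1) 0 (u T + w T) (w T)
  rw [add_sub_cancel_right] at f3 f4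
  have g1 := heatForm_succ_le hD j (T / 2) (u 0 - w 0)
  have g2 := heatForm_succ_le hD j 0 (u T + w T + w T)
  have g3 := heatForm_succ_le hD j 0 (u T + w T)
  have g4 := heatForm_succ_le hD j 0 (w T)
  have g5 := heatForm_nonneg hD (j + 1) 0 (u T)
  have g6 := heatForm_succ_le hD j (T / 2) (w 0)
  have g7 := heatForm_nonneg hD (j + 1) (T / 2) (u 0)
  have g8 := heatForm_succ_le hD j (T / 2) (u 0)
  linarith

end Energy

/-! ### The resolvent of a form domain -/

theorem sum_heatForm_sub {E : Type*} [NormedAddCommGroup E] [InnerProductSpace ℝ E] {D : E →L[ℝ] E} (k N : ℕ) (t : ℝ) (x : E) :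
    ∑ i ∈ Finset.range N, (heatForm D (k + i) t x - heatForm D (k + i + 1) t x) =
      heatForm D k t x - heatForm D (k + N) t x :=
  Finset.sum_range_sub' (fun i => heatForm D (k + i) t x) N

theorem pow_intertwine {E V : Type*} [NormedAddCommGroup E] [NormedSpace ℝ E]
    [NormedAddCommGroup V] [NormedSpace ℝ V] {J : V →L[ℝ] E} {A : E →L[ℝ] E} {B : V →L[ℝ] V}
    (h : ∀ v, A (J v) = J (B v)) (k : ℕ) (v : V) :
    (A ^ k) (J v) = J ((B ^ k) v) := by
  induction k generalizing v with
  | zero => simp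
  | succ k ih => rw [pow_succ, pow_succ, mul_apply_eq_comp, mul_apply_eq_comp, ← ih, h]

section FormDomain

open scoped RealInnerProductSpace Topology

variable {E V : Type*} [NormedAddCommGroup E] [InnerProductSpace ℝ E] [CompleteSpace E]
  [NormedAddCommGroup V] [InnerProductSpace ℝ V] [CompleteSpace V]

/-- For the embedding `J` of a form domain `V` into `E`, the operator `1 - (1 + A)⁻¹` on `E`. -/
noncomputable def defect (J : V →L[ℝ] E) : E →L[ℝ] E := 1 - J ∘L J.adjoint

/-- The operator `1 - (1 + A)⁻¹` on the form domain. -/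
noncomputable def formDefect (J : V →L[ℝ] E) : V →L[ℝ] V := 1 - J.adjoint ∘L J

variable {J : V →L[ℝ] E}

theorem one_sub_defect_apply (J : V →L[ℝ] E) (x : E) : (1 - defect J) x = J (J.adjoint x) := by
  simp [defect]

theorem norm_adjoint_apply_le (hJ : ∀ v, ‖J v‖ ≤ ‖v‖) (x : E) : ‖J.adjoint x‖ ≤ ‖x‖ := by
  have h1 : ‖J.adjoint‖ ≤ 1 := by
    rw [LinearIsometryEquiv.norm_map]
    exact J.opNorm_le_bound zero_le_one fun v => by simpa using hJ v
  simpa using J.adjoint.le_of_opNorm_le h1 x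

theorem isUnitInterval_defect (hJ : ∀ v, ‖J v‖ ≤ ‖v‖) : IsUnitInterval (defect J) where
  symm x y := by
    simp [defect, inner_sub_left, inner_sub_right, ← ContinuousLinearMap.adjoint_inner_right]
  nonneg x := by
    have := norm_adjoint_apply_le hJ x
    have h2 : ⟪J (J.adjoint x), x⟫ = ‖J.adjoint x‖ ^ 2 := by
      rw [← ContinuousLinearMap.adjoint_inner_right, real_inner_self_eq_norm_sq]
    simp only [defect, sub_apply, one_apply_eq_self, inner_sub_left, ContinuousLinearMap.comp_apply, h2,
      real_inner_self_eq_norm_sq]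
    nlinarith [norm_nonneg (J.adjoint x)]
  le_one x := by
    have h2 : ⟪J (J.adjoint x), x⟫ = ‖J.adjoint x‖ ^ 2 := by
      rw [← ContinuousLinearMap.adjoint_inner_right, real_inner_self_eq_norm_sq]
    simp only [defect, sub_apply, one_apply_eq_self, inner_sub_left, ContinuousLinearMap.comp_apply, h2,
      real_inner_self_eq_norm_sq]
    nlinarith [norm_nonneg (J.adjoint x)]

/-- For the Sobolev embedding the right side is the squared norm of the horizontal gradient. -/
theorem inner_formDefect (J : V →L[ℝ] E) (v : V) : ⟪formDefect J v, v⟫ = ‖v‖ ^ 2 - ‖J v‖ ^ 2 := by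
  simp [formDefect, inner_sub_left, ContinuousLinearMap.adjoint_inner_left]

theorem isUnitInterval_formDefect (hJ : ∀ v, ‖J v‖ ≤ ‖v‖) : IsUnitInterval (formDefect J) where
  symm x y := by
    simp [formDefect, inner_sub_left, inner_sub_right, ContinuousLinearMap.adjoint_inner_right,
      ContinuousLinearMap.adjoint_inner_left]
  nonneg v := by
    rw [inner_formDefect]
    nlinarith [hJ v, norm_nonneg (J v)]
  le_one v := by
    rw [inner_formDefect, real_inner_self_eq_norm_sq]
    nlinarith [norm_nonneg (J v)]

theorem formDefect_fixed (hi : Function.Injective J) (v : V) (hv : formDefect J v = v) : v = 0 := by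
  have h := inner_formDefect J v
  rw [hv, real_inner_self_eq_norm_sq] at h
  have : ‖J v‖ = 0 := by nlinarith
  exact hi (by simpa using this)

theorem defect_fixed (hd : DenseRange J) (x : E) (hx : defect J x = x) : x = 0 := by
  have h : J (J.adjoint x) = 0 := by simpa [defect] using hx
  have h2 : ⟪J (J.adjoint x), x⟫ = ‖J.adjoint x‖ ^ 2 := by
    rw [← ContinuousLinearMap.adjoint_inner_right, real_inner_self_eq_norm_sq]
  have h3 : J.adjoint x = 0 := by simpa [h] using h2.symm
  refine hd.eq_zero_of_inner_left (𝕜 := ℝ) fun v => ?_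
  rw [real_inner_comm, ← ContinuousLinearMap.adjoint_inner_right, h3, inner_zero_right]

theorem defect_comp (J : V →L[ℝ] E) (v : V) : defect J (J v) = J (formDefect J v) := by
  simp [defect, formDefect]

theorem heat_defect_comp (J : V →L[ℝ] E) (t : ℝ) (v : V) :
    heat (defect J) t (J v) = J (heat (formDefect J) t v) := by
  have h1 := (NormedSpace.exp_series_hasSum_exp' (𝕂 := ℝ) (t • (-defect J))).mapL
    (ContinuousLinearMap.apply ℝ E (J v))
  have h2 := ((NormedSpace.exp_series_hasSum_exp' (𝕂 := ℝ) (t • (-formDefect J))).mapL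
    (ContinuousLinearMap.apply ℝ V v)).mapL J
  refine h1.unique ?_
  convert h2 using 2 with k
  · simp only [ContinuousLinearMap.apply_apply, map_smul]
    congr 1
    exact pow_intertwine (fun v => by simp [defect_comp]) k v
  · rfl

/-- Since `J* J` is `1` minus the defect on `V`, forms on `E` become differences of consecutive
forms on `V`. Their sums over `j` therefore telescope. -/
theorem heatForm_defect_apply (J : V →L[ℝ] E) (j : ℕ) (t : ℝ) (v : V) :
    heatForm (defect J) j t (J v) = heatForm (formDefect J) j t v - heatForm (formDefect J) (j + 1) t v := by
  rw [heatForm, mul_apply_eq_comp, heat_defect_comp, pow_intertwine (defect_comp J),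
    ← ContinuousLinearMap.adjoint_inner_left, heatForm, heatForm, pow_succ', ← inner_sub_left]
  simp [formDefect]

theorem sum_heatForm_defect (J : V →L[ℝ] E) (k N : ℕ) (t : ℝ) (v : V) :
    ∑ i ∈ Finset.range N, heatForm (defect J) (k + i) t (J v) =
      heatForm (formDefect J) k t v - heatForm (formDefect J) (k + N) t v := by
  simp only [heatForm_defect_apply]
  exact Finset.sum_range_sub' (fun i => heatForm (formDefect J) (k + i) t v) N

/-- This is the geometric series `d / (1 - d) = ∑_{i ≥ 1} d ^ i` for `A` in terms of `D`. The
partial sums telescope on `V`, and the remainder vanishes because `J` is injective. -/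
theorem sq_sub_sq_le_of_sum_le (hJ : ∀ v, ‖J v‖ ≤ ‖v‖) (hi : Function.Injective J) (v : V) {B : ℝ}
    (h : ∀ N, ∑ i ∈ Finset.range N, heatForm (defect J) (1 + i) 0 (J v) ≤ B) :
    ‖v‖ ^ 2 - ‖J v‖ ^ 2 ≤ B := by
  have h1 := (isUnitInterval_formDefect hJ).tendsto_pow (formDefect_fixed hi) v
  have h2 := (tendsto_const_nhds (x := ‖v‖ ^ 2 - ‖J v‖ ^ 2)).sub
    ((Filter.tendsto_add_atTop_iff_nat 1).2 h1)
  rw [sub_zero] at h2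
  refine le_of_tendsto h2 (Filter.Eventually.of_forall fun N => ?_)
  refine le_trans (le_of_eq ?_) (h N)
  rw [sum_heatForm_defect, ← inner_formDefect]
  simp [heatForm, heat_zero, add_comm 1 N]

/-- The series here is `d² = ∑_{i ≥ 2} d ^ i (1 - d)`; dense range excludes the frequency `d = 1`
and kills the remainder. -/
theorem norm_sq_defect_le_of_sum_le (hJ : ∀ v, ‖J v‖ ≤ ‖v‖) (hd : DenseRange J) (x : E) {B : ℝ}
    (h : ∀ N, ∑ i ∈ Finset.range N,
      (heatForm (defect J) (2 + i) 0 x - heatForm (defect J) (2 + i + 1) 0 x) ≤ B) :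
    ‖defect J x‖ ^ 2 ≤ B := by
  have hD := isUnitInterval_defect hJ
  have h1 := hD.tendsto_pow (defect_fixed hd) x
  have h2 := (tendsto_const_nhds (x := ‖defect J x‖ ^ 2)).sub
    ((Filter.tendsto_add_atTop_iff_nat 2).2 h1)
  rw [sub_zero] at h2
  refine le_of_tendsto h2 (Filter.Eventually.of_forall fun N => ?_)
  refine le_trans (le_of_eq ?_) (h N)
  rw [sum_heatForm_sub, ← real_inner_self_eq_norm_sq, hD.symm, real_inner_comm]
  simp [heatForm, heat_zero, add_comm 2 N]

/-- Comparison with a polynomially decaying supersolution of `f' = - f`. -/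
theorem le_of_deriv_le_neg_add {f f' : ℝ → ℝ} {K : ℝ} (p : ℕ) (hf : ContinuousOn f (Ici 0))
    (hf' : ∀ t, 0 < t → HasDerivAt f (f' t) t) (h0 : 0 ≤ f 0) (hK : 0 ≤ K)
    (h : ∀ t, 0 < t → (f' t + f t) * (1 + t) ^ p ≤ K) {t : ℝ} (ht : 0 ≤ t) :
    f t * (1 + t) ^ p ≤ (2 * (p + 1)) ^ p * (f 0 + 2 * K) := by
  -- The supersolution is `L (1 + c s) ^ (-p)`. As `c p ≤ 1 / 2`, its derivative costs at most half
  -- of its value, and the other half of `L` dominates `K`.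
  set c : ℝ := 1 / (2 * (p + 1)) with hc
  have hc0 : 0 < c := by positivity
  have hc1 : c ≤ 1 := by rw [hc, div_le_one (by positivity)]; linarith [(Nat.cast_nonneg p : (0 : ℝ) ≤ p)]
  have hcp : c * p ≤ 1 / 2 := by
    rw [hc, div_mul_eq_mul_div, one_mul, div_le_div_iff₀ (by positivity) (by positivity)]
    linarith
  set L := f 0 + 2 * K with hL
  have hpos : ∀ s : ℝ, 0 ≤ s → 0 < 1 + c * s := fun s hs => by positivity
  have hd : ∀ s, 0 < s → HasDerivAt (fun s => Real.exp s * (f s - L * ((1 + c * s) ^ p)⁻¹))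
      (Real.exp s * (f s - L * ((1 + c * s) ^ p)⁻¹) +
        Real.exp s * (f' s - L * (-(p * (1 + c * s) ^ (p - 1) * c) / ((1 + c * s) ^ p) ^ 2))) s := by
    intro s hs
    have h1 : HasDerivAt (fun s : ℝ => 1 + c * s) c s := by
      simpa using ((hasDerivAt_id s).const_mul c).const_add 1
    exact (Real.hasDerivAt_exp s).mul ((hf' s hs).sub
      (((h1.pow p).inv (pow_pos (hpos s hs.le) p).ne').const_mul L))
  have hanti : AntitoneOn (fun s => Real.exp s * (f s - L * ((1 + c * s) ^ p)⁻¹)) (Icc 0 t) := by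
    refine antitoneOn_of_deriv_nonpos (convex_Icc _ _) ?_ ?_ ?_
    · have hf2 : ContinuousOn f (Icc 0 t) := hf.mono Icc_subset_Ici_self
      refine Real.continuous_exp.continuousOn.mul (hf2.sub (continuousOn_const.mul
        (ContinuousOn.inv₀ (by fun_prop) fun s hs => (pow_pos (hpos s hs.1) p).ne')))
    · rw [interior_Icc]
      exact fun s hs => (hd s hs.1).differentiableAt.differentiableWithinAt
    · rw [interior_Icc]
      intro s hs
      rw [(hd s hs.1).deriv, ← mul_add]
      refine mul_nonpos_of_nonneg_of_nonpos (Real.exp_pos s).le ?_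
      have hX := hpos s hs.1.le
      set X := 1 + c * s with hXdef
      have hX1 : 1 ≤ X := by have := mul_nonneg hc0.le hs.1.le; linarith
      have hXle : X ≤ 1 + s := by nlinarith [hs.1]
      have hk := h s hs.1
      have e1 : -(p * X ^ (p - 1) * c) / (X ^ p) ^ 2 ≥ -(1 / 2) * (X ^ p)⁻¹ := by
        rw [ge_iff_le, neg_mul, neg_div, neg_le_neg_iff, pow_two, ← div_eq_mul_inv, ← div_div]
        refine div_le_div_of_nonneg_right ?_ (by positivity)
        rw [div_le_iff₀ (by positivity)]
        have : X ^ (p - 1) ≤ X ^ p := pow_le_pow_right₀ hX1 (Nat.sub_le _ _)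
        calc p * X ^ (p - 1) * c = c * p * X ^ (p - 1) := by ring
          _ ≤ 1 / 2 * X ^ p := by gcongr
      have e2 : f' s + f s ≤ K * (X ^ p)⁻¹ := by
        rw [← div_eq_mul_inv, le_div_iff₀ (by positivity)]
        by_cases hn : 0 ≤ f' s + f s
        · exact (mul_le_mul_of_nonneg_left (pow_le_pow_left₀ hX.le hXle p) hn).trans hk
        · exact (mul_nonpos_of_nonpos_of_nonneg (not_le.1 hn).le (by positivity)).trans hK
      have hLnn : 0 ≤ L := by positivity
      have e3 := mul_le_mul_of_nonneg_left e1 hLnn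
      have e4 : 0 ≤ f 0 * (X ^ p)⁻¹ := by positivity
      rw [hL] at e3 ⊢
      linarith
  have h1 := hanti (left_mem_Icc.2 ht) (right_mem_Icc.2 ht) ht
  simp only [Real.exp_zero, mul_zero, add_zero, one_pow, inv_one, mul_one, one_mul] at h1
  have h2 : f t - L * ((1 + c * t) ^ p)⁻¹ ≤ 0 := by
    by_contra hcon
    have := mul_pos (Real.exp_pos t) (not_le.1 hcon)
    linarith
  have h3 : (1 + t) ^ p ≤ (2 * (p + 1)) ^ p * (1 + c * t) ^ p := by
    rw [← mul_pow]
    refine pow_le_pow_left₀ (by positivity) ?_ p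
    have : (2 * ((p : ℝ) + 1)) * c = 1 := by rw [hc]; field_simp
    have hp0 : (0 : ℝ) ≤ p := Nat.cast_nonneg p
    nlinarith
  have hLnn : 0 ≤ L := by positivity
  have hXp := pow_pos (hpos t ht) p
  calc f t * (1 + t) ^ p ≤ L * ((1 + c * t) ^ p)⁻¹ * (1 + t) ^ p := by
        gcongr; linarith
    _ ≤ L * ((1 + c * t) ^ p)⁻¹ * ((2 * (p + 1)) ^ p * (1 + c * t) ^ p) := by gcongr
    _ = _ := by field_simp

end FormDomain

/-! ### Decay for the damped wave equation -/

section Decay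

open scoped RealInnerProductSpace Topology

/-- `u` has range in the form domain of `J`, is `C¹` with derivative `w`, and satisfies
`(1 + A)⁻¹ (u'' + u') = - A (1 + A)⁻¹ u`. -/
structure IsDampedWave {E V : Type*} [NormedAddCommGroup E] [InnerProductSpace ℝ E] [CompleteSpace E]
    [NormedAddCommGroup V] [InnerProductSpace ℝ V] [CompleteSpace V]
    (J : V →L[ℝ] E) (v : ℝ → V) (u w : ℝ → E) : Prop where
  eq : ∀ t, 0 ≤ t → u t = J (v t)
  cont : ContinuousOn u (Ici 0)
  cont' : ContinuousOn w (Ici 0)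
  deriv : ∀ t, 0 < t → HasDerivAt u (w t) t
  deriv' : ∀ t, 0 < t →
    HasDerivAt (fun t => (1 - defect J) (w t)) (-(defect J (u t)) - (1 - defect J) (w t)) t

variable {E V : Type*} [NormedAddCommGroup E] [InnerProductSpace ℝ E] [CompleteSpace E]
  [NormedAddCommGroup V] [InnerProductSpace ℝ V] [CompleteSpace V]
  {J : V →L[ℝ] E} {v : ℝ → V} {u w : ℝ → E}

theorem heatForm_le_of_le {D : E →L[ℝ] E} (hD : IsUnitInterval D) (j : ℕ) (t : ℝ) (x : E) {i : ℕ}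
    (h : j ≤ i) : heatForm D i t x ≤ heatForm D j t x :=
  antitone_nat_of_succ_le (f := fun i => heatForm D i t x) (fun i => heatForm_succ_le hD i t x) h

/-- Each of the first `a` terms is at most the leading one, and the rest telescopes to a form on `V`
of level `m + a`. That extra level supplies on `V` the rate `a` which the hypotheses give only for
the flow on `E`. -/
theorem sum_heatForm_defect_le (hJ : ∀ v, ‖J v‖ ≤ ‖v‖) (m a N : ℕ) (t : ℝ) (v : V) :
    ∑ i ∈ Finset.range N, heatForm (defect J) (m + i) t (J v) ≤
      a * heatForm (defect J) m t (J v) + heatForm (formDefect J) (m + a) t v := by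
  have hD := isUnitInterval_defect hJ
  calc ∑ i ∈ Finset.range N, heatForm (defect J) (m + i) t (J v)
      ≤ ∑ i ∈ Finset.range (a + N), heatForm (defect J) (m + i) t (J v) :=
        Finset.sum_le_sum_of_subset_of_nonneg (Finset.range_mono (Nat.le_add_left _ _))
          fun i _ _ => heatForm_nonneg hD _ _ _
    _ = ∑ i ∈ Finset.range a, heatForm (defect J) (m + i) t (J v) +
        ∑ i ∈ Finset.range N, heatForm (defect J) (m + a + i) t (J v) := by
        rw [Finset.sum_range_add]; simp only [add_assoc]
    _ ≤ ∑ i ∈ Finset.range a, heatForm (defect J) m t (J v) + heatForm (formDefect J) (m + a) t v := by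
        gcongr
        · exact heatForm_le_of_le hD _ _ _ (Nat.le_add_right _ _)
        · rw [sum_heatForm_defect]
          linarith [heatForm_nonneg (isUnitInterval_formDefect hJ) (m + a + N) t v]
    _ = _ := by simp

/-- The weighted energy estimates are summed over the weights `D ^ (m + i)`. On the data side the
`w` terms telescope directly, and the `u` terms split into decay on `E` at level `m` and decay on
`V` at level `m + a`, both of rate `a + m`. -/
theorem exists_sum_decay (a m : ℕ) : ∃ C : ℝ, 0 < C ∧
    ∀ {E V : Type*} [NormedAddCommGroup E] [InnerProductSpace ℝ E] [CompleteSpace E]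
      [NormedAddCommGroup V] [InnerProductSpace ℝ V] [CompleteSpace V]
      {J : V →L[ℝ] E} {v : ℝ → V} {u w : ℝ → E}, (∀ v, ‖J v‖ ≤ ‖v‖) → IsDampedWave J v u w →
      ∀ B : ℝ, (∀ t, 0 ≤ t → heatForm (defect J) 0 t (u 0) * (1 + t) ^ a ≤ B) →
      (∀ t, 0 ≤ t → heatForm (defect J) 0 t (w 0) * (1 + t) ^ a ≤ B) → ‖v 0‖ ^ 2 ≤ B →
      ∀ T, 0 ≤ T → ∀ N, (∑ i ∈ Finset.range N, (heatForm (defect J) (m + i) 0 (u T) +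
        (heatForm (defect J) (m + i) 0 (w T) - heatForm (defect J) (m + i + 1) 0 (w T)))) *
          (1 + T) ^ (a + m) ≤ C * B := by
  obtain ⟨C₁, hC₁, h₁⟩ := exists_heatForm_decay a m
  obtain ⟨C₂, hC₂, h₂⟩ := exists_heatForm_decay 0 (m + a)
  refine ⟨11 * 2 ^ (a + m) * (a * C₁ + C₂ + C₁), by positivity, ?_⟩
  intro E V _ _ _ _ _ _ J v u w hJ hw B hu0 hw0 hv0 T hT N
  have hD := isUnitInterval_defect hJ
  have hT2 : 0 ≤ T / 2 := by positivity
  have e1 := h₁ hD (u 0) B hu0 (T / 2) hT2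
  have e2 := h₁ hD (w 0) B hw0 (T / 2) hT2
  have e3 := h₂ (isUnitInterval_formDefect hJ) (v 0) B (fun t ht => by
    rw [pow_zero, mul_one]
    refine le_trans ?_ hv0
    rw [← heatForm_zero_zero (formDefect J)]
    exact heatForm_antitone (isUnitInterval_formDefect hJ) 0 (v 0) ht) (T / 2) hT2
  have e4 := sum_heatForm_defect_le hJ m a N (T / 2) (v 0)
  rw [← hw.eq 0 le_rfl] at e4
  have e5 := sum_heatForm_sub (D := defect J) m N (T / 2) (w 0)
  have e6 := heatForm_nonneg hD (m + N) (T / 2) (w 0)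
  have key : ∑ i ∈ Finset.range N, (heatForm (defect J) (m + i) 0 (u T) +
      (heatForm (defect J) (m + i) 0 (w T) - heatForm (defect J) (m + i + 1) 0 (w T))) ≤
      11 * (a * heatForm (defect J) m (T / 2) (u 0) + heatForm (formDefect J) (m + a) (T / 2) (v 0) +
        heatForm (defect J) m (T / 2) (w 0)) := by
    refine (Finset.sum_le_sum fun i _ => energy_le hD hw.cont hw.cont' hw.deriv hw.deriv' (m + i) hT).trans ?_
    rw [← Finset.mul_sum, Finset.sum_add_distrib]
    linarith
  have h3 : (1 + T) ^ (a + m) ≤ 2 ^ (a + m) * (1 + T / 2) ^ (a + m) := by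
    rw [← mul_pow]
    exact pow_le_pow_left₀ (by positivity) (by linarith) _
  have n1 := heatForm_nonneg hD m (T / 2) (u 0)
  have n2 := heatForm_nonneg hD m (T / 2) (w 0)
  have n3 := heatForm_nonneg (isUnitInterval_formDefect hJ) (m + a) (T / 2) (v 0)
  rw [zero_add, add_comm m a] at e3
  rw [add_comm m a] at n3 key
  set X := (1 + T / 2) ^ (a + m)
  have hX : 0 < X := by positivity
  calc _ ≤ 11 * (a * heatForm (defect J) m (T / 2) (u 0) + heatForm (formDefect J) (a + m) (T / 2) (v 0) +
        heatForm (defect J) m (T / 2) (w 0)) * (2 ^ (a + m) * X) := by gcongr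
    _ = 11 * 2 ^ (a + m) * (a * (heatForm (defect J) m (T / 2) (u 0) * X) +
        heatForm (formDefect J) (a + m) (T / 2) (v 0) * X + heatForm (defect J) m (T / 2) (w 0) * X) := by
        ring
    _ ≤ 11 * 2 ^ (a + m) * (a * (C₁ * B) + C₂ * B + C₁ * B) := by gcongr
    _ = _ := by ring

theorem norm_sq_decay (hJ : ∀ v, ‖J v‖ ≤ ‖v‖) (hw : IsDampedWave J v u w) (a : ℕ) {B : ℝ}
    (hu0 : ∀ t, 0 ≤ t → heatForm (defect J) 0 t (u 0) * (1 + t) ^ a ≤ B)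
    (hw0 : ∀ t, 0 ≤ t → heatForm (defect J) 0 t (w 0) * (1 + t) ^ a ≤ B) {T : ℝ} (hT : 0 ≤ T) :
    ‖u T‖ ^ 2 * (1 + T) ^ a ≤ 22 * 2 ^ a * B := by
  have hD := isUnitInterval_defect hJ
  have h := energy_le hD hw.cont hw.cont' hw.deriv hw.deriv' 0 hT
  rw [heatForm_zero_zero] at h
  have h1 := heatForm_succ_le hD 0 0 (w T)
  have h2 := heatForm_nonneg hD (0 + 1) (T / 2) (w 0)
  have hT2 : 0 ≤ T / 2 := by positivity
  have e1 := hu0 (T / 2) hT2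
  have e2 := hw0 (T / 2) hT2
  have h3 : (1 + T) ^ a ≤ 2 ^ a * (1 + T / 2) ^ a := by
    rw [← mul_pow]
    exact pow_le_pow_left₀ (by positivity) (by linarith) _
  have n1 := heatForm_nonneg hD 0 (T / 2) (u 0)
  have n2 := heatForm_nonneg hD 0 (T / 2) (w 0)
  calc _ ≤ 11 * (heatForm (defect J) 0 (T / 2) (u 0) + heatForm (defect J) 0 (T / 2) (w 0)) *
        (2 ^ a * (1 + T / 2) ^ a) := by gcongr; linarith
    _ = 11 * 2 ^ a * (heatForm (defect J) 0 (T / 2) (u 0) * (1 + T / 2) ^ a +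
        heatForm (defect J) 0 (T / 2) (w 0) * (1 + T / 2) ^ a) := by ring
    _ ≤ 11 * 2 ^ a * (B + B) := by gcongr
    _ = _ := by ring

/-- Decay of the form energy and of the time derivative of a damped wave, if the heat flow of its
data decays polynomially. -/
theorem exists_energy_decay (a : ℕ) : ∃ C : ℝ, 0 < C ∧
    ∀ {E V : Type*} [NormedAddCommGroup E] [InnerProductSpace ℝ E] [CompleteSpace E]
      [NormedAddCommGroup V] [InnerProductSpace ℝ V] [CompleteSpace V]
      {J : V →L[ℝ] E} {v : ℝ → V} {u w : ℝ → E}, (∀ v, ‖J v‖ ≤ ‖v‖) → Function.Injective J →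
      DenseRange J → IsDampedWave J v u w →
      ∀ B : ℝ, (∀ t, 0 ≤ t → heatForm (defect J) 0 t (u 0) * (1 + t) ^ a ≤ B) →
      (∀ t, 0 ≤ t → heatForm (defect J) 0 t (w 0) * (1 + t) ^ a ≤ B) → ‖v 0‖ ^ 2 ≤ B →
      ∀ T, 0 ≤ T → (‖v T‖ ^ 2 - ‖J (v T)‖ ^ 2) * (1 + T) ^ (a + 1) ≤ C * B ∧
        ‖w T‖ ^ 2 * (1 + T) ^ (a + 2) ≤ C * B := by
  obtain ⟨C₁, hC₁, h₁⟩ := exists_sum_decay a 1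
  obtain ⟨C₂, hC₂, h₂⟩ := exists_sum_decay a 2
  refine ⟨C₁ + 2 * (C₂ + (2 * ((a + 2 : ℕ) + 1)) ^ (a + 2) * (1 + 2 * C₂)), by positivity, ?_⟩
  intro E V _ _ _ _ _ _ J v u w hJ hi hd hw B hu0 hw0 hv0 T hT
  have hD := isUnitInterval_defect hJ
  have hB : 0 ≤ B := (sq_nonneg _).trans hv0
  have hXpos : ∀ k : ℕ, ∀ T : ℝ, 0 ≤ T → 0 < (1 + T) ^ k := fun k T hT => by positivity
  set C₃ : ℝ := (2 * ((a + 2 : ℕ) + 1)) ^ (a + 2) * (1 + 2 * C₂) with hC₃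
  have hC₃0 : 0 < C₃ := by positivity
  constructor
  · have h : ‖v T‖ ^ 2 - ‖J (v T)‖ ^ 2 ≤ C₁ * B / (1 + T) ^ (a + 1) := by
      -- The energy sum with `m = 1` contains the series for the form energy; its `w` terms are
      -- nonnegative.
      refine sq_sub_sq_le_of_sum_le hJ hi _ fun N => ?_
      rw [le_div_iff₀ (hXpos _ _ hT)]
      refine le_trans (mul_le_mul_of_nonneg_right ?_ (hXpos _ _ hT).le)
        (h₁ hJ hw B hu0 hw0 hv0 T hT N)
      refine Finset.sum_le_sum fun i _ => ?_
      rw [hw.eq T hT]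
      linarith [heatForm_succ_le hD (1 + i) 0 (w T)]
    rw [le_div_iff₀ (hXpos _ _ hT)] at h
    refine h.trans ?_
    gcongr
    have : 0 < 2 * (C₂ + C₃) := by positivity
    linarith
  -- Split `w = D w + (1 - D) w`. With `m = 2` the energy sum bounds `D w` through its series, and
  -- its first term alone bounds `D u`, the source in the equation for `(1 - D) w`.
  · have hDw : ‖defect J (w T)‖ ^ 2 ≤ C₂ * B / (1 + T) ^ (a + 2) := by
      refine norm_sq_defect_le_of_sum_le hJ hd _ fun N => ?_
      rw [le_div_iff₀ (hXpos _ _ hT)]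
      refine le_trans (mul_le_mul_of_nonneg_right ?_ (hXpos _ _ hT).le)
        (h₂ hJ hw B hu0 hw0 hv0 T hT N)
      exact Finset.sum_le_sum fun i _ => by linarith [heatForm_nonneg hD (2 + i) 0 (u T)]
    have hDu : ∀ s, 0 ≤ s → ‖defect J (u s)‖ ^ 2 * (1 + s) ^ (a + 2) ≤ C₂ * B := fun s hs => by
      refine le_trans (mul_le_mul_of_nonneg_right ?_ (hXpos _ _ hs).le)
        (h₂ hJ hw B hu0 hw0 hv0 s hs 1)
      have e : ‖defect J (u s)‖ ^ 2 = heatForm (defect J) 2 0 (u s) := by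
        rw [← real_inner_self_eq_norm_sq, hD.symm, real_inner_comm]
        simp [heatForm, heat_zero]
      have := heatForm_succ_le hD 2 0 (w s)
      simp only [Finset.range_one, Finset.sum_singleton, add_zero, e]
      linarith
    -- Young's inequality on the cross term gives `f' + f ≤ ‖D u‖²`, so `f` inherits the rate of the
    -- source.
    have hRw := le_of_deriv_le_neg_add (f := fun t => ‖(1 - defect J) (w t)‖ ^ 2)
      (f' := fun t => 2 * ⟪(1 - defect J) (w t), -(defect J (u t)) - (1 - defect J) (w t)⟫)
      (K := C₂ * B) (a + 2)
      (((1 - defect J : E →L[ℝ] E).continuous.comp_continuousOn hw.cont').norm.pow 2)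
      (fun t ht => (hw.deriv' t ht).norm_sq) (by positivity) (by positivity)
      (fun t ht => by
        refine le_trans (mul_le_mul_of_nonneg_right ?_ (hXpos _ _ ht.le).le) (hDu t ht.le)
        rw [inner_sub_right, inner_neg_right, real_inner_self_eq_norm_sq]
        have := abs_real_inner_le_norm ((1 - defect J) (w t)) (defect J (u t))
        nlinarith [neg_abs_le ⟪(1 - defect J) (w t), defect J (u t)⟫,
          sq_nonneg (‖(1 - defect J) (w t)‖ - ‖defect J (u t)‖)]) hT
    have hRw0 : ‖(1 - defect J) (w 0)‖ ^ 2 ≤ B := by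
      have h := hw0 0 le_rfl
      rw [heatForm_zero_zero, add_zero, one_pow, mul_one] at h
      refine le_trans ((hD.one_sub.norm_sq_apply_le _).trans (hD.one_sub.le_one _)) ?_
      rwa [real_inner_self_eq_norm_sq]
    have hRw' : ‖(1 - defect J) (w T)‖ ^ 2 * (1 + T) ^ (a + 2) ≤ C₃ * B := by
      refine hRw.trans ?_
      rw [hC₃, mul_assoc]
      refine mul_le_mul_of_nonneg_left ?_ (by positivity)
      linarith
    rw [le_div_iff₀ (hXpos _ _ hT)] at hDw
    have hsum : ‖w T‖ ^ 2 ≤ 2 * (‖defect J (w T)‖ ^ 2 + ‖(1 - defect J) (w T)‖ ^ 2) := by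
      have e : w T = defect J (w T) + (1 - defect J) (w T) := by simp
      have := norm_add_le (defect J (w T)) ((1 - defect J) (w T))
      rw [← e] at this
      nlinarith [sq_nonneg (‖defect J (w T)‖ - ‖(1 - defect J) (w T)‖), norm_nonneg (w T)]
    calc ‖w T‖ ^ 2 * (1 + T) ^ (a + 2)
        ≤ 2 * (‖defect J (w T)‖ ^ 2 + ‖(1 - defect J) (w T)‖ ^ 2) * (1 + T) ^ (a + 2) :=
          mul_le_mul_of_nonneg_right hsum (hXpos _ _ hT).le
      _ ≤ 2 * (C₂ * B + C₃ * B) := by linarith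
      _ ≤ _ := by
        have : 0 ≤ C₁ * B := by positivity
        linarith

end Decay

/-! ### Heat decay from a Nash inequality -/

section HeatDecay

open scoped RealInnerProductSpace Topology

/-- Polynomial decay of a heat flow from an inequality of Nash type at large scales. -/
theorem heatForm_decay_of_nash {E : Type*} [NormedAddCommGroup E] [InnerProductSpace ℝ E]
    [CompleteSpace E] {D : E →L[ℝ] E} (hD : IsUnitInterval D) (p : ℕ) {C K : ℝ} (hC : 0 < C)
    (hK : 0 ≤ K) (f : E)
    (h : ∀ t, 0 ≤ t → ∀ s, 1 ≤ s →
      heatForm D 0 t f * s ^ p ≤ C * (s ^ (p + 1) * heatForm D 1 t f + K)) {t : ℝ} (ht : 0 ≤ t) :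
    heatForm D 0 t f * (1 + t) ^ p ≤ (1 + C * (p + 1)) ^ p * (‖f‖ ^ 2 + C * (p + 1) * K) := by
  -- The Nash inequality is used at the moving scale `s = X t = 1 + t / A`. This slope makes the
  -- derivative of `X ^ (p + 1)` times the level `0` form at most `K`, because `(p + 1) X ^ p / A =
  -- X ^ p / C`.
  set A : ℝ := C * (p + 1) with hA
  have hA0 : 0 < A := by positivity
  set X : ℝ → ℝ := fun t => 1 + t / A with hX
  have hX1 : ∀ s, 0 ≤ s → 1 ≤ X s := fun s hs => by
    have : 0 ≤ s / A := by positivity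
    simp only [hX]; linarith
  have hd : ∀ s, HasDerivAt (fun s => X s ^ (p + 1) * heatForm D 0 s f - K * s)
      ((p + 1 : ℕ) * X s ^ p * (1 / A) * heatForm D 0 s f + X s ^ (p + 1) * (-heatForm D 1 s f) - K) s := by
    intro s
    have h1 : HasDerivAt X (1 / A) s := by
      exact ((hasDerivAt_id s).div_const A).const_add 1
    have h2 := ((h1.pow (p + 1)).mul (hasDerivAt_heatForm D 0 s f)).sub
      ((hasDerivAt_id s).const_mul K)
    refine h2.congr_deriv ?_
    simp
  have hanti : AntitoneOn (fun s => X s ^ (p + 1) * heatForm D 0 s f - K * s) (Icc 0 t) := by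
    refine antitoneOn_of_deriv_nonpos (convex_Icc _ _) (fun s _ => (hd s).continuousAt.continuousWithinAt)
      (fun s _ => (hd s).differentiableAt.differentiableWithinAt) fun s hs => ?_
    rw [interior_Icc] at hs
    rw [(hd s).deriv]
    have h1 := h s hs.1.le (X s) (hX1 s hs.1.le)
    have h2 : ((p + 1 : ℕ) : ℝ) * X s ^ p * (1 / A) * heatForm D 0 s f =
        heatForm D 0 s f * X s ^ p / C := by
      rw [hA]; push_cast; field_simp
    have h3 : heatForm D 0 s f * X s ^ p / C ≤ X s ^ (p + 1) * heatForm D 1 s f + K := by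
      rw [div_le_iff₀ hC]; linarith
    rw [h2]; linarith
  have h1 := hanti (left_mem_Icc.2 ht) (right_mem_Icc.2 ht) ht
  simp only [hX, zero_div, add_zero, one_pow, one_mul, mul_zero, sub_zero, heatForm_zero_zero] at h1
  have hXt := hX1 t ht
  have hXe : 1 + t / A = X t := rfl
  rw [hXe] at h1
  have hN := heatForm_nonneg hD 0 t f
  have h2 : X t ^ p * heatForm D 0 t f ≤ ‖f‖ ^ 2 + A * K := by
    refine le_of_mul_le_mul_left ?_ (zero_lt_one.trans_le hXt)
    have e : t = A * (X t - 1) := by simp only [hX]; field_simp; ring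
    calc X t * (X t ^ p * heatForm D 0 t f) = X t ^ (p + 1) * heatForm D 0 t f := by ring
      _ ≤ ‖f‖ ^ 2 + K * t := by linarith
      _ = ‖f‖ ^ 2 + K * (A * (X t - 1)) := by rw [← e]
      _ ≤ X t * (‖f‖ ^ 2 + A * K) := by
        have : 0 ≤ A * K := by positivity
        nlinarith [sq_nonneg ‖f‖]
  have h3 : (1 + t) ^ p ≤ (1 + A) ^ p * X t ^ p := by
    rw [← mul_pow]
    refine pow_le_pow_left₀ (by positivity) ?_ p
    have : (1 + A) * X t = 1 + A + t / A + t := by simp only [hX]; field_simp; ring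
    have : 0 ≤ t / A := by positivity
    linarith
  calc _ ≤ heatForm D 0 t f * ((1 + A) ^ p * X t ^ p) := by gcongr
    _ = (1 + A) ^ p * (X t ^ p * heatForm D 0 t f) := by ring
    _ ≤ _ := by gcongr

end HeatDecay

noncomputable section

namespace Heisenberg

variable {n : ℕ}

/-! ### Group law and left-invariant fields -/

theorem gmul_assoc (p q r : H n) : mul (mul p q) r = mul p (mul q r) := by
  refine Prod.ext (add_assoc _ _ _) (Prod.ext (add_assoc _ _ _) ?_)
  simp only [mul, Pi.add_apply, add_mul, mul_add, Finset.sum_add_distrib]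
  ring

theorem gmul_zero (p : H n) : mul p 0 = p := by simp [mul]

theorem zero_gmul (p : H n) : mul 0 p = p := by simp [mul]

theorem gmul_neg_self (p : H n) : mul p (-p) = 0 := by simp [mul]

theorem neg_gmul_self (p : H n) : mul (-p) p = 0 := by simp [mul]

theorem gmul_neg_cancel_right (p q : H n) : mul (mul p q) (-q) = p := by
  rw [gmul_assoc, gmul_neg_self, gmul_zero]

theorem neg_gmul_cancel_right (p q : H n) : mul (mul p (-q)) q = p := by
  rw [gmul_assoc, neg_gmul_self, gmul_zero]

theorem gmul_neg_cancel_left (p q : H n) : mul p (mul (-p) q) = q := by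
  rw [← gmul_assoc, gmul_neg_self, zero_gmul]

theorem neg_gmul_cancel_left (p q : H n) : mul (-p) (mul p q) = q := by
  rw [← gmul_assoc, neg_gmul_self, zero_gmul]

theorem neg_gmul (p q : H n) : -mul p q = mul (-q) (-p) := by
  refine Prod.ext (by simp [mul, add_comm]) (Prod.ext (by simp [mul, add_comm]) ?_)
  simp only [mul, Prod.snd_neg, Prod.fst_neg, Pi.neg_apply, neg_mul_neg]
  generalize ∑ j, p.1 j * q.2.1 j = a
  generalize ∑ j, q.1 j * p.2.1 j = b
  linarith

/-- The horizontal element `(a, b, 0)`. -/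
def horizontal (ζ : (Fin n → ℝ) × (Fin n → ℝ)) : H n := (ζ.1, ζ.2, 0)

/-- The left-invariant vector field generated by `(a, b, 0)`. -/
def field (ζ : (Fin n → ℝ) × (Fin n → ℝ)) (p : H n) : H n :=
  (ζ.1, ζ.2, (1 / 2) * ((∑ j, p.1 j * ζ.2 j) - ∑ j, ζ.1 j * p.2.1 j))

theorem mul_smul_horizontal (p : H n) (s : ℝ) (ζ : (Fin n → ℝ) × (Fin n → ℝ)) :
    mul p (s • horizontal ζ) = p + s • field ζ p := by
  refine Prod.ext rfl (Prod.ext rfl ?_)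
  have e1 : ∑ j, p.1 j * (s * ζ.2 j) = s * ∑ j, p.1 j * ζ.2 j := by
    rw [Finset.mul_sum]
    exact Finset.sum_congr rfl fun _ _ => by ring
  have e2 : ∑ j, s * ζ.1 j * p.2.1 j = s * ∑ j, ζ.1 j * p.2.1 j := by
    rw [Finset.mul_sum]
    exact Finset.sum_congr rfl fun _ _ => by ring
  simp only [mul, field, horizontal, Prod.smul_snd, Prod.smul_fst, Pi.smul_apply, smul_eq_mul,
    Prod.snd_add, e1, e2]
  ring

theorem add_smul_horizontal (s t : ℝ) (ζ : (Fin n → ℝ) × (Fin n → ℝ)) :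
    mul (s • horizontal ζ) (t • horizontal ζ) = (s + t) • horizontal ζ := by
  refine Prod.ext (add_smul _ _ _).symm (Prod.ext (add_smul _ _ _).symm ?_)
  have e : ∑ j, s * ζ.1 j * (t * ζ.2 j) = ∑ j, t * ζ.1 j * (s * ζ.2 j) :=
    Finset.sum_congr rfl fun _ _ => by ring
  simp [mul, horizontal, e]

theorem vecX_eq (j : Fin n) : vecX j = field (Pi.single j 1, 0) := by
  funext p
  simp [vecX, field, Pi.single_apply]
  ring

theorem vecY_eq (j : Fin n) : vecY j = field (0, Pi.single j 1) := by
  funext p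
  simp [vecY, field, Pi.single_apply]
  ring

theorem contDiff_mul {P : Type*} [NormedAddCommGroup P] [NormedSpace ℝ P] {f g : P → H n} {k : WithTop ℕ∞}
    (hf : ContDiff ℝ k f) (hg : ContDiff ℝ k g) : ContDiff ℝ k fun x => mul (f x) (g x) := by
  have h1 : ∀ {f : P → H n}, ContDiff ℝ k f → ∀ j, ContDiff ℝ k fun x => (f x).1 j := fun hf j =>
    (contDiff_apply ℝ ℝ j).comp hf.fst
  have h2 : ∀ {f : P → H n}, ContDiff ℝ k f → ∀ j, ContDiff ℝ k fun x => (f x).2.1 j := fun hf j =>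
    (contDiff_apply ℝ ℝ j).comp hf.snd.fst
  refine (hf.fst.add hg.fst).prodMk ((hf.snd.fst.add hg.snd.fst).prodMk
    ((hf.snd.snd.add hg.snd.snd).add (contDiff_const.mul (ContDiff.sub ?_ ?_))))
  · exact ContDiff.sum fun j _ => (h1 hf j).mul (h2 hg j)
  · exact ContDiff.sum fun j _ => (h1 hg j).mul (h2 hf j)

theorem continuous_mul : Continuous fun x : H n × H n => mul x.1 x.2 :=
  (contDiff_mul (k := 0) contDiff_fst contDiff_snd).continuous

theorem contDiff_field (ζ : (Fin n → ℝ) × (Fin n → ℝ)) : ContDiff ℝ ∞ (field ζ) := by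
  have e : field ζ = fun p => mul p (horizontal ζ) - p := by
    funext p
    have := mul_smul_horizontal p 1 ζ
    rw [one_smul, one_smul] at this
    rw [this, add_sub_cancel_left]
  rw [e]
  exact (contDiff_mul contDiff_id contDiff_const).sub contDiff_id

/-! ### Invariance of Lebesgue measure -/

/-- Left and right group translations both shift `(x, y)` and move `τ` by an amount depending only
on `(x, y)`. Fubini reduces invariance to translations in each factor. -/
theorem measurePreserving_shear (a b : Fin n → ℝ) {ℓ : (Fin n → ℝ) → (Fin n → ℝ) → ℝ}
    (hℓ : Continuous (Function.uncurry ℓ)) :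
    MeasurePreserving (fun p : H n => ((p.1 + a, p.2.1 + b, p.2.2 + ℓ p.1 p.2.1) : H n)) volume volume := by
  refine MeasurePreserving.skew_product (μa := (volume : Measure (Fin n → ℝ)))
    (μc := (volume : Measure ((Fin n → ℝ) × ℝ))) (μd := (volume : Measure ((Fin n → ℝ) × ℝ)))
    (g := fun x y => (y.1 + b, y.2 + ℓ x y.1)) (measurePreserving_add_right volume a) ?_ ?_
  · refine Continuous.measurable ?_
    have : Continuous fun z : (Fin n → ℝ) × (Fin n → ℝ) × ℝ => ℓ z.1 z.2.1 :=
      hℓ.comp (continuous_fst.prodMk continuous_snd.fst)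
    change Continuous fun z : (Fin n → ℝ) × (Fin n → ℝ) × ℝ => (z.2.1 + b, z.2.2 + ℓ z.1 z.2.1)
    fun_prop
  · refine Filter.Eventually.of_forall fun x => ?_
    refine (MeasurePreserving.skew_product (μa := (volume : Measure (Fin n → ℝ)))
      (μc := (volume : Measure ℝ)) (μd := (volume : Measure ℝ))
      (g := fun y τ => τ + ℓ x y) (measurePreserving_add_right volume b) ?_ ?_).map_eq
    · refine Continuous.measurable ?_
      have : Continuous fun z : (Fin n → ℝ) × ℝ => ℓ x z.1 :=
        hℓ.comp (continuous_const.prodMk continuous_fst)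
      change Continuous fun z : (Fin n → ℝ) × ℝ => z.2 + ℓ x z.1
      fun_prop
    · exact Filter.Eventually.of_forall fun y => (measurePreserving_add_right volume (ℓ x y)).map_eq

theorem measurePreserving_mul_right (q : H n) : MeasurePreserving (fun p => mul p q) volume volume := by
  have := measurePreserving_shear q.1 q.2.1
    (ℓ := fun x y => q.2.2 + (1 / 2) * ((∑ j, x j * q.2.1 j) - ∑ j, q.1 j * y j))
    (by unfold Function.uncurry; fun_prop)
  convert this using 2 with p
  simp only [mul]
  rw [add_assoc]

theorem measurePreserving_mul_left (q : H n) : MeasurePreserving (fun p => mul q p) volume volume := by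
  have := measurePreserving_shear q.1 q.2.1
    (ℓ := fun x y => q.2.2 + (1 / 2) * ((∑ j, q.1 j * y j) - ∑ j, x j * q.2.1 j))
    (by unfold Function.uncurry; fun_prop)
  convert this using 2 with p
  simp only [mul]
  rw [add_comm q.1, add_comm q.2.1, add_comm q.2.2, add_assoc]

theorem measurePreserving_neg : MeasurePreserving (fun p : H n => -p) volume volume :=
  (Measure.measurePreserving_neg volume).prod
    ((Measure.measurePreserving_neg volume).prod (Measure.measurePreserving_neg volume))

theorem measurableEmbedding_mul_right (q : H n) : MeasurableEmbedding fun p => mul p q :=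
  (Homeomorph.mk ⟨fun p => mul p q, fun p => mul p (-q), fun p => gmul_neg_cancel_right p q,
    fun p => neg_gmul_cancel_right p q⟩ (continuous_mul.comp (continuous_id.prodMk continuous_const))
    (continuous_mul.comp (continuous_id.prodMk continuous_const))).measurableEmbedding

theorem measurableEmbedding_mul_left (q : H n) : MeasurableEmbedding fun p => mul q p :=
  (Homeomorph.mk ⟨fun p => mul q p, fun p => mul (-q) p, fun p => neg_gmul_cancel_left q p,
    fun p => gmul_neg_cancel_left q p⟩ (continuous_mul.comp (continuous_const.prodMk continuous_id))
    (continuous_mul.comp (continuous_const.prodMk continuous_id))).measurableEmbedding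

end Heisenberg

end

/-- A linear functional bounded by `K ‖T m‖` is represented by a vector of norm at most `K`. -/
theorem exists_inner_eq_of_abs_le {M X : Type*} [AddCommGroup M] [Module ℝ M] [NormedAddCommGroup X]
    [InnerProductSpace ℝ X] [CompleteSpace X] (T : M →ₗ[ℝ] X) (ℓ : M →ₗ[ℝ] ℝ) {K : ℝ} (hK : 0 ≤ K)
    (h : ∀ m, |ℓ m| ≤ K * ‖T m‖) : ∃ w : X, ‖w‖ ≤ K ∧ ∀ m, inner ℝ w (T m) = ℓ m := by
  have hker : LinearMap.ker T ≤ LinearMap.ker ℓ := fun m hm => by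
    have := h m
    rw [LinearMap.mem_ker.1 hm, norm_zero, mul_zero] at this
    exact abs_eq_zero.1 (le_antisymm this (abs_nonneg _))
  let f : LinearMap.range T →ₗ[ℝ] ℝ :=
    (LinearMap.ker T).liftQ ℓ hker ∘ₗ T.quotKerEquivRange.symm.toLinearMap
  have hf : ∀ m, f ⟨T m, m, rfl⟩ = ℓ m := fun m => by
    have : T.quotKerEquivRange.symm ⟨T m, m, rfl⟩ = (LinearMap.ker T).mkQ m := by
      rw [LinearEquiv.symm_apply_eq]; rfl
    simp only [f, LinearMap.comp_apply, LinearEquiv.coe_coe, this]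
    exact Submodule.liftQ_apply _ _ _
  let F : StrongDual ℝ (LinearMap.range T) := f.mkContinuous K (by
    rintro ⟨_, m, rfl⟩
    rw [hf]
    exact h m)
  -- The range of `T` need not be closed, so the functional is extended by Hahn–Banach before Riesz
  -- representation is applied.
  obtain ⟨g, hg, hgn⟩ := _root_.exists_extension_norm_eq (LinearMap.range T) F
  refine ⟨(InnerProductSpace.toDual ℝ X).symm g, ?_, fun m => ?_⟩
  · rw [LinearIsometryEquiv.norm_map, hgn]
    exact LinearMap.mkContinuous_norm_le _ hK _
  · rw [InnerProductSpace.toDual_symm_apply, ← hf m]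
    exact hg ⟨T m, m, rfl⟩

noncomputable section

namespace Heisenberg

variable {n : ℕ}

/-! ### Test functions and right translations -/

theorem IsTest.comp_mul_right {φ : H n → ℝ} (hφ : IsTest φ) (q : H n) :
    IsTest fun p => φ (mul p q) := by
  refine ⟨hφ.1.comp (contDiff_mul contDiff_id contDiff_const), ?_⟩
  exact hφ.2.comp_homeomorph (Homeomorph.mk ⟨fun p => mul p q, fun p => mul p (-q),
    fun p => gmul_neg_cancel_right p q, fun p => neg_gmul_cancel_right p q⟩
    (continuous_mul.comp (continuous_id.prodMk continuous_const))
    (continuous_mul.comp (continuous_id.prodMk continuous_const)))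

theorem IsTest.continuous {φ : H n → ℝ} (hφ : IsTest φ) : Continuous φ := hφ.1.continuous

theorem IsTest.differentiable {φ : H n → ℝ} (hφ : IsTest φ) : Differentiable ℝ φ :=
  hφ.1.differentiable (by simp)

theorem contDiff_along {φ : H n → ℝ} (hφ : ContDiff ℝ ∞ φ) (ζ : (Fin n → ℝ) × (Fin n → ℝ)) :
    ContDiff ℝ ∞ (along (field ζ) φ) :=
  (hφ.fderiv_right (m := ∞) (by simp)).clm_apply (contDiff_field ζ)

theorem IsTest.along {φ : H n → ℝ} (hφ : IsTest φ) (ζ : (Fin n → ℝ) × (Fin n → ℝ)) :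
    IsTest (along (field ζ) φ) := by
  refine ⟨contDiff_along hφ.1 ζ, (hφ.2.fderiv ℝ).mono fun p hp => ?_⟩
  contrapose! hp
  simp [Heisenberg.along, Function.notMem_support.1 hp]

theorem IsTest.memLp {φ : H n → ℝ} (hφ : IsTest φ) : MemLp φ 2 (volume : Measure (H n)) :=
  hφ.continuous.memLp_of_hasCompactSupport hφ.2

/-- The contributions of `ζ` to the `τ` component cancel by antisymmetry. Integral curves are thus
straight lines, and right translation by `s • horizontal ζ` is the flow of the field. -/
theorem field_mul_smul_horizontal (ζ : (Fin n → ℝ) × (Fin n → ℝ)) (p : H n) (s : ℝ) :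
    field ζ (mul p (s • horizontal ζ)) = field ζ p := by
  rw [mul_smul_horizontal]
  refine Prod.ext rfl (Prod.ext rfl ?_)
  have e : ∑ j, s * ζ.1 j * ζ.2 j = ∑ j, ζ.1 j * (s * ζ.2 j) :=
    Finset.sum_congr rfl fun _ _ => by ring
  simp [field, add_mul, mul_add, Finset.sum_add_distrib, e]

theorem hasDerivAt_comp_mul {φ : H n → ℝ} (hφ : Differentiable ℝ φ) (ζ : (Fin n → ℝ) × (Fin n → ℝ))
    (p : H n) (s : ℝ) : HasDerivAt (fun s => φ (mul p (s • horizontal ζ)))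
      (along (field ζ) φ (mul p (s • horizontal ζ))) s := by
  have h1 : HasDerivAt (fun s : ℝ => mul p (s • horizontal ζ)) (field ζ p) s := by
    simp only [mul_smul_horizontal]
    simpa using ((hasDerivAt_id s).smul_const (field ζ p)).const_add p
  have := (hφ (mul p (s • horizontal ζ))).hasFDerivAt.comp_hasDerivAt s h1
  rwa [← field_mul_smul_horizontal ζ p s] at this

theorem along_comp_mul {φ : H n → ℝ} (hφ : ContDiff ℝ ∞ φ) (ζ : (Fin n → ℝ) × (Fin n → ℝ))
    (p : H n) (s : ℝ) : along (field ζ) (fun p => φ (mul p (s • horizontal ζ))) p =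
      along (field ζ) φ (mul p (s • horizontal ζ)) := by
  have hd : Differentiable ℝ fun p => φ (mul p (s • horizontal ζ)) :=
    (hφ.comp (contDiff_mul contDiff_id contDiff_const)).differentiable (by simp)
  have h1 := hasDerivAt_comp_mul hd ζ p 0
  have h2 := (hasDerivAt_comp_mul (hφ.differentiable (by simp)) ζ p (0 + s)).comp_add_const 0 s
  simp only [gmul_assoc, add_smul_horizontal] at h1
  simpa [gmul_zero] using h1.unique h2

/-- Differentiation of a pairing along the flow of a left-invariant field. -/
theorem hasDerivAt_integral_comp_mul {v : H n → ℝ} (hv : LocallyIntegrable v volume) {φ : H n → ℝ}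
    (hφ : IsTest φ) (ζ : (Fin n → ℝ) × (Fin n → ℝ)) (s : ℝ) :
    HasDerivAt (fun s => ∫ p, v p * φ (mul p (s • horizontal ζ)))
      (∫ p, v p * along (field ζ) φ (mul p (s • horizontal ζ))) s := by
  have hα := hφ.along ζ
  obtain ⟨C, hC⟩ := hα.2.exists_bound_of_continuous hα.continuous
  -- A single compact set contains the supports of all translated derivatives for times within `1`
  -- of `s`, so local integrability of `v` gives domination.
  set K : Set (H n) := (fun x : H n × ℝ => mul x.1 (-(x.2 • horizontal ζ))) ''
    (tsupport (along (field ζ) φ) ×ˢ Metric.closedBall s 1) with hKdef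
  have hK : IsCompact K := by
    refine (hα.2.isCompact.prod (isCompact_closedBall s 1)).image ?_
    exact continuous_mul.comp (continuous_fst.prodMk (continuous_snd.smul continuous_const).neg)
  have hcm : ∀ t : ℝ, Continuous fun p : H n => mul p (t • horizontal ζ) := fun t =>
    continuous_mul.comp (continuous_id.prodMk continuous_const)
  refine (hasDerivAt_integral_of_dominated_loc_of_deriv_le (s := Metric.ball s 1)
    (F := fun s p => v p * φ (mul p (s • horizontal ζ)))
    (F' := fun s p => v p * along (field ζ) φ (mul p (s • horizontal ζ)))
    (bound := K.indicator fun p => ‖v p‖ * C) (Metric.ball_mem_nhds s one_pos)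
    (Filter.Eventually.of_forall fun t => ?_) ?_ ?_ ?_ ?_ ?_).2
  · exact hv.aestronglyMeasurable.mul (hφ.continuous.comp (hcm t)).aestronglyMeasurable
  · have := hv.integrable_smul_right_of_hasCompactSupport
      (hφ.comp_mul_right (s • horizontal ζ)).continuous (hφ.comp_mul_right (s • horizontal ζ)).2
    simpa [mul_comm] using this
  · exact hv.aestronglyMeasurable.mul (hα.continuous.comp (hcm s)).aestronglyMeasurable
  · refine Filter.Eventually.of_forall fun p t ht => ?_
    by_cases hp : p ∈ K
    · rw [indicator_of_mem hp, norm_mul]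
      exact mul_le_mul_of_nonneg_left (hC _) (norm_nonneg _)
    · rw [indicator_of_notMem hp]
      have : mul p (t • horizontal ζ) ∉ tsupport (along (field ζ) φ) := fun hm =>
        hp ⟨(_, t), ⟨hm, Metric.ball_subset_closedBall ht⟩, gmul_neg_cancel_right _ _⟩
      rw [image_eq_zero_of_notMem_tsupport this, mul_zero, norm_zero]
  · rw [integrable_indicator_iff hK.measurableSet]
    exact ((hv.integrableOn_isCompact hK).norm).mul_const C
  · exact Filter.Eventually.of_forall fun p t _ =>
      (hasDerivAt_comp_mul hφ.differentiable ζ p t).const_mul (v p)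

theorem locallyIntegrable_L2 (f : L2 n) : LocallyIntegrable f volume :=
  (Lp.memLp f).locallyIntegrable (by norm_num)

theorem inner_L2 (f g : L2 n) : inner ℝ f g = ∫ p, f p * g p := by
  rw [L2.inner_def]
  exact integral_congr_ae (Filter.Eventually.of_forall fun p => by
    simp only [RCLike.inner_apply, RCLike.conj_to_real, mul_comm])

theorem inner_toLp (f : L2 n) {φ : H n → ℝ} (hφ : MemLp φ 2 (volume : Measure (H n))) :
    inner ℝ f (hφ.toLp φ) = ∫ p, f p * φ p := by
  rw [inner_L2]
  refine integral_congr_ae ?_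
  filter_upwards [hφ.coeFn_toLp] with p hp using by rw [hp]

/-- Right translation on `L²`. -/
def rightTranslate (q : H n) : L2 n →ₗᵢ[ℝ] L2 n :=
  Lp.compMeasurePreservingₗᵢ ℝ (fun p => mul p q) (measurePreserving_mul_right q)

theorem coeFn_rightTranslate (q : H n) (f : L2 n) :
    rightTranslate q f =ᵐ[volume] fun p => f (mul p q) :=
  Lp.coeFn_compMeasurePreserving f (measurePreserving_mul_right q)

theorem integral_rightTranslate (q : H n) (f : L2 n) (φ : H n → ℝ) :
    ∫ p, rightTranslate q f p * φ p = ∫ p, f p * φ (mul p (-q)) := by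
  refine Eq.trans (integral_congr_ae ?_) ((measurePreserving_mul_right q).integral_comp
    (measurableEmbedding_mul_right q) fun p => f p * φ (mul p (-q)))
  filter_upwards [coeFn_rightTranslate q f] with p hp
  rw [hp, gmul_neg_cancel_right]

theorem toLp_comp_mul_right {φ : H n → ℝ} (hφ : MemLp φ 2 (volume : Measure (H n))) (q : H n)
    (h' : MemLp (fun p => φ (mul p q)) 2 (volume : Measure (H n))) :
    h'.toLp _ = rightTranslate q (hφ.toLp φ) :=
  (Lp.toLp_compMeasurePreserving hφ (measurePreserving_mul_right q)).symm

theorem abs_integral_mul_le (f : L2 n) {φ : H n → ℝ} (hφ : MemLp φ 2 (volume : Measure (H n))) :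
    |∫ p, f p * φ p| ≤ ‖f‖ * ‖hφ.toLp φ‖ := by
  rw [← inner_toLp]
  exact abs_real_inner_le_norm _ _

theorem eq_zero_of_integral_test {f : L2 n} (h : ∀ φ : H n → ℝ, IsTest φ → ∫ p, f p * φ p = 0) :
    f = 0 := by
  have := ae_eq_zero_of_integral_contDiff_smul_eq_zero (locallyIntegrable_L2 f)
    fun g hg hc => by simpa [mul_comm] using h g ⟨hg, hc⟩
  exact (Lp.eq_zero_iff_ae_eq_zero).2 this

/-- The space of test functions. -/
def testSpace (n : ℕ) : Submodule ℝ (H n → ℝ) where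
  carrier := {φ | IsTest φ}
  add_mem' h h' := ⟨h.1.add h'.1, h.2.add h'.2⟩
  zero_mem' := ⟨contDiff_const, HasCompactSupport.zero⟩
  smul_mem' c _ h := ⟨h.1.const_smul c, h.2.smul_left (f := fun _ => c)⟩

/-- A test function as an element of `L²`. -/
def testToL2 (n : ℕ) : testSpace n →ₗ[ℝ] L2 n where
  toFun φ := (IsTest.memLp φ.2).toLp φ
  map_add' _ _ := MemLp.toLp_add _ _
  map_smul' c _ := MemLp.toLp_const_smul c _

theorem denseRange_testToL2 : DenseRange (testToL2 n) := by
  have h : (LinearMap.range (testToL2 n)).topologicalClosure = ⊤ := by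
    rw [Submodule.topologicalClosure_eq_top_iff, Submodule.eq_bot_iff]
    intro f hf
    refine eq_zero_of_integral_test fun φ hφ => ?_
    rw [← inner_toLp f hφ.memLp, real_inner_comm]
    exact (Submodule.mem_orthogonal _ _).1 hf _ ⟨⟨φ, hφ⟩, rfl⟩
  have := Submodule.dense_iff_topologicalClosure_eq_top.2 h
  rwa [LinearMap.coe_range] at this

theorem norm_le_of_test {f : L2 n} {K : ℝ} (hK : 0 ≤ K)
    (h : ∀ φ : H n → ℝ, ∀ hφ : IsTest φ, ∫ p, f p * φ p ≤ K * ‖hφ.memLp.toLp φ‖) : ‖f‖ ≤ K := by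
  have h1 : ∀ g : L2 n, inner ℝ f g ≤ K * ‖g‖ := fun g => by
    refine denseRange_testToL2.induction_on (p := fun g => inner ℝ f g ≤ K * ‖g‖) g ?_ ?_
    · exact isClosed_le (by fun_prop) (by fun_prop)
    · rintro ⟨φ, hφ⟩
      change inner ℝ f (IsTest.memLp hφ |>.toLp φ) ≤ _
      rw [inner_toLp]
      exact h φ hφ
  have h2 := h1 f
  rw [real_inner_self_eq_norm_sq] at h2
  rcases (norm_nonneg f).eq_or_lt with h0 | h0
  · rwa [← h0]
  · nlinarith

theorem IsWeakDeriv.hasDerivAt_integral {ζ : (Fin n → ℝ) × (Fin n → ℝ)} {v w : L2 n}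
    (h : IsWeakDeriv (field ζ) v w) {φ : H n → ℝ} (hφ : IsTest φ) (s : ℝ) :
    HasDerivAt (fun s => ∫ p, v p * φ (mul p (s • horizontal ζ)))
      (-∫ p, w p * φ (mul p (s • horizontal ζ))) s := by
  refine (hasDerivAt_integral_comp_mul (locallyIntegrable_L2 v) hφ ζ s).congr_deriv ?_
  rw [h _ (hφ.comp_mul_right _), ← integral_neg]
  refine integral_congr_ae (Filter.Eventually.of_forall fun p => ?_)
  simp [along_comp_mul hφ.1]

/-- Paired with a test function, the translate is differentiable in `s` with derivative bounded
through `‖w‖`, as translations are isometries. The mean value inequality and duality finish. -/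
theorem norm_rightTranslate_sub_le {ζ : (Fin n → ℝ) × (Fin n → ℝ)} {v w : L2 n}
    (h : IsWeakDeriv (field ζ) v w) (s : ℝ) :
    ‖rightTranslate (s • horizontal ζ) v - v‖ ≤ |s| * ‖w‖ := by
  refine norm_le_of_test (by positivity) fun φ hφ => ?_
  have e : ∫ p, (rightTranslate (s • horizontal ζ) v - v : L2 n) p * φ p =
      (∫ p, v p * φ (mul p ((-s) • horizontal ζ))) - ∫ p, v p * φ (mul p ((0 : ℝ) • horizontal ζ)) := by
    rw [neg_smul, ← integral_rightTranslate, ← inner_toLp _ hφ.memLp, inner_sub_left, inner_toLp, inner_toLp]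
    simp [gmul_zero]
  rw [e]
  have hb := Convex.norm_image_sub_le_of_norm_hasDerivWithin_le (s := univ) (x := 0) (y := -s)
    (C := ‖w‖ * ‖hφ.memLp.toLp φ‖)
    (fun s _ => (h.hasDerivAt_integral hφ s).hasDerivWithinAt) (fun s _ => by
      rw [norm_neg, Real.norm_eq_abs]
      refine (abs_integral_mul_le w (hφ.comp_mul_right _).memLp).trans (le_of_eq ?_)
      rw [toLp_comp_mul_right hφ.memLp, LinearIsometry.norm_map]) convex_univ (mem_univ _) (mem_univ _)
  refine (le_abs_self _).trans (hb.trans (le_of_eq ?_))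
  rw [sub_zero, norm_neg, Real.norm_eq_abs]
  ring

/-- The difference quotients bound the functional `φ ↦ -∫ v Zφ` by `K` times the `L²` norm of `φ`,
and Riesz representation provides `w`. This converse lets truncation be handled without a chain
rule. -/
theorem exists_weakDeriv_of_norm_sub_le {ζ : (Fin n → ℝ) × (Fin n → ℝ)} {v : L2 n} {K : ℝ} (hK : 0 ≤ K)
    (h : ∀ s : ℝ, ‖rightTranslate (s • horizontal ζ) v - v‖ ≤ |s| * K) :
    ∃ w, IsWeakDeriv (field ζ) v w ∧ ‖w‖ ≤ K := by
  have hint : ∀ {φ : H n → ℝ}, IsTest φ → Integrable (fun p => v p * φ p) volume := fun hφ => by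
    simpa [mul_comm] using
      (locallyIntegrable_L2 v).integrable_smul_right_of_hasCompactSupport hφ.continuous hφ.2
  let ℓ : testSpace n →ₗ[ℝ] ℝ :=
    { toFun := fun φ => ∫ p, v p * (-along (field ζ) φ p)
      map_add' := fun φ ψ => by
        rw [← integral_add (by simpa using (hint (IsTest.along φ.2 ζ)).neg)
          (by simpa using (hint (IsTest.along ψ.2 ζ)).neg)]
        refine integral_congr_ae (Filter.Eventually.of_forall fun p => ?_)
        have : along (field ζ) ((φ + ψ : testSpace n) : H n → ℝ) p =
            along (field ζ) φ p + along (field ζ) ψ p := by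
          simp only [along, Submodule.coe_add]
          rw [fderiv_add (IsTest.differentiable φ.2 p) (IsTest.differentiable ψ.2 p)]
          rfl
        simp only [this]
        ring
      map_smul' := fun c φ => by
        rw [RingHom.id_apply, smul_eq_mul, ← integral_const_mul]
        refine integral_congr_ae (Filter.Eventually.of_forall fun p => ?_)
        have : along (field ζ) ((c • φ : testSpace n) : H n → ℝ) p = c * along (field ζ) φ p := by
          simp only [along, Submodule.coe_smul]
          rw [fderiv_const_smul (IsTest.differentiable φ.2 p)]
          rfl
        simp only [this]
        ring }
  obtain ⟨w, hw, hwφ⟩ := exists_inner_eq_of_abs_le (testToL2 n) ℓ hK (by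
    rintro ⟨φ, hφ⟩
    have hd := hasDerivAt_integral_comp_mul (locallyIntegrable_L2 v) hφ ζ 0
    have e : ℓ ⟨φ, hφ⟩ = -∫ p, v p * along (field ζ) φ (mul p ((0 : ℝ) • horizontal ζ)) := by
      simp [ℓ, gmul_zero, integral_neg]
    rw [e, abs_neg, ← Real.norm_eq_abs]
    refine hd.le_of_lip' (by positivity) (Filter.Eventually.of_forall fun s => ?_)
    have e2 : (∫ p, v p * φ (mul p (s • horizontal ζ))) - ∫ p, v p * φ (mul p ((0 : ℝ) • horizontal ζ)) =
        inner ℝ (rightTranslate ((-s) • horizontal ζ) v - v) ((IsTest.memLp hφ).toLp φ) := by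
      rw [inner_sub_left, inner_toLp, inner_toLp, integral_rightTranslate]
      simp [gmul_zero]
    rw [e2, sub_zero]
    refine (norm_inner_le_norm _ _).trans ?_
    have := h (-s)
    rw [abs_neg] at this
    calc _ ≤ |s| * K * ‖(IsTest.memLp hφ).toLp φ‖ := by gcongr
      _ = _ := by rw [Real.norm_eq_abs]; simp only [testToL2, LinearMap.coe_mk, AddHom.coe_mk]; ring)
  refine ⟨w, fun φ hφ => ?_, hw⟩
  have := hwφ ⟨φ, hφ⟩
  rwa [show testToL2 n ⟨φ, hφ⟩ = (IsTest.memLp hφ).toLp φ from rfl, inner_toLp] at this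

/-! ### The horizontal Sobolev space -/

theorem along_mul {φ ψ : H n → ℝ} (hφ : Differentiable ℝ φ) (hψ : Differentiable ℝ ψ) (Z : H n → H n)
    (p : H n) : along Z (fun p => φ p * ψ p) p = along Z φ p * ψ p + φ p * along Z ψ p := by
  simp only [along]
  rw [fderiv_fun_mul (hφ p) (hψ p)]
  simp only [add_apply, smul_apply, smul_eq_mul]
  ring

theorem IsTest.mul {φ ψ : H n → ℝ} (hφ : IsTest φ) (hψ : ContDiff ℝ ∞ ψ) :
    IsTest fun p => φ p * ψ p :=
  ⟨hφ.1.mul hψ, hφ.2.mul_right⟩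

/-- The integral of `φ` along the flow is constant because right translations preserve the measure.
-/
theorem integral_along_eq_zero {φ : H n → ℝ} (hφ : IsTest φ) (ζ : (Fin n → ℝ) × (Fin n → ℝ)) :
    ∫ p, along (field ζ) φ p = 0 := by
  have h := hasDerivAt_integral_comp_mul (v := fun _ => 1) (locallyIntegrable_const 1) hφ ζ 0
  have e : (fun s : ℝ => ∫ p, 1 * φ (Heisenberg.mul p (s • horizontal ζ))) = fun _ => ∫ p, φ p := by
    funext s
    simp only [one_mul]
    exact (measurePreserving_mul_right _).integral_comp (measurableEmbedding_mul_right _) φ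
  rw [e] at h
  simpa [gmul_zero] using h.unique (hasDerivAt_const 0 _)

theorem integral_along_mul {φ ψ : H n → ℝ} (hφ : IsTest φ) (hψ : ContDiff ℝ ∞ ψ)
    (ζ : (Fin n → ℝ) × (Fin n → ℝ)) :
    ∫ p, along (field ζ) φ p * ψ p = -∫ p, φ p * along (field ζ) ψ p := by
  have h := integral_along_eq_zero (hφ.mul hψ) ζ
  have h1 := ((hφ.along ζ).mul hψ)
  have h2 := hφ.mul (contDiff_along hψ ζ)
  simp only [along_mul hφ.differentiable (hψ.differentiable (by simp))] at h
  rw [integral_add (h1.continuous.integrable_of_hasCompactSupport h1.2)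
    (h2.continuous.integrable_of_hasCompactSupport h2.2)] at h
  linarith

theorem isWeakDeriv_iff {Z : H n → H n} {v w : L2 n} :
    IsWeakDeriv Z v w ↔ ∀ φ : H n → ℝ, IsTest φ → ∫ p, w p * φ p = -∫ p, v p * along Z φ p := by
  simp only [IsWeakDeriv, mul_neg, integral_neg]

theorem isWeakDeriv_toLp {φ : H n → ℝ} (hφ : IsTest φ) (ζ : (Fin n → ℝ) × (Fin n → ℝ)) :
    IsWeakDeriv (field ζ) (hφ.memLp.toLp φ) ((hφ.along ζ).memLp.toLp _) := by
  rw [isWeakDeriv_iff]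
  intro ψ hψ
  have e1 : ∫ p, (hφ.along ζ).memLp.toLp _ p * ψ p = ∫ p, along (field ζ) φ p * ψ p := by
    refine integral_congr_ae ?_
    filter_upwards [(hφ.along ζ).memLp.coeFn_toLp] with p hp using by rw [hp]
  have e2 : ∫ p, hφ.memLp.toLp φ p * along (field ζ) ψ p = ∫ p, φ p * along (field ζ) ψ p := by
    refine integral_congr_ae ?_
    filter_upwards [hφ.memLp.coeFn_toLp] with p hp using by rw [hp]
  rw [e1, e2, integral_along_mul hφ hψ.1]

/-- The horizontal coordinate directions. -/
def dir : Fin n ⊕ Fin n → (Fin n → ℝ) × (Fin n → ℝ) :=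
  Sum.elim (fun j => (Pi.single j 1, 0)) (fun j => (0, Pi.single j 1))

theorem integral_toLp_mul {φ : H n → ℝ} (hφ : MemLp φ 2 (volume : Measure (H n))) (f : L2 n) :
    ∫ p, f p * φ p = inner ℝ (hφ.toLp φ) f := by
  rw [real_inner_comm, inner_toLp]

theorem isClosed_isWeakDeriv (ζ : (Fin n → ℝ) × (Fin n → ℝ)) :
    IsClosed {x : L2 n × L2 n | IsWeakDeriv (field ζ) x.1 x.2} := by
  simp only [isWeakDeriv_iff, ofPred_forall]
  refine isClosed_iInter fun φ => isClosed_iInter fun hφ => ?_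
  simp only [integral_toLp_mul hφ.memLp, integral_toLp_mul (hφ.along ζ).memLp]
  exact isClosed_eq (by fun_prop) (by fun_prop)

theorem IsWeakDeriv.add {ζ : (Fin n → ℝ) × (Fin n → ℝ)} {v w v' w' : L2 n}
    (h : IsWeakDeriv (field ζ) v w) (h' : IsWeakDeriv (field ζ) v' w') :
    IsWeakDeriv (field ζ) (v + v') (w + w') := by
  rw [isWeakDeriv_iff] at *
  intro φ hφ
  have h1 := h φ hφ
  have h2 := h' φ hφ
  simp only [integral_toLp_mul hφ.memLp, integral_toLp_mul (hφ.along ζ).memLp, inner_add_right] at *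
  linarith

theorem IsWeakDeriv.smul {ζ : (Fin n → ℝ) × (Fin n → ℝ)} {v w : L2 n}
    (h : IsWeakDeriv (field ζ) v w) (c : ℝ) : IsWeakDeriv (field ζ) (c • v) (c • w) := by
  rw [isWeakDeriv_iff] at *
  intro φ hφ
  have h1 := h φ hφ
  simp only [integral_toLp_mul hφ.memLp, integral_toLp_mul (hφ.along ζ).memLp, inner_smul_right] at *
  rw [h1]
  ring

theorem isWeakDeriv_zero (ζ : (Fin n → ℝ) × (Fin n → ℝ)) : IsWeakDeriv (field ζ) (0 : L2 n) 0 := by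
  rw [isWeakDeriv_iff]
  intro φ hφ
  simp only [integral_toLp_mul hφ.memLp, integral_toLp_mul (hφ.along ζ).memLp, inner_zero_right, neg_zero]

/-- The horizontal Sobolev space `H¹`, as the space of all `v` together with their weak derivatives
`X_j v`, `Y_j v`. -/
def sobolev (n : ℕ) : Submodule ℝ (PiLp 2 fun _ : Option (Fin n ⊕ Fin n) => L2 n) where
  carrier := {v | ∀ i, IsWeakDeriv (field (dir i)) (v none) (v (some i))}
  add_mem' h h' i := (h i).add (h' i)
  zero_mem' _ := isWeakDeriv_zero _
  smul_mem' c _ h i := (h i).smul c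

theorem isClosed_sobolev : IsClosed (sobolev n : Set (PiLp 2 fun _ : Option (Fin n ⊕ Fin n) => L2 n)) := by
  have : (sobolev n : Set (PiLp 2 fun _ : Option (Fin n ⊕ Fin n) => L2 n)) =
      ⋂ i, (fun v => (v none, v (some i))) ⁻¹' {x : L2 n × L2 n | IsWeakDeriv (field (dir i)) x.1 x.2} := by
    ext v
    simp [sobolev]
  rw [this]
  refine isClosed_iInter fun i => (isClosed_isWeakDeriv _).preimage ?_
  fun_prop

instance : CompleteSpace (sobolev n) := isClosed_sobolev.completeSpace_coe

/-- The embedding of the Sobolev space into `L²`. -/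
def sobolevEmb (n : ℕ) : sobolev n →L[ℝ] L2 n :=
  (PiLp.proj 2 (fun _ : Option (Fin n ⊕ Fin n) => L2 n) none) ∘L (sobolev n).subtypeL

theorem sobolev_norm_sq (v : sobolev n) :
    ‖v‖ ^ 2 = ‖sobolevEmb n v‖ ^ 2 + ∑ i, ‖v.1 (some i)‖ ^ 2 := by
  rw [Submodule.coe_norm, PiLp.norm_sq_eq_of_L2, Fintype.sum_option]
  rfl

theorem sobolev_inner (v w : sobolev n) :
    inner ℝ v w = inner ℝ (sobolevEmb n v) (sobolevEmb n w) + ∑ i, inner ℝ (v.1 (some i)) (w.1 (some i)) := by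
  rw [Submodule.coe_inner, PiLp.inner_apply, Fintype.sum_option]
  rfl

theorem norm_sobolevEmb_le (v : sobolev n) : ‖sobolevEmb n v‖ ≤ ‖v‖ := by
  refine le_of_sq_le_sq ?_ (norm_nonneg _)
  rw [sobolev_norm_sq]
  have : 0 ≤ ∑ i, ‖v.1 (some i)‖ ^ 2 := Finset.sum_nonneg fun _ _ => sq_nonneg _
  linarith

theorem injective_sobolevEmb : Function.Injective (sobolevEmb n) := by
  intro v w h
  refine Subtype.ext (PiLp.ext fun i => ?_)
  cases i with
  | none => exact h
  | some i =>
    refine IsWeakDeriv.unique (v.2 i) ?_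
    have h2 : v.1 none = w.1 none := h
    rw [h2]
    exact w.2 i

/-- A pair of an `L²` function and its weak derivatives, as an element of the Sobolev space. -/
def sobolevMk (v : L2 n) (w : Fin n ⊕ Fin n → L2 n) (h : ∀ i, IsWeakDeriv (field (dir i)) v (w i)) :
    sobolev n :=
  ⟨WithLp.toLp 2 fun o => o.elim v w, h⟩

theorem sobolevEmb_mk (v : L2 n) (w : Fin n ⊕ Fin n → L2 n)
    (h : ∀ i, IsWeakDeriv (field (dir i)) v (w i)) : sobolevEmb n (sobolevMk v w h) = v := rfl

theorem sobolevMk_some (v : L2 n) (w : Fin n ⊕ Fin n → L2 n)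
    (h : ∀ i, IsWeakDeriv (field (dir i)) v (w i)) (i : Fin n ⊕ Fin n) :
    (sobolevMk v w h).1 (some i) = w i := rfl

/-- A test function as an element of the Sobolev space. -/
def sobolevTest {φ : H n → ℝ} (hφ : IsTest φ) : sobolev n :=
  sobolevMk (hφ.memLp.toLp φ) (fun i => (hφ.along (dir i)).memLp.toLp _) fun _ => isWeakDeriv_toLp hφ _

theorem inner_sobolevTest (v : sobolev n) {φ : H n → ℝ} (hφ : IsTest φ) :
    inner ℝ v (sobolevTest hφ) = (∫ p, sobolevEmb n v p * φ p) +
      ∑ i, ∫ p, v.1 (some i) p * along (field (dir i)) φ p := by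
  rw [sobolev_inner, sobolevTest, sobolevEmb_mk, inner_toLp]
  simp only [sobolevMk_some, inner_toLp]

theorem denseRange_sobolevEmb : DenseRange (sobolevEmb n) := by
  refine denseRange_testToL2.mono ?_
  rintro _ ⟨⟨φ, hφ⟩, rfl⟩
  exact ⟨sobolevTest hφ, rfl⟩

/-! ### Density of test functions -/

theorem IsTest.comp_neg {φ : H n → ℝ} (hφ : IsTest φ) : IsTest fun p => φ (-p) :=
  ⟨hφ.1.comp contDiff_neg, hφ.2.comp_homeomorph (Homeomorph.neg (H n))⟩

theorem IsTest.comp_mul_left {φ : H n → ℝ} (hφ : IsTest φ) (q : H n) :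
    IsTest fun p => φ (Heisenberg.mul q p) := by
  refine ⟨hφ.1.comp (contDiff_mul contDiff_const contDiff_id), ?_⟩
  exact hφ.2.comp_homeomorph (Homeomorph.mk ⟨fun p => Heisenberg.mul q p, fun p => Heisenberg.mul (-q) p,
    fun p => neg_gmul_cancel_left q p, fun p => gmul_neg_cancel_left q p⟩
    (continuous_mul.comp (continuous_const.prodMk continuous_id))
    (continuous_mul.comp (continuous_const.prodMk continuous_id)))

theorem IsTest.kernel {ρ : H n → ℝ} (hρ : IsTest ρ) (p : H n) :
    IsTest fun q => ρ (Heisenberg.mul p (-q)) :=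
  (hρ.comp_mul_left p).comp_neg

/-- The group convolution `ρ * v`. -/
def mollify (ρ : H n → ℝ) (v : H n → ℝ) (p : H n) : ℝ := ∫ q, v q * ρ (mul p (-q))

theorem contDiff_mollify {ρ : H n → ℝ} (hρ : IsTest ρ) {v : H n → ℝ} (hv : LocallyIntegrable v volume) :
    ContDiff ℝ ∞ (mollify ρ v) := by
  rw [contDiff_iff_contDiffAt]
  intro p₀
  set k : Set (H n) := (fun x : H n × H n => mul (-x.1) x.2) '' (Metric.closedBall p₀ 1 ×ˢ tsupport ρ)
  have hk : IsCompact k := ((isCompact_closedBall p₀ 1).prod hρ.2.isCompact).image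
    (continuous_mul.comp (continuous_fst.neg.prodMk continuous_snd))
  -- The group convolution is read as an additive convolution evaluated at `0`, with `p` as a
  -- parameter in the kernel. Near `p₀` the kernels share the compact support set `k`.
  have h := contDiffOn_convolution_right_with_param_comp (𝕜 := ℝ) (n := ⊤) (μ := volume)
    (ContinuousLinearMap.mul ℝ ℝ) (s := Metric.ball p₀ 1) (v := fun _ : H n => (0 : H n))
    (g := fun p z => ρ (mul p z)) (k := k) (f := v) contDiffOn_const Metric.isOpen_ball hk
    (fun p x hp hx => by
      refine image_eq_zero_of_notMem_tsupport fun hm => hx ⟨(p, mul p x),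
        ⟨Metric.ball_subset_closedBall hp, hm⟩, neg_gmul_cancel_left p x⟩) hv
    (hρ.1.comp (contDiff_mul contDiff_fst contDiff_snd)).contDiffOn
  have e : mollify ρ v = fun p => convolution v (fun z => ρ (mul p z)) (ContinuousLinearMap.mul ℝ ℝ) volume 0 := by
    funext p
    simp [mollify, convolution]
  rw [e]
  exact h.contDiffAt (Metric.ball_mem_nhds p₀ one_pos)

/-- Moving `p` by the flow for time `s` equals moving `q` for time `-s`, since only `p q⁻¹` enters
the kernel. This is why the kernel acts from the left: left-invariant fields then commute with
mollification. -/
theorem along_mollify {ρ : H n → ℝ} (hρ : IsTest ρ) {v : H n → ℝ} (hv : LocallyIntegrable v volume)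
    (ζ : (Fin n → ℝ) × (Fin n → ℝ)) (p : H n) :
    along (field ζ) (mollify ρ v) p = -∫ q, v q * along (field ζ) (fun q => ρ (mul p (-q))) q := by
  have h1 := hasDerivAt_comp_mul ((contDiff_mollify hρ hv).differentiable (by simp)) ζ p 0
  have h2 := (hasDerivAt_integral_comp_mul hv (hρ.kernel p) ζ (-0)).scomp 0 (hasDerivAt_neg 0)
  have e : (fun s : ℝ => mollify ρ v (mul p (s • horizontal ζ))) =
      (fun s => ∫ q, v q * ρ (mul p (-mul q (s • horizontal ζ)))) ∘ fun s => -s := by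
    funext s
    simp only [mollify, Function.comp, neg_gmul, gmul_assoc, neg_smul, neg_neg]
  rw [e] at h1
  have := h1.unique h2
  simpa [gmul_zero] using this

theorem IsWeakDeriv.along_mollify {ζ : (Fin n → ℝ) × (Fin n → ℝ)} {v w : L2 n}
    (h : IsWeakDeriv (field ζ) v w) {ρ : H n → ℝ} (hρ : IsTest ρ) (p : H n) :
    along (field ζ) (mollify ρ v) p = mollify ρ w p := by
  rw [Heisenberg.along_mollify hρ (locallyIntegrable_L2 v), mollify, isWeakDeriv_iff.1 h _ (hρ.kernel p)]

theorem sq_integral_mul_le {α : Type*} [MeasurableSpace α] {μ : Measure α} {v φ : α → ℝ}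
    (h0 : Integrable φ μ) (h1 : Integrable (fun x => v x * φ x) μ)
    (h2 : Integrable (fun x => v x ^ 2 * |φ x|) μ) :
    (∫ x, v x * φ x ∂μ) ^ 2 ≤ (∫ x, |φ x| ∂μ) * ∫ x, v x ^ 2 * |φ x| ∂μ := by
  have h1' : Integrable (fun x => |v x| * |φ x|) μ := by simpa [abs_mul] using h1.abs
  have hd : discrim (∫ x, |φ x| ∂μ) (-(2 * ∫ x, |v x| * |φ x| ∂μ)) (∫ x, v x ^ 2 * |φ x| ∂μ) ≤ 0 := by
    refine discrim_le_zero fun c => ?_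
    have e : (∫ x, |φ x| ∂μ) * (c * c) + -(2 * ∫ x, |v x| * |φ x| ∂μ) * c + ∫ x, v x ^ 2 * |φ x| ∂μ =
        ∫ x, (|v x| - c) ^ 2 * |φ x| ∂μ := by
      have : ∀ x, (|v x| - c) ^ 2 * |φ x| =
          (c * c) * |φ x| - (2 * c) * (|v x| * |φ x|) + v x ^ 2 * |φ x| := fun x => by
        rw [sub_sq, sq_abs]; ring
      simp only [this]
      rw [integral_add (f := fun x => c * c * |φ x| - 2 * c * (|v x| * |φ x|))
        ((h0.abs.const_mul _).sub (h1'.const_mul _)) h2,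
        integral_sub (h0.abs.const_mul _) (h1'.const_mul _), integral_const_mul, integral_const_mul]
      ring
    rw [e]
    exact integral_nonneg fun x => by positivity
  have h3 : |∫ x, v x * φ x ∂μ| ≤ ∫ x, |v x| * |φ x| ∂μ := by
    simpa [abs_mul] using abs_integral_le_integral_abs (f := fun x => v x * φ x) (μ := μ)
  rw [discrim] at hd
  have h4 : (∫ x, v x * φ x ∂μ) ^ 2 ≤ (∫ x, |v x| * |φ x| ∂μ) ^ 2 := by
    rw [← sq_abs]; exact pow_le_pow_left₀ (abs_nonneg _) h3 2
  nlinarith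

theorem measurePreserving_mul_neg (p : H n) :
    MeasurePreserving (fun q => mul p (-q)) volume volume :=
  (measurePreserving_mul_left p).comp measurePreserving_neg

theorem measurableEmbedding_mul_neg (p : H n) : MeasurableEmbedding fun q => mul p (-q) :=
  (measurableEmbedding_mul_left p).comp (Homeomorph.neg (H n)).measurableEmbedding

/-- This is Young's inequality for `L¹ * L²`: Cauchy–Schwarz with weight `|ρ|`, then Fubini and
invariance of the measure. -/
theorem integrable_mollify_sq {ρ : H n → ℝ} (hρ : IsTest ρ) (v : L2 n) :
    Integrable (fun p => mollify ρ v p ^ 2) volume := by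
  have hρi : Integrable ρ volume := hρ.continuous.integrable_of_hasCompactSupport hρ.2
  have hv2 : Integrable (fun q => v q ^ 2) volume := (Lp.memLp v).integrable_sq
  have hker : Continuous fun x : H n × H n => ρ (mul x.1 (-x.2)) :=
    hρ.continuous.comp (continuous_mul.comp (continuous_fst.prodMk continuous_snd.neg))
  have hprod : Integrable (fun x : H n × H n => v x.2 ^ 2 * |ρ (mul x.1 (-x.2))|)
      ((volume : Measure (H n)).prod volume) := by
    rw [integrable_prod_iff']
    · refine ⟨Filter.Eventually.of_forall fun q => ?_, ?_⟩
      · change Integrable (fun p => v q ^ 2 * |ρ (mul p (-q))|) volume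
        exact (((measurePreserving_mul_right (-q)).integrable_comp hρi.aestronglyMeasurable).2 hρi).abs.const_mul _
      · have : ∀ q, ∫ p, ‖v q ^ 2 * |ρ (mul p (-q))|‖ = v q ^ 2 * ∫ p, |ρ p| := fun q => by
          simp only [norm_mul, norm_pow, Real.norm_eq_abs, sq_abs, abs_abs]
          rw [integral_const_mul, (measurePreserving_mul_right (-q)).integral_comp
            (measurableEmbedding_mul_right (-q)) fun p => |ρ p|]
        simp only [this]
        exact hv2.mul_const _
    · exact (hv2.aestronglyMeasurable.comp_snd).mul hker.abs.aestronglyMeasurable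
  have hdom := (hprod.integral_prod_left).const_mul (∫ q, |ρ q|)
  refine hdom.mono ((contDiff_mollify hρ (locallyIntegrable_L2 v)).continuous.pow 2).aestronglyMeasurable ?_
  filter_upwards [hprod.prod_right_ae] with p hp
  have hker' := hρ.kernel p
  have h := sq_integral_mul_le (μ := volume) (v := v) (φ := fun q => ρ (mul p (-q)))
    (hker'.continuous.integrable_of_hasCompactSupport hker'.2) (by
      simpa [mul_comm] using (locallyIntegrable_L2 v).integrable_smul_right_of_hasCompactSupport
        hker'.continuous hker'.2) hp
  rw [(measurePreserving_mul_neg p).integral_comp (measurableEmbedding_mul_neg p) fun q => |ρ q|] at h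
  rw [Real.norm_eq_abs, Real.norm_eq_abs, abs_of_nonneg (sq_nonneg _)]
  exact h.trans (le_abs_self _)

/-- The automorphic dilation. -/
def dilate (r : ℝ) (p : H n) : H n := (r • p.1, r • p.2.1, r ^ 2 * p.2.2)

theorem contDiff_dilate (r : ℝ) : ContDiff ℝ ∞ (dilate (n := n) r) :=
  (contDiff_fst.const_smul r).prodMk ((contDiff_snd.fst.const_smul r).prodMk
    (contDiff_const.mul contDiff_snd.snd))

theorem dilate_mul_smul_horizontal (r s : ℝ) (ζ : (Fin n → ℝ) × (Fin n → ℝ)) (p : H n) :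
    dilate r (mul p (s • horizontal ζ)) = mul (dilate r p) ((r * s) • horizontal ζ) := by
  rw [mul_smul_horizontal, mul_smul_horizontal]
  have e1 : ∑ j, r * p.1 j * ζ.2 j = r * ∑ j, p.1 j * ζ.2 j := by
    rw [Finset.mul_sum]
    exact Finset.sum_congr rfl fun _ _ => by ring
  have e2 : ∑ j, ζ.1 j * (r * p.2.1 j) = r * ∑ j, ζ.1 j * p.2.1 j := by
    rw [Finset.mul_sum]
    exact Finset.sum_congr rfl fun _ _ => by ring
  refine Prod.ext ?_ (Prod.ext ?_ ?_)
  · simp [dilate, field, mul_smul]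
  · simp [dilate, field, mul_smul]
  · simp only [dilate, field, Prod.snd_add, Prod.smul_snd, Pi.smul_apply, smul_eq_mul, e1, e2]
    ring

theorem along_comp_dilate {φ : H n → ℝ} (hφ : ContDiff ℝ ∞ φ) (r : ℝ)
    (ζ : (Fin n → ℝ) × (Fin n → ℝ)) (p : H n) :
    along (field ζ) (fun p => φ (dilate r p)) p = r * along (field ζ) φ (dilate r p) := by
  have h1 := hasDerivAt_comp_mul ((hφ.comp (contDiff_dilate r)).differentiable (by simp)) ζ p 0
  have h2 := (hasDerivAt_comp_mul (hφ.differentiable (by simp)) ζ (dilate r p) (r * 0)).comp 0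
    ((hasDerivAt_id (0 : ℝ)).const_mul r)
  simp only [Function.comp_def, dilate_mul_smul_horizontal] at h1 h2
  have := h1.unique h2
  simp only [zero_smul, gmul_zero, mul_zero, mul_one] at this
  rw [this, mul_comm]

theorem IsTest.comp_dilate {φ : H n → ℝ} (hφ : IsTest φ) {r : ℝ} (hr : r ≠ 0) :
    IsTest fun p => φ (dilate r p) := by
  have h1 : ∀ r : ℝ, Continuous (dilate (n := n) r) := fun r => (contDiff_dilate r).continuous
  have h2 : ∀ {r : ℝ} (_ : r ≠ 0) (p : H n), dilate r⁻¹ (dilate r p) = p := fun {r} hr p => by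
    simp [dilate, hr, smul_smul]
  exact ⟨hφ.1.comp (contDiff_dilate r), hφ.2.comp_homeomorph (Homeomorph.mk ⟨dilate r, dilate r⁻¹, h2 hr,
    fun p => by simpa using h2 (inv_ne_zero hr) p⟩ (h1 _) (h1 _))⟩

/-- Caccioppoli's inequality for `∑ Z_i² W = W`. -/
theorem integral_cutoff_sq_le {W : H n → ℝ} (hW : ContDiff ℝ ∞ W) {G : Fin n ⊕ Fin n → H n → ℝ}
    (hG : ∀ i, ContDiff ℝ ∞ (G i)) (hWG : ∀ i p, along (field (dir i)) W p = G i p)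
    (hGW : ∀ p, ∑ i, along (field (dir i)) (G i) p = W p) {η : H n → ℝ} (hη : IsTest η) :
    ∫ p, (η p) ^ 2 * W p ^ 2 ≤ ∫ p, W p ^ 2 * ∑ i, along (field (dir i)) η p ^ 2 := by
  have hint : ∀ {f : H n → ℝ}, IsTest f → Integrable f volume := fun h =>
    h.continuous.integrable_of_hasCompactSupport h.2
  have hη2 : IsTest fun p => η p * η p := hη.mul hη.1
  have hT : ∀ i, IsTest fun p => (η p * η p) * (W p * G i p) := fun i => hη2.mul (hW.mul (hG i))
  have hd : ∀ {f : H n → ℝ}, ContDiff ℝ ∞ f → Differentiable ℝ f := fun h => h.differentiable (by simp)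
  -- This is the horizontal divergence of `η² W ∇W`, whose integral vanishes. Completing the square
  -- in the cross term gives the inequality.
  have e0 : ∀ p, ∑ i, along (field (dir i)) (fun p => (η p * η p) * (W p * G i p)) p =
      η p ^ 2 * W p ^ 2 + ∑ i, (2 * η p * W p * along (field (dir i)) η p * G i p + η p ^ 2 * G i p ^ 2) := by
    intro p
    have : ∀ i, along (field (dir i)) (fun p => (η p * η p) * (W p * G i p)) p =
        η p ^ 2 * W p * along (field (dir i)) (G i) p +
          (2 * η p * W p * along (field (dir i)) η p * G i p + η p ^ 2 * G i p ^ 2) := fun i => by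
      rw [along_mul (hd hη2.1) (hd (hW.mul (hG i))), along_mul (hd hη.1) (hd hη.1),
        along_mul (hd hW) (hd (hG i)), hWG]
      ring
    simp only [this]
    rw [Finset.sum_add_distrib, ← Finset.mul_sum, hGW]
    ring
  have e1 : ∫ p, ∑ i, along (field (dir i)) (fun p => (η p * η p) * (W p * G i p)) p = 0 := by
    rw [integral_finsetSum _ fun i _ => hint ((hT i).along _)]
    exact Finset.sum_eq_zero fun i _ => integral_along_eq_zero (hT i) _
  have i1 : Integrable (fun p => η p ^ 2 * W p ^ 2) volume := by
    have := hint (hη2.mul (hW.mul hW))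
    refine this.congr (Filter.Eventually.of_forall fun p => ?_)
    ring
  have i2 : Integrable (fun p => W p ^ 2 * ∑ i, along (field (dir i)) η p ^ 2) volume := by
    simp only [Finset.mul_sum]
    refine integrable_finsetSum _ fun i _ => ?_
    have := hint (((hη.along (dir i)).mul (hη.along (dir i)).1).mul (hW.mul hW))
    refine this.congr (Filter.Eventually.of_forall fun p => ?_)
    ring
  have i3 : Integrable (fun p => ∑ i, along (field (dir i)) (fun p => (η p * η p) * (W p * G i p)) p) volume :=
    integrable_finsetSum _ fun i _ => hint ((hT i).along _)
  rw [← sub_nonpos, ← integral_sub i1 i2, ← e1]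
  refine integral_mono (i1.sub i2) i3 fun p => ?_
  simp only [e0, Finset.mul_sum]
  rw [sub_eq_add_neg, ← Finset.sum_neg_distrib]
  gcongr with i
  nlinarith [sq_nonneg (η p * G i p + W p * along (field (dir i)) η p)]

/-- Caccioppoli's inequality is applied to the cutoffs `η ∘ dilate r` with `r → 0`. Their horizontal
gradients are `O(r)`, since dilation scales horizontal fields by `r`, while the cutoffs tend to `1`.
-/
theorem eq_zero_of_subLaplacian_eq {W : H n → ℝ} (hW : ContDiff ℝ ∞ W) (hW2 : Integrable (fun p => W p ^ 2) volume)
    {G : Fin n ⊕ Fin n → H n → ℝ}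
    (hG : ∀ i, ContDiff ℝ ∞ (G i)) (hWG : ∀ i p, along (field (dir i)) W p = G i p)
    (hGW : ∀ p, ∑ i, along (field (dir i)) (G i) p = W p) (p : H n) : W p = 0 := by
  obtain ⟨η, hη, hη1, hηb⟩ : ∃ η : H n → ℝ, IsTest η ∧ (∀ᶠ p in nhds 0, η p = 1) ∧ ∀ p, |η p| ≤ 1 := by
    let b : ContDiffBump (0 : H n) := ⟨1, 2, one_pos, one_lt_two⟩
    refine ⟨b, ⟨b.contDiff, b.hasCompactSupport⟩, b.eventuallyEq_one, fun p => ?_⟩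
    rw [abs_of_nonneg b.nonneg]
    exact b.le_one
  have hα : ∀ i, ∃ C, ∀ p, |along (field (dir i)) η p| ≤ C := fun i =>
    (hη.along (dir i)).2.exists_bound_of_continuous (hη.along (dir i)).continuous
  choose C hC using hα
  set S : ℝ := ∑ i, C i ^ 2 with hS
  set r : ℕ → ℝ := fun k => ((k : ℝ) + 1)⁻¹ with hr
  have hr0 : ∀ k, r k ≠ 0 := fun k => by simp only [hr]; positivity
  have hrlim : Filter.Tendsto r Filter.atTop (nhds 0) := tendsto_inv_atTop_zero.comp
    (Filter.tendsto_atTop_add_const_right _ _ tendsto_natCast_atTop_atTop)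
  have hle : ∀ k, ∫ p, (η (dilate (r k) p)) ^ 2 * W p ^ 2 ≤ r k ^ 2 * (S * ∫ p, W p ^ 2) := fun k => by
    refine (integral_cutoff_sq_le hW hG hWG hGW (hη.comp_dilate (hr0 k))).trans ?_
    rw [← integral_const_mul, ← integral_const_mul]
    refine integral_mono_of_nonneg (Filter.Eventually.of_forall fun p => by positivity)
      ((hW2.const_mul _).const_mul _) (Filter.Eventually.of_forall fun p => ?_)
    simp only [along_comp_dilate hη.1, mul_pow, ← Finset.mul_sum]
    have : ∑ i, along (field (dir i)) η (dilate (r k) p) ^ 2 ≤ S := by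
      refine Finset.sum_le_sum fun i _ => ?_
      rw [← sq_abs]
      exact pow_le_pow_left₀ (abs_nonneg _) (hC i _) 2
    calc _ ≤ W p ^ 2 * (r k ^ 2 * S) := by gcongr
      _ = _ := by ring
  have hlim : Filter.Tendsto (fun k => ∫ p, (η (dilate (r k) p)) ^ 2 * W p ^ 2) Filter.atTop
      (nhds (∫ p, W p ^ 2)) := by
    refine tendsto_integral_of_dominated_convergence (fun p => W p ^ 2) (fun k => ?_) hW2
      (fun k => Filter.Eventually.of_forall fun p => ?_) (Filter.Eventually.of_forall fun p => ?_)
    · exact (((hη.comp_dilate (hr0 k)).continuous.pow 2).mul (hW.continuous.pow 2)).aestronglyMeasurable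
    · rw [norm_mul, norm_pow, norm_pow, Real.norm_eq_abs, Real.norm_eq_abs, sq_abs (W p)]
      exact mul_le_of_le_one_left (sq_nonneg _) (pow_le_one₀ (abs_nonneg _) (hηb _))
    · have h1 : Filter.Tendsto (fun k => dilate (r k) p) Filter.atTop (nhds 0) := by
        have h2 : Continuous fun r : ℝ => dilate r p := by unfold dilate; fun_prop
        have h3 := (h2.tendsto 0).comp hrlim
        have h4 : dilate 0 p = 0 := by simp [dilate]
        rwa [h4] at h3
      refine tendsto_const_nhds.congr' ?_
      filter_upwards [h1.eventually hη1] with k hk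
      rw [hk, one_pow, one_mul]
  have hlim2 : Filter.Tendsto (fun k => r k ^ 2 * (S * ∫ p, W p ^ 2)) Filter.atTop (nhds 0) := by
    simpa using (hrlim.pow 2).mul_const (S * ∫ p, W p ^ 2)
  have h0 : ∫ p, W p ^ 2 ≤ 0 := le_of_tendsto_of_tendsto' hlim hlim2 hle
  have h1 : (fun p => W p ^ 2) =ᵐ[volume] 0 :=
    (integral_eq_zero_iff_of_nonneg (fun p => sq_nonneg _) hW2).1
      (le_antisymm h0 (integral_nonneg fun p => sq_nonneg _))
  have h2 := (Continuous.ae_eq_iff_eq (g := fun _ => (0 : ℝ)) (volume : Measure (H n))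
    (hW.continuous.pow 2) continuous_const).1 h1
  simpa using congrFun h2 p

/-- This is density of test functions in `H¹`. Orthogonality says that `w` minus its sub-Laplacian
is zero in the sense of distributions; mollification commutes with the fields and makes this
classical, so the Liouville result applies. -/
theorem eq_zero_of_inner_sobolevTest {w : sobolev n}
    (h : ∀ φ : H n → ℝ, ∀ hφ : IsTest φ, inner ℝ w (sobolevTest hφ) = 0) : w = 0 := by
  have key : ∀ ρ : H n → ℝ, IsTest ρ → ∀ p, mollify ρ (sobolevEmb n w) p = 0 := fun ρ hρ =>
    eq_zero_of_subLaplacian_eq (contDiff_mollify hρ (locallyIntegrable_L2 _)) (integrable_mollify_sq hρ _)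
      (G := fun i => mollify ρ (w.1 (some i))) (fun i => contDiff_mollify hρ (locallyIntegrable_L2 _))
      (fun i p => IsWeakDeriv.along_mollify (w.2 i) hρ p) (fun p => by
        simp only [along_mollify hρ (locallyIntegrable_L2 _)]
        have := h _ (hρ.kernel p)
        rw [inner_sobolevTest] at this
        rw [Finset.sum_neg_distrib, mollify]
        linarith)
  have h0 : sobolevEmb n w = 0 := eq_zero_of_integral_test fun φ hφ => by
    -- With the reflected kernel, the mollification at the identity is the pairing with `φ`.
    have := key _ hφ.comp_neg 0
    simpa [mollify, zero_gmul] using this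
  exact injective_sobolevEmb (by rw [h0, map_zero])

/-! ### Markov property of the resolvent -/

/-- Truncation of a real number to `[-1, 1]`. -/
def clamp (x : ℝ) : ℝ := max (-1) (min x 1)

theorem lipschitzWith_clamp : LipschitzWith 1 clamp := by
  have := (LipschitzWith.id.min_const (1 : ℝ)).const_max (-1)
  exact this

theorem clamp_zero : clamp 0 = 0 := by simp [clamp]

theorem clamp_eq_self {x : ℝ} : clamp x = x ↔ |x| ≤ 1 := by
  rw [abs_le, clamp]
  constructor
  · intro h
    constructor
    · rw [← h]; exact le_max_left _ _
    · rw [← h]; exact max_le (by norm_num) (min_le_right _ _)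
  · rintro ⟨h1, h2⟩
    rw [min_eq_left h2, max_eq_right h1]

/-- Truncation on `L²`. -/
def clampL2 (f : L2 n) : L2 n := lipschitzWith_clamp.compLp clamp_zero f

theorem coeFn_clampL2 (f : L2 n) : clampL2 f =ᵐ[volume] fun p => clamp (f p) :=
  lipschitzWith_clamp.coeFn_compLp clamp_zero f

theorem norm_clampL2_sub_le (f g : L2 n) : ‖clampL2 f - clampL2 g‖ ≤ ‖f - g‖ := by
  have := lipschitzWith_clamp.norm_compLp_sub_le clamp_zero f g
  rwa [NNReal.coe_one, one_mul] at this

theorem rightTranslate_clampL2 (q : H n) (f : L2 n) :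
    rightTranslate q (clampL2 f) = clampL2 (rightTranslate q f) := by
  refine Lp.ext ?_
  filter_upwards [coeFn_rightTranslate q (clampL2 f), coeFn_clampL2 (rightTranslate q f),
    coeFn_rightTranslate q f,
    (measurePreserving_mul_right q).quasiMeasurePreserving.ae (coeFn_clampL2 f)] with p h1 h2 h3 h4
  rw [h1, h2, h3, h4]

/-- Functions bounded by `a`. -/
def IsBddBy (a : ℝ) (f : L2 n) : Prop := ∀ᵐ p, |f p| ≤ a

theorem isBddBy_one_iff {f : L2 n} : IsBddBy 1 f ↔ clampL2 f = f := by
  constructor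
  · intro h
    refine Lp.ext ?_
    filter_upwards [coeFn_clampL2 f, h] with p h1 h2
    rw [h1, clamp_eq_self.2 h2]
  · intro h
    have h1 := coeFn_clampL2 f
    rw [h] at h1
    filter_upwards [h1] with p hp
    exact clamp_eq_self.1 hp.symm

theorem isClosed_isBddBy_one : IsClosed {f : L2 n | IsBddBy 1 f} := by
  simp only [isBddBy_one_iff]
  have hc : Continuous (clampL2 (n := n)) :=
    LipschitzWith.continuous (K := 1) (LipschitzWith.of_dist_le_mul fun f g => by
      simpa [dist_eq_norm] using norm_clampL2_sub_le f g)
  exact isClosed_eq hc continuous_id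

theorem isBddBy_zero : IsBddBy 0 (0 : L2 n) := by
  filter_upwards [Lp.coeFn_zero ℝ 2 (volume : Measure (H n))] with p hp
  rw [hp]; simp

theorem IsBddBy.add {a b : ℝ} {f g : L2 n} (hf : IsBddBy a f) (hg : IsBddBy b g) :
    IsBddBy (a + b) (f + g) := by
  filter_upwards [hf, hg, Lp.coeFn_add f g] with p h1 h2 h3
  rw [h3]
  exact (abs_add_le _ _).trans (add_le_add h1 h2)

theorem IsBddBy.smul {a : ℝ} {f : L2 n} (hf : IsBddBy a f) {c : ℝ} (hc : 0 ≤ c) :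
    IsBddBy (c * a) (c • f) := by
  filter_upwards [hf, Lp.coeFn_smul c f] with p h1 h2
  rw [h2, Pi.smul_apply, smul_eq_mul, abs_mul, abs_of_nonneg hc]
  gcongr

theorem IsBddBy.mono {a b : ℝ} {f : L2 n} (hf : IsBddBy a f) (h : a ≤ b) : IsBddBy b f :=
  Filter.Eventually.mono hf fun _ hp => hp.trans h

/-- Truncation is `1`-Lipschitz on `L²` and commutes with translations, so it does not increase
difference quotients, hence not the norms of weak derivatives. -/
theorem exists_sobolev_clamp (v : sobolev n) : ∃ w : sobolev n,
    sobolevEmb n w = clampL2 (sobolevEmb n v) ∧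
      ∑ i, ‖w.1 (some i)‖ ^ 2 ≤ ∑ i, ‖v.1 (some i)‖ ^ 2 := by
  have h : ∀ i, ∃ w, IsWeakDeriv (field (dir i)) (clampL2 (sobolevEmb n v)) w ∧ ‖w‖ ≤ ‖v.1 (some i)‖ :=
    fun i => exists_weakDeriv_of_norm_sub_le (norm_nonneg _) fun s => by
      rw [rightTranslate_clampL2]
      exact (norm_clampL2_sub_le _ _).trans (norm_rightTranslate_sub_le (v.2 i) s)
  choose w hw hn using h
  exact ⟨sobolevMk _ w hw, sobolevEmb_mk _ _ _, Finset.sum_le_sum fun i _ =>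
    pow_le_pow_left₀ (norm_nonneg _) (hn i) 2⟩

/-- The resolvent `v = J* f` minimises the squared gradient norm plus `‖J v - f‖²`, and the excess
of any competitor `w` is `‖w - v‖²`. Truncating `v` does not increase the functional when `|f| ≤ 1`,
so `v` equals its truncation. -/
theorem isBddBy_resolvent {f : L2 n} (hf : IsBddBy 1 f) :
    IsBddBy 1 ((1 - defect (sobolevEmb n)) f) := by
  rw [one_sub_defect_apply, isBddBy_one_iff]
  set v := (sobolevEmb n).adjoint f with hv
  obtain ⟨w, hw, hE⟩ := exists_sobolev_clamp v
  have h1 : inner ℝ w v = inner ℝ (sobolevEmb n w) f := by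
    rw [hv, ContinuousLinearMap.adjoint_inner_right]
  have h2 : ‖v‖ ^ 2 = inner ℝ (sobolevEmb n v) f := by
    rw [← ContinuousLinearMap.adjoint_inner_right, ← hv, real_inner_self_eq_norm_sq]
  have h3 : ‖sobolevEmb n w - f‖ ≤ ‖sobolevEmb n v - f‖ := by
    rw [hw]
    nth_rw 1 [← isBddBy_one_iff.1 hf]
    exact norm_clampL2_sub_le _ _
  have h4 := pow_le_pow_left₀ (norm_nonneg _) h3 2
  have h5 := norm_sub_sq_real w v
  rw [norm_sub_sq_real, norm_sub_sq_real] at h4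
  have h6 := sobolev_norm_sq v
  have h7 := sobolev_norm_sq w
  have h8 : ‖w - v‖ ^ 2 ≤ 0 := by linarith
  have h9 : w = v := by
    rw [← sub_eq_zero, ← norm_eq_zero]
    exact pow_eq_zero_iff two_ne_zero |>.1 (le_antisymm h8 (sq_nonneg _))
  rw [← hw, h9]

theorem heat_eq_exp_smul {E : Type*} [NormedAddCommGroup E] [InnerProductSpace ℝ E] [CompleteSpace E]
    (D : E →L[ℝ] E) (t : ℝ) : heat D t = Real.exp (-t) • NormedSpace.exp (t • (1 - D)) := by
  let _ := NormedAlgebra.restrictScalars ℚ ℝ (E →L[ℝ] E)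
  have e : t • (-D) = (-t) • (1 : E →L[ℝ] E) + t • (1 - D) := by
    rw [smul_sub, neg_smul, smul_neg]; abel
  rw [heat, e, NormedSpace.exp_add_of_commute (((Commute.one_left _).smul_left _))]
  rw [← Algebra.algebraMap_eq_smul_one, ← NormedSpace.algebraMap_exp_comm,
    Algebra.algebraMap_eq_smul_one, smul_mul_assoc, one_mul, Real.exp_eq_exp_ℝ]

/-- As `exp (-t D) = e⁻ᵗ exp (t (1 - D))`, the flow is a Poisson average of powers of the resolvent,
each of which preserves the bound. The weights of the partial sums add up to at most `1`. -/
theorem isBddBy_heat {f : L2 n} (hf : IsBddBy 1 f) {t : ℝ} (ht : 0 ≤ t) :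
    IsBddBy 1 (heat (defect (sobolevEmb n)) t f) := by
  set R := 1 - defect (sobolevEmb n) with hR
  have hpow : ∀ k : ℕ, IsBddBy 1 ((R ^ k) f) := fun k => by
    induction k with
    | zero => simpa using hf
    | succ k ih => rw [pow_succ', mul_apply_eq_comp]; exact isBddBy_resolvent ih
  have hs := ((NormedSpace.exp_series_hasSum_exp' (𝕂 := ℝ) (t • R)).mapL
    (ContinuousLinearMap.apply ℝ (L2 n) f)).const_smul (Real.exp (-t))
  have e : heat (defect (sobolevEmb n)) t f =
      Real.exp (-t) • (ContinuousLinearMap.apply ℝ (L2 n) f) (NormedSpace.exp (t • R)) := by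
    rw [heat_eq_exp_smul]; rfl
  rw [e]
  refine isClosed_isBddBy_one.mem_of_tendsto hs.tendsto_sum_nat (Filter.Eventually.of_forall fun N => ?_)
  have hN : IsBddBy (∑ k ∈ Finset.range N, Real.exp (-t) * (t ^ k / k.factorial))
      (∑ k ∈ Finset.range N, Real.exp (-t) • (ContinuousLinearMap.apply ℝ (L2 n) f)
        (((k.factorial : ℝ)⁻¹) • (t • R) ^ k)) := by
    induction N with
    | zero => simpa using isBddBy_zero
    | succ N ih =>
      rw [Finset.sum_range_succ, Finset.sum_range_succ]
      refine ih.add ?_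
      have : (ContinuousLinearMap.apply ℝ (L2 n) f) (((N.factorial : ℝ)⁻¹) • (t • R) ^ N) =
          (t ^ N / N.factorial) • (R ^ N) f := by
        rw [ContinuousLinearMap.apply_apply, smul_pow, smul_smul, smul_apply]
        congr 1
        rw [div_eq_inv_mul]
      rw [this, smul_smul]
      simpa using (hpow N).smul (c := Real.exp (-t) * (t ^ N / N.factorial)) (by positivity)
  refine hN.mono ?_
  rw [← Finset.mul_sum]
  calc Real.exp (-t) * ∑ k ∈ Finset.range N, t ^ k / k.factorial ≤ Real.exp (-t) * Real.exp t := by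
        gcongr; exact Real.sum_le_exp_of_nonneg ht N
    _ = 1 := by rw [← Real.exp_add]; simp

theorem inner_le_L1norm {f h : L2 n} (hf : Integrable f volume) (hh : IsBddBy 1 h) :
    inner ℝ f h ≤ L1norm f := by
  rw [inner_L2, L1norm]
  have hi : Integrable (fun p => f p * h p) volume := by
    refine hf.mono (hf.aestronglyMeasurable.mul (Lp.aestronglyMeasurable h)) ?_
    filter_upwards [hh] with p hp
    rw [norm_mul]
    exact mul_le_of_le_one_right (norm_nonneg _) hp
  refine integral_mono_ae hi hf.abs ?_
  filter_upwards [hh] with p hp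
  calc f p * h p ≤ |f p * h p| := le_abs_self _
    _ = |f p| * |h p| := abs_mul _ _
    _ ≤ |f p| := mul_le_of_le_one_right (abs_nonneg _) hp

/-- The `L¹` norm by duality. -/
theorem lintegral_enorm_le_of_inner_le {f : L2 n} {K : ℝ} (h : ∀ g, IsBddBy 1 g → inner ℝ f g ≤ K) :
    ∫⁻ p, ‖f p‖ₑ ≤ ENNReal.ofReal K := by
  set S := spanningSets (volume : Measure (H n)) with hS
  have hm : ∀ k, MeasurableSet (S k) := fun k => measurableSet_spanningSets _ k
  have hfm : Measurable f := (Lp.stronglyMeasurable f).measurable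
  -- Integrability of `f` is not known in advance, so the sign of `f` is cut off to sets of finite
  -- measure, where it lies in `L²`, and the sets are then exhausted.
  have hk : ∀ k, ∫⁻ p in S k, ‖f p‖ₑ ≤ ENNReal.ofReal K := fun k => by
    have hsm : AEStronglyMeasurable ((S k).indicator fun p => (SignType.sign (f p) : ℝ)) volume := by
      refine Measurable.aestronglyMeasurable (Measurable.indicator ?_ (hm k))
      have : Measurable fun x : ℝ => (SignType.sign x : ℝ) := by
        have : (fun x : ℝ => (SignType.sign x : ℝ)) = fun x => if 0 < x then 1 else if x < 0 then -1 else 0 := by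
          funext x
          rw [sign_apply]
          split_ifs <;> simp
        rw [this]
        exact Measurable.ite measurableSet_Ioi measurable_const
          (Measurable.ite measurableSet_Iio measurable_const measurable_const)
      exact this.comp hfm
    have hb : ∀ p, |(S k).indicator (fun p => (SignType.sign (f p) : ℝ)) p| ≤ 1 := fun p => by
      by_cases hp : p ∈ S k
      · rw [indicator_of_mem hp]
        rcases lt_trichotomy (f p) 0 with h | h | h <;> simp [h, sign_neg, sign_pos]
      · rw [indicator_of_notMem hp]; simp
    have hmem : MemLp ((S k).indicator fun p => (SignType.sign (f p) : ℝ)) 2 volume := by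
      have h1 : MemLp ((S k).indicator fun _ => (1 : ℝ)) 2 (volume : Measure (H n)) :=
        memLp_indicator_const 2 (hm k) 1 (Or.inr (measure_spanningSets_lt_top _ k).ne)
      refine h1.mono hsm (Filter.Eventually.of_forall fun p => ?_)
      by_cases hp : p ∈ S k
      · have := hb p
        rw [indicator_of_mem hp (f := fun _ => (1 : ℝ))]
        simpa using this
      · simp [hp]
    have h1 := h (hmem.toLp _) (by
      filter_upwards [hmem.coeFn_toLp] with p hp
      rw [hp]; exact hb p)
    rw [inner_toLp] at h1
    have e : (fun p => f p * (S k).indicator (fun p => (SignType.sign (f p) : ℝ)) p) =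
        (S k).indicator fun p => |f p| := by
      funext p
      by_cases hp : p ∈ S k
      · rw [indicator_of_mem hp, indicator_of_mem hp, mul_comm, sign_mul_self]
      · rw [indicator_of_notMem hp, indicator_of_notMem hp, mul_zero]
    rw [e, integral_indicator (hm k)] at h1
    have hi : Integrable (fun p => |f p|) (volume.restrict (S k)) := by
      have : IsFiniteMeasure ((volume : Measure (H n)).restrict (S k)) :=
        ⟨by rw [Measure.restrict_apply_univ]; exact measure_spanningSets_lt_top _ k⟩
      exact (((Lp.memLp f).restrict (S k)).integrable (by norm_num)).abs
    have h2 := ENNReal.ofReal_le_ofReal h1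
    rw [ofReal_integral_eq_lintegral_ofReal hi (Filter.Eventually.of_forall fun _ => abs_nonneg _)] at h2
    simpa [Real.enorm_eq_ofReal_abs] using h2
  have hU : ∫⁻ p, ‖f p‖ₑ = ⨆ k, ∫⁻ p in S k, ‖f p‖ₑ := by
    rw [← setLIntegral_iUnion_of_directed, iUnion_spanningSets, setLIntegral_univ]
    exact (monotone_spanningSets _).directed_le
  rw [hU]
  exact iSup_le hk

/-! ### The Nash inequality -/

theorem rightTranslate_mul (g g' : H n) (v : L2 n) :
    rightTranslate (mul g g') v = rightTranslate g (rightTranslate g' v) := by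
  refine Lp.ext ?_
  filter_upwards [coeFn_rightTranslate (mul g g') v, coeFn_rightTranslate g (rightTranslate g' v),
    (measurePreserving_mul_right g).quasiMeasurePreserving.ae (coeFn_rightTranslate g' v)]
    with p h1 h2 h3
  rw [h1, h2, h3, gmul_assoc]

theorem norm_rightTranslate_mul_sub_le (g g' : H n) (v : L2 n) :
    ‖rightTranslate (mul g g') v - v‖ ≤ ‖rightTranslate g v - v‖ + ‖rightTranslate g' v - v‖ := by
  have e : rightTranslate (mul g g') v - v =
      (rightTranslate g v - v) + rightTranslate g (rightTranslate g' v - v) := by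
    rw [rightTranslate_mul, map_sub]; abel
  rw [e]
  refine (norm_add_le _ _).trans ?_
  rw [LinearIsometry.norm_map]

theorem field_eq_sum (ζ : (Fin n → ℝ) × (Fin n → ℝ)) (p : H n) :
    field ζ p = ∑ i, Sum.elim ζ.1 ζ.2 i • field (dir i) p := by
  have h1 : ∀ z : Fin n → ℝ, z = ∑ j, z j • (Pi.single j 1 : Fin n → ℝ) := fun z => by
    ext k; simp [Finset.sum_apply, Pi.single_apply]
  rw [Fintype.sum_sum_type]
  refine Prod.ext ?_ (Prod.ext ?_ ?_)
  · simpa [field, dir, Prod.fst_sum, Prod.snd_sum] using h1 ζ.1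
  · simpa [field, dir, Prod.fst_sum, Prod.snd_sum] using h1 ζ.2
  · simp [field, dir, Prod.snd_sum, Pi.single_apply, Finset.mul_sum, mul_sub,
      ← Finset.sum_add_distrib, ← Finset.sum_sub_distrib]
    refine Finset.sum_congr rfl fun _ _ => ?_
    ring

theorem isWeakDeriv_sum (v : sobolev n) (ζ : (Fin n → ℝ) × (Fin n → ℝ)) :
    IsWeakDeriv (field ζ) (sobolevEmb n v) (∑ i, Sum.elim ζ.1 ζ.2 i • v.1 (some i)) := by
  rw [isWeakDeriv_iff]
  intro φ hφ
  have hi : ∀ i, inner ℝ (hφ.memLp.toLp φ) (v.1 (some i)) =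
      -inner ℝ ((hφ.along (dir i)).memLp.toLp _) (sobolevEmb n v) := fun i => by
    have := isWeakDeriv_iff.1 (v.2 i) φ hφ
    rwa [integral_toLp_mul hφ.memLp, integral_toLp_mul (hφ.along (dir i)).memLp] at this
  have e : (hφ.along ζ).memLp.toLp _ =
      ∑ i, Sum.elim ζ.1 ζ.2 i • (hφ.along (dir i)).memLp.toLp _ := by
    refine Lp.ext ?_
    have h2 : ∀ i, ((hφ.along (dir i)).memLp.toLp _ : L2 n) =ᵐ[volume] along (field (dir i)) φ :=
      fun i => MemLp.coeFn_toLp _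
    have h3 : ∀ i, ((Sum.elim ζ.1 ζ.2 i • (hφ.along (dir i)).memLp.toLp _ : L2 n) : H n → ℝ)
        =ᵐ[volume] Sum.elim ζ.1 ζ.2 i • ((hφ.along (dir i)).memLp.toLp _ : L2 n) :=
      fun i => Lp.coeFn_smul _ _
    filter_upwards [(hφ.along ζ).memLp.coeFn_toLp, ae_all_iff.2 h2, ae_all_iff.2 h3,
      Lp.coeFn_finsetSum Finset.univ fun i => Sum.elim ζ.1 ζ.2 i • (hφ.along (dir i)).memLp.toLp _]
      with p hp h2 h3 h4
    rw [hp, h4]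
    simp only [Finset.sum_apply, h3, h2, Pi.smul_apply]
    simp only [along]
    rw [field_eq_sum, map_sum]
    simp
  rw [integral_toLp_mul hφ.memLp, integral_toLp_mul (hφ.along ζ).memLp, e, sum_inner, inner_sum,
    ← Finset.sum_neg_distrib]
  refine Finset.sum_congr rfl fun i _ => ?_
  rw [inner_smul_left, inner_smul_right, hi]
  simp

/-- The `L²` norm of the horizontal gradient. -/
def sobolevGrad (v : sobolev n) : ℝ := √(∑ i, ‖v.1 (some i)‖ ^ 2)

theorem sobolevGrad_sq (v : sobolev n) : sobolevGrad v ^ 2 = ‖v‖ ^ 2 - ‖sobolevEmb n v‖ ^ 2 := by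
  rw [sobolevGrad, Real.sq_sqrt (Finset.sum_nonneg fun _ _ => sq_nonneg _), sobolev_norm_sq]
  ring

theorem sobolevGrad_nonneg (v : sobolev n) : 0 ≤ sobolevGrad v := Real.sqrt_nonneg _

theorem norm_le_sobolevGrad (v : sobolev n) (i : Fin n ⊕ Fin n) : ‖v.1 (some i)‖ ≤ sobolevGrad v :=
  Real.le_sqrt_of_sq_le
    (Finset.single_le_sum (f := fun i => ‖v.1 (some i)‖ ^ 2) (fun _ _ => sq_nonneg _) (Finset.mem_univ i))

theorem norm_rightTranslate_horizontal_sub_le (v : sobolev n) (ζ : (Fin n → ℝ) × (Fin n → ℝ)) :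
    ‖rightTranslate (horizontal ζ) (sobolevEmb n v) - sobolevEmb n v‖ ≤
      (∑ i, |Sum.elim ζ.1 ζ.2 i|) * sobolevGrad v := by
  have h := norm_rightTranslate_sub_le (isWeakDeriv_sum v ζ) 1
  rw [one_smul, abs_one, one_mul] at h
  refine h.trans ((norm_sum_le _ _).trans ?_)
  rw [Finset.sum_mul]
  refine Finset.sum_le_sum fun i _ => ?_
  rw [norm_smul, Real.norm_eq_abs]
  exact mul_le_mul_of_nonneg_left (norm_le_sobolevGrad v i) (abs_nonneg _)

/-- Four horizontal moves of length `a` produce a central displacement `a²`; this is how the missing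
direction `∂_τ` is controlled by the horizontal gradient. -/
theorem mul_commutator (j : Fin n) (a : ℝ) :
    mul (mul (a • horizontal (dir (Sum.inl j))) (a • horizontal (dir (Sum.inr j))))
      (mul ((-a) • horizontal (dir (Sum.inl j))) ((-a) • horizontal (dir (Sum.inr j)))) =
      ((0, 0, a ^ 2) : H n) := by
  refine Prod.ext ?_ (Prod.ext ?_ ?_)
  · simp [mul, horizontal, dir]
  · simp [mul, horizontal, dir]
  · simp [mul, horizontal, dir, Pi.single_apply]
    ring

theorem norm_rightTranslate_center_sub_le (j : Fin n) (v : sobolev n) {a : ℝ} (ha : 0 ≤ a) :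
    ‖rightTranslate ((0, 0, a ^ 2) : H n) (sobolevEmb n v) - sobolevEmb n v‖ ≤
      4 * a * sobolevGrad v := by
  have h : ∀ i, ∀ s : ℝ, |s| = a →
      ‖rightTranslate (s • horizontal (dir i)) (sobolevEmb n v) - sobolevEmb n v‖ ≤
        a * sobolevGrad v := fun i s hs => by
    refine (norm_rightTranslate_sub_le (v.2 i) s).trans ?_
    rw [hs]
    exact mul_le_mul_of_nonneg_left (norm_le_sobolevGrad v i) ha
  have hp : |a| = a := abs_of_nonneg ha
  have hm : |-a| = a := by rw [abs_neg, hp]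
  rw [← mul_commutator j]
  have h1 := norm_rightTranslate_mul_sub_le
    (mul (a • horizontal (dir (Sum.inl j))) (a • horizontal (dir (Sum.inr j))))
    (mul ((-a) • horizontal (dir (Sum.inl j))) ((-a) • horizontal (dir (Sum.inr j)))) (sobolevEmb n v)
  have h2 := norm_rightTranslate_mul_sub_le (a • horizontal (dir (Sum.inl j)))
    (a • horizontal (dir (Sum.inr j))) (sobolevEmb n v)
  have h3 := norm_rightTranslate_mul_sub_le ((-a) • horizontal (dir (Sum.inl j)))
    ((-a) • horizontal (dir (Sum.inr j))) (sobolevEmb n v)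
  have := h (Sum.inl j) a hp
  have := h (Sum.inr j) a hp
  have := h (Sum.inl j) (-a) hm
  have := h (Sum.inr j) (-a) hm
  linarith

/-- A box adapted to the dilations of the group. -/
def box (n : ℕ) (r : ℝ) : Set (H n) :=
  Icc 0 (fun _ => r) ×ˢ Icc 0 (fun _ => r) ×ˢ Icc 0 (r ^ 2)

theorem measurableSet_box (r : ℝ) : MeasurableSet (box n r) :=
  measurableSet_Icc.prod (measurableSet_Icc.prod measurableSet_Icc)

theorem volume_box {r : ℝ} (hr : 0 ≤ r) : volume (box n r) = ENNReal.ofReal (r ^ (2 * n + 2)) := by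
  rw [box, Measure.volume_eq_prod, Measure.prod_prod, Measure.volume_eq_prod, Measure.prod_prod,
    Real.volume_Icc_pi, Real.volume_Icc]
  simp only [Pi.zero_apply, sub_zero, Finset.prod_const, Finset.card_univ, Fintype.card_fin]
  rw [← ENNReal.ofReal_pow hr, ← ENNReal.ofReal_mul (by positivity), ← ENNReal.ofReal_mul (by positivity)]
  congr 1
  ring

/-- A point of the box is a horizontal element times a central one. The first costs at most `2 n r`;
the second is a commutator with `a = √τ ≤ r` and costs `4 r`. At least one pair of directions is
needed, hence `1 ≤ n`. -/
theorem norm_rightTranslate_box_sub_le (hn : 1 ≤ n) (v : sobolev n) {r : ℝ} (hr : 0 ≤ r) {g : H n}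
    (hg : g ∈ box n r) : ‖rightTranslate g (sobolevEmb n v) - sobolevEmb n v‖ ≤
      (2 * n + 4) * r * sobolevGrad v := by
  obtain ⟨x, y, τ⟩ := g
  obtain ⟨⟨hx0, hx1⟩, ⟨hy0, hy1⟩, hτ0, hτ1⟩ := hg
  have e : ((x, y, τ) : H n) = mul (horizontal (x, y)) (0, 0, √τ ^ 2) := by
    rw [Real.sq_sqrt hτ0]
    refine Prod.ext ?_ (Prod.ext ?_ ?_) <;> simp [mul, horizontal]
  have h1 := norm_rightTranslate_mul_sub_le (horizontal (x, y)) (0, 0, √τ ^ 2) (sobolevEmb n v)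
  have h2 := norm_rightTranslate_horizontal_sub_le v (x, y)
  have h3 := norm_rightTranslate_center_sub_le ⟨0, hn⟩ v (Real.sqrt_nonneg τ)
  rw [← e] at h1
  have hs : √τ ≤ r := Real.sqrt_le_iff.2 ⟨hr, hτ1⟩
  have hb : ∑ i, |Sum.elim x y i| ≤ 2 * n * r := by
    have : ∀ i ∈ (Finset.univ : Finset (Fin n ⊕ Fin n)), |Sum.elim x y i| ≤ r := by
      rintro (i | i) -
      · exact abs_le.2 ⟨by have : 0 ≤ x i := hx0 i; simp; linarith, hx1 i⟩
      · exact abs_le.2 ⟨by have : 0 ≤ y i := hy0 i; simp; linarith, hy1 i⟩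
    refine (Finset.sum_le_card_nsmul _ _ _ this).trans (le_of_eq ?_)
    rw [nsmul_eq_mul, Finset.card_univ, Fintype.card_sum, Fintype.card_fin]
    push_cast; ring
  have h4 := mul_le_mul_of_nonneg_right hb (sobolevGrad_nonneg v)
  have h5 := mul_le_mul_of_nonneg_right hs (sobolevGrad_nonneg v)
  simp only at h2
  linarith

theorem setLIntegral_enorm_mul_le (f : L2 n) (p : H n) (s : Set (H n)) :
    ∫⁻ g in s, ‖f (mul p g)‖ₑ ≤ ‖f‖ₑ * volume s ^ (1 / 2 : ℝ) := by
  have hm : AEStronglyMeasurable (fun g => f (mul p g)) (volume : Measure (H n)) :=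
    (Lp.aestronglyMeasurable f).comp_measurePreserving (measurePreserving_mul_left p)
  have h1 := eLpNorm_le_eLpNorm_mul_rpow_measure_univ (μ := (volume : Measure (H n)).restrict s)
    (f := fun g => f (mul p g)) (p := 1) (q := 2) (by norm_num) hm.restrict
  rw [eLpNorm_one_eq_lintegral_enorm, Measure.restrict_apply_univ] at h1
  have h2 : eLpNorm (fun g => f (mul p g)) 2 ((volume : Measure (H n)).restrict s) ≤ ‖f‖ₑ := by
    refine (eLpNorm_restrict_le _ _ _ _).trans (le_of_eq ?_)
    have := eLpNorm_comp_measurePreserving (p := 2) (Lp.aestronglyMeasurable f)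
      (measurePreserving_mul_left p)
    exact this.trans (Lp.enorm_def f).symm
  have e : (1 / (1 : ENNReal).toReal - 1 / (2 : ENNReal).toReal) = (1 / 2 : ℝ) := by norm_num
  rw [e] at h1
  exact h1.trans (mul_le_mul_left h2 _)

/-- If `f` is close to its translates then `⟪f, f(· g)⟫ ≥ ‖f‖² - c ‖f‖`. Averaged over the box, this
correlation is at most the `L¹` norm times `‖f‖` divided by the square root of the volume, by
Cauchy–Schwarz in `g`; that root is `r ^ (n + 1)`. -/
theorem norm_le_of_translates {f : L2 n} {K c r : ℝ} (hK : 0 ≤ K) (hr : 0 < r)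
    (hf : ∫⁻ p, ‖f p‖ₑ ≤ ENNReal.ofReal K)
    (h : ∀ g ∈ box n r, ‖rightTranslate g f - f‖ ≤ c) : ‖f‖ ≤ c + K / r ^ (n + 1) := by
  have hmf : Measurable f := (Lp.stronglyMeasurable f).measurable
  have hmul : Measurable fun x : H n × H n => mul x.1 x.2 :=
    (continuous_mul.comp (continuous_fst.prodMk continuous_snd)).measurable
  have h1 : ∀ g ∈ box n r, ENNReal.ofReal (‖f‖ ^ 2 - c * ‖f‖) ≤ ∫⁻ p, ‖f p‖ₑ * ‖f (mul p g)‖ₑ := by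
    intro g hg
    have e1 : ‖f‖ ^ 2 - c * ‖f‖ ≤ inner ℝ f (rightTranslate g f) := by
      have e2 : inner ℝ f (rightTranslate g f) = ‖f‖ ^ 2 + inner ℝ f (rightTranslate g f - f) := by
        rw [inner_sub_right, real_inner_self_eq_norm_sq]; ring
      have e3 := neg_le_of_abs_le (abs_real_inner_le_norm f (rightTranslate g f - f))
      have e4 := mul_le_mul_of_nonneg_left (h g hg) (norm_nonneg f)
      linarith
    refine (ENNReal.ofReal_le_ofReal e1).trans ?_
    rw [inner_L2]
    refine (ENNReal.ofReal_le_ofReal (le_abs_self _)).trans ?_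
    rw [← Real.enorm_eq_ofReal_abs]
    refine (enorm_integral_le_lintegral_enorm _).trans (le_of_eq (lintegral_congr_ae ?_))
    filter_upwards [coeFn_rightTranslate g f] with p hp
    rw [enorm_mul, hp]
  have h2 : ENNReal.ofReal (‖f‖ ^ 2 - c * ‖f‖) * volume (box n r) ≤
      ENNReal.ofReal K * (‖f‖ₑ * volume (box n r) ^ (1 / 2 : ℝ)) := by
    calc ENNReal.ofReal (‖f‖ ^ 2 - c * ‖f‖) * volume (box n r)
        = ∫⁻ _ in box n r, ENNReal.ofReal (‖f‖ ^ 2 - c * ‖f‖) := (setLIntegral_const _ _).symm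
      _ ≤ ∫⁻ g in box n r, ∫⁻ p, ‖f p‖ₑ * ‖f (mul p g)‖ₑ :=
          setLIntegral_mono' (measurableSet_box r) h1
      _ = ∫⁻ p, ∫⁻ g in box n r, ‖f p‖ₑ * ‖f (mul p g)‖ₑ := by
          refine lintegral_lintegral_swap (Measurable.aemeasurable ?_)
          exact (hmf.comp measurable_snd).enorm.mul
            (hmf.comp (hmul.comp (measurable_snd.prodMk measurable_fst))).enorm
      _ = ∫⁻ p, ‖f p‖ₑ * ∫⁻ g in box n r, ‖f (mul p g)‖ₑ := by
          refine lintegral_congr fun p => lintegral_const_mul _ ?_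
          exact (hmf.comp (hmul.comp (measurable_const.prodMk measurable_id))).enorm
      _ ≤ ∫⁻ p, ‖f p‖ₑ * (‖f‖ₑ * volume (box n r) ^ (1 / 2 : ℝ)) :=
          lintegral_mono fun p => mul_le_mul_right (setLIntegral_enorm_mul_le f p _) _
      _ = (∫⁻ p, ‖f p‖ₑ) * (‖f‖ₑ * volume (box n r) ^ (1 / 2 : ℝ)) :=
          lintegral_mul_const _ hmf.enorm
      _ ≤ _ := mul_le_mul_left hf _
  have e5 : ENNReal.ofReal (r ^ (2 * n + 2)) ^ (1 / 2 : ℝ) = ENNReal.ofReal (r ^ (n + 1)) := by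
    rw [ENNReal.ofReal_rpow_of_nonneg (by positivity) (by norm_num), ← Real.sqrt_eq_rpow]
    congr 1
    rw [show r ^ (2 * n + 2) = (r ^ (n + 1)) ^ 2 by ring, Real.sqrt_sq (by positivity)]
  rw [volume_box hr.le, e5, ← ofReal_norm, ← ENNReal.ofReal_mul (norm_nonneg _),
    ← ENNReal.ofReal_mul hK, ← ENNReal.ofReal_mul' (by positivity),
    ENNReal.ofReal_le_ofReal_iff (by positivity)] at h2
  have hrp : 0 < r ^ (n + 1) := by positivity
  rcases (norm_nonneg f).eq_or_lt with h0 | h0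
  · rw [← h0]
    have : 0 ≤ c := (norm_nonneg _).trans (h 0 ⟨⟨le_rfl, fun _ => hr.le⟩, ⟨le_rfl, fun _ => hr.le⟩,
      ⟨le_rfl, by positivity⟩⟩)
    positivity
  · have h3 : (‖f‖ - c) * r ^ (n + 1) ≤ K := by
      refine le_of_mul_le_mul_right ?_ (mul_pos h0 hrp)
      calc (‖f‖ - c) * r ^ (n + 1) * (‖f‖ * r ^ (n + 1))
          = (‖f‖ ^ 2 - c * ‖f‖) * r ^ (2 * n + 2) := by ring
        _ ≤ _ := h2
    have := (le_div_iff₀ hrp).2 h3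
    linarith

/-- The Nash inequality on the Heisenberg group. -/
theorem norm_sobolevEmb_le_of_lintegral_le (hn : 1 ≤ n) (v : sobolev n) {K r : ℝ} (hK : 0 ≤ K)
    (hr : 0 < r) (hv : ∫⁻ p, ‖sobolevEmb n v p‖ₑ ≤ ENNReal.ofReal K) :
    ‖sobolevEmb n v‖ ≤ (2 * n + 4) * r * sobolevGrad v + K / r ^ (n + 1) :=
  norm_le_of_translates hK hr hv fun _ hg => norm_rightTranslate_box_sub_le hn v hr.le hg

/-! ### Decay of the semigroup on integrable functions -/

theorem isUnitInterval_sobolev : IsUnitInterval (defect (sobolevEmb n)) :=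
  isUnitInterval_defect norm_sobolevEmb_le

theorem heatForm_one_eq {E : Type*} [NormedAddCommGroup E] [InnerProductSpace ℝ E] [CompleteSpace E]
    {D : E →L[ℝ] E} (hD : IsUnitInterval D) (t : ℝ) (x : E) :
    heatForm D 1 t x = inner ℝ (D (heat D (t / 2) x)) (heat D (t / 2) x) := by
  rw [heatForm, pow_one, ← hD.heat_symm, ← mul_apply_eq_comp, ← mul_apply_eq_comp,
    ← (heat_commute (Commute.refl D) _).eq, mul_assoc, ← heat_add, add_halves]

theorem lintegral_enorm_le_L1norm {f : L2 n} (hf : Integrable f volume) :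
    ∫⁻ p, ‖f p‖ₑ ≤ ENNReal.ofReal (L1norm f) :=
  lintegral_enorm_le_of_inner_le fun _ hg => inner_le_L1norm hf hg

theorem L1norm_nonneg (f : L2 n) : 0 ≤ L1norm f := integral_nonneg fun _ => abs_nonneg _

/-- The operators are symmetric, so `L¹` contractivity is dual to `L^∞` contractivity. -/
theorem lintegral_enorm_resolvent_heat_le {f : L2 n} (hf : Integrable f volume) {t : ℝ} (ht : 0 ≤ t) :
    ∫⁻ p, ‖(1 - defect (sobolevEmb n)) (heat (defect (sobolevEmb n)) t f) p‖ₑ ≤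
      ENNReal.ofReal (L1norm f) := by
  refine lintegral_enorm_le_of_inner_le fun g hg => ?_
  rw [isUnitInterval_sobolev.one_sub.symm, isUnitInterval_sobolev.heat_symm]
  exact inner_le_L1norm hf (isBddBy_heat (isBddBy_resolvent hg) ht)

/-- The half-time flow `g` need not lie in the form domain, so the Nash inequality is applied to its
resolvent `v`, with `r = √s`. The gradient of `v` and the error `D g = g - J v` are both bounded by
`√⟪D g, g⟫`. -/
theorem heatForm_nash (hn : 1 ≤ n) {f : L2 n} (hf : Integrable f volume) {t s : ℝ} (ht : 0 ≤ t)
    (hs : 1 ≤ s) : heatForm (defect (sobolevEmb n)) 0 t f * s ^ (n + 1) ≤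
      2 * (2 * n + 5) ^ 2 *
        (s ^ (n + 1 + 1) * heatForm (defect (sobolevEmb n)) 1 t f + L1norm f ^ 2) := by
  have hD := isUnitInterval_sobolev (n := n)
  set D := defect (sobolevEmb n) with hDdef
  have h1 := lintegral_enorm_resolvent_heat_le hf (by positivity : (0 : ℝ) ≤ t / 2)
  rw [heatForm_zero_eq hD, heatForm_one_eq hD]
  set g := heat D (t / 2) f
  set v := (sobolevEmb n).adjoint g with hv
  have hJv : sobolevEmb n v = g - D g := by
    rw [hv, ← one_sub_defect_apply]; simp [hDdef]
  have hs0 : 0 < s := by linarith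
  rw [one_sub_defect_apply] at h1
  have h2 := norm_sobolevEmb_le_of_lintegral_le hn v (L1norm_nonneg f) (Real.sqrt_pos.2 hs0) h1
  have hDg : ‖D g‖ ^ 2 ≤ inner ℝ (D g) g := hD.norm_sq_apply_le g
  have hv2 : ‖v‖ ^ 2 = inner ℝ (g - D g) g := by
    rw [← real_inner_self_eq_norm_sq, hv, ContinuousLinearMap.adjoint_inner_right, ← hv, hJv]
  have hgr : sobolevGrad v ^ 2 ≤ inner ℝ (D g) g := by
    rw [sobolevGrad_sq, hv2, hJv, ← real_inner_self_eq_norm_sq]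
    simp only [inner_sub_left, inner_sub_right, real_inner_comm g (D g)]
    rw [real_inner_self_eq_norm_sq (D g)]
    nlinarith [sq_nonneg ‖D g‖]
  set h := (inner ℝ (D g) g : ℝ)
  have hh : 0 ≤ h := (sq_nonneg _).trans hDg
  have e1 : ‖D g‖ ≤ √h := Real.le_sqrt_of_sq_le hDg
  have e2 : sobolevGrad v ≤ √h := Real.le_sqrt_of_sq_le hgr
  have e3 : ‖g‖ ≤ ‖sobolevEmb n v‖ + ‖D g‖ := by
    have : g = sobolevEmb n v + D g := by rw [hJv]; abel
    calc ‖g‖ = ‖sobolevEmb n v + D g‖ := by rw [← this]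
      _ ≤ _ := norm_add_le _ _
  have hs1 : 1 ≤ √s := by rw [← Real.sqrt_one]; exact Real.sqrt_le_sqrt hs
  -- The error `‖D g‖ ≤ √h` is absorbed by `√s √h`, which requires `s ≥ 1` and raises `2 n + 4` to
  -- `2 n + 5`.
  have e4 : ‖g‖ ≤ (2 * n + 5) * (√s * √h) + L1norm f / √s ^ (n + 1) := by
    have a1 := mul_le_mul_of_nonneg_left e2 (by positivity : 0 ≤ (2 * (n : ℝ) + 4) * √s)
    have a2 := mul_le_mul_of_nonneg_right hs1 (Real.sqrt_nonneg h)
    linarith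
  have e5 : ‖g‖ * √s ^ (n + 1) ≤ (2 * n + 5) * √s ^ (n + 2) * √h + L1norm f := by
    have hp : 0 < √s ^ (n + 1) := by positivity
    calc ‖g‖ * √s ^ (n + 1)
        ≤ ((2 * n + 5) * (√s * √h) + L1norm f / √s ^ (n + 1)) * √s ^ (n + 1) := by gcongr
      _ = _ := by field_simp; ring
  have e6 : ∀ k : ℕ, (√s ^ k) ^ 2 = s ^ k := fun k => by
    rw [← pow_mul, mul_comm, pow_mul, Real.sq_sqrt hs0.le]
  calc ‖g‖ ^ 2 * s ^ (n + 1) = (‖g‖ * √s ^ (n + 1)) ^ 2 := by rw [mul_pow, e6]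
    _ ≤ ((2 * n + 5) * √s ^ (n + 2) * √h + L1norm f) ^ 2 := by gcongr
    _ ≤ 2 * (((2 * n + 5) * √s ^ (n + 2) * √h) ^ 2 + L1norm f ^ 2) := add_sq_le
    _ = 2 * ((2 * n + 5) ^ 2 * (s ^ (n + 1 + 1) * h) + 1 * L1norm f ^ 2) := by
        rw [mul_pow, mul_pow, e6, Real.sq_sqrt hh]; ring
    _ ≤ 2 * ((2 * n + 5) ^ 2 * (s ^ (n + 1 + 1) * h) + (2 * n + 5) ^ 2 * L1norm f ^ 2) := by
        gcongr
        nlinarith [(Nat.cast_nonneg n : (0 : ℝ) ≤ n)]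
    _ = _ := by ring

theorem exists_heatForm_decay_of_integrable (hn : 1 ≤ n) : ∃ C : ℝ, 0 < C ∧ ∀ f : L2 n,
    Integrable f volume → ∀ t, 0 ≤ t →
      heatForm (defect (sobolevEmb n)) 0 t f * (1 + t) ^ (n + 1) ≤ C * (‖f‖ ^ 2 + L1norm f ^ 2) := by
  set A : ℝ := 2 * (2 * n + 5) ^ 2 * ((n + 1 : ℕ) + 1) with hA
  have hA0 : 0 < A := by positivity
  refine ⟨(1 + A) ^ (n + 1) * (1 + A), by positivity, fun f hf t ht => ?_⟩
  refine (heatForm_decay_of_nash isUnitInterval_sobolev (n + 1) (by positivity)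
    (sq_nonneg (L1norm f)) f (fun t ht s hs => heatForm_nash hn hf ht hs) ht).trans ?_
  rw [← hA]
  have h : ‖f‖ ^ 2 + A * L1norm f ^ 2 ≤ (1 + A) * (‖f‖ ^ 2 + L1norm f ^ 2) := by
    nlinarith [mul_nonneg hA0.le (sq_nonneg ‖f‖), sq_nonneg (L1norm f)]
  exact (mul_le_mul_of_nonneg_left h (by positivity : 0 ≤ (1 + A) ^ (n + 1))).trans_eq (by ring)

theorem norm_sobolevEmb_le_of_integrable (hn : 1 ≤ n) (v : sobolev n)
    (hv : Integrable (sobolevEmb n v) volume) :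
    ‖sobolevEmb n v‖ ≤ (2 * n + 4) * sobolevGrad v + L1norm (sobolevEmb n v) := by
  have := norm_sobolevEmb_le_of_lintegral_le hn v (L1norm_nonneg _) one_pos
    (lintegral_enorm_le_L1norm hv)
  simpa using this

/-! ### Solutions as damped waves on the form domain -/

theorem isWeakDeriv_weakDeriv {Z : H n → H n} {v : L2 n} (h : ∃ w, IsWeakDeriv Z v w) :
    IsWeakDeriv Z v (weakDeriv Z v) := by
  rw [weakDeriv, dif_pos h]
  exact h.choose_spec

/-- The weak derivatives of `v` in the directions `dir`. -/
def horizontalGrad (v : L2 n) : Fin n ⊕ Fin n → L2 n :=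
  Sum.elim (fun j => weakDeriv (vecX j) v) (fun j => weakDeriv (vecY j) v)

theorem MemH1.isWeakDeriv {v : L2 n} (h : MemH1 v) (i : Fin n ⊕ Fin n) :
    IsWeakDeriv (field (dir i)) v (horizontalGrad v i) := by
  rcases i with j | j
  · have := isWeakDeriv_weakDeriv (h j).1
    rw [vecX_eq] at this
    simpa [dir, horizontalGrad, vecX_eq] using this
  · have := isWeakDeriv_weakDeriv (h j).2
    rw [vecY_eq] at this
    simpa [dir, horizontalGrad, vecY_eq] using this

open Classical in
/-- An element of `H¹` as an element of the Sobolev space. -/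
def sobolevLift (v : L2 n) : sobolev n :=
  if h : MemH1 v then sobolevMk v (horizontalGrad v) h.isWeakDeriv else 0

theorem sobolevLift_eq {v : L2 n} (h : MemH1 v) :
    sobolevLift v = sobolevMk v (horizontalGrad v) h.isWeakDeriv := dif_pos h

theorem sobolevEmb_lift {v : L2 n} (h : MemH1 v) : sobolevEmb n (sobolevLift v) = v := by
  rw [sobolevLift_eq h, sobolevEmb_mk]

theorem sobolevGrad_lift {v : L2 n} (h : MemH1 v) : sobolevGrad (sobolevLift v) = gradNorm v := by
  rw [sobolevLift_eq h, sobolevGrad, gradNorm, Fintype.sum_sum_type, Finset.sum_add_distrib]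
  rfl

theorem norm_sq_sobolevLift {v : L2 n} (h : MemH1 v) :
    ‖sobolevLift v‖ ^ 2 = ‖v‖ ^ 2 + gradNorm v ^ 2 := by
  rw [← sobolevGrad_lift h, sobolevGrad_sq, sobolevEmb_lift h]
  ring

theorem EnergyClass.continuousOn_lift {u : ℝ → L2 n} (h : EnergyClass u) :
    ContinuousOn (fun t => sobolevLift (u t)) (Ici 0) := by
  rw [Topology.IsInducing.subtypeVal.continuousOn_iff]
  have h1 : ContinuousOn (fun t => WithLp.toLp 2 fun o : Option (Fin n ⊕ Fin n) =>
      o.elim (u t) (horizontalGrad (u t))) (Ici 0) := by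
    refine (PiLp.continuous_toLp 2 _).comp_continuousOn (continuousOn_pi.2 fun o => ?_)
    rcases o with _ | j | j
    · exact h.diff.continuousOn
    · exact h.contX j
    · exact h.contY j
  refine h1.congr fun t ht => ?_
  simp only [Function.comp, sobolevLift_eq (h.memH1 t ht)]
  rfl

theorem integral_mul_subLaplacian {v : L2 n} (h : MemH1 v) {φ : H n → ℝ} (hφ : IsTest φ) :
    ∫ p, v p * subLaplacian φ p = -∑ i, ∫ p, horizontalGrad v i p * along (field (dir i)) φ p := by
  have e : ∀ p, v p * subLaplacian φ p =
      ∑ i, v p * along (field (dir i)) (along (field (dir i)) φ) p := fun p => by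
    rw [subLaplacian, Fintype.sum_sum_type, Finset.mul_sum, ← Finset.sum_add_distrib]
    refine Finset.sum_congr rfl fun j _ => ?_
    rw [vecX_eq, vecY_eq, mul_add]
    rfl
  simp only [e]
  rw [integral_finsetSum _ fun i _ => ?_, ← Finset.sum_neg_distrib]
  · refine Finset.sum_congr rfl fun i _ => ?_
    rw [isWeakDeriv_iff.1 (h.isWeakDeriv i) _ (hφ.along _), neg_neg]
  · have hψ := (hφ.along (dir i)).along (dir i)
    simpa [mul_comm] using
      (locallyIntegrable_L2 v).integrable_smul_right_of_hasCompactSupport hψ.continuous hψ.2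

/-- A weak derivative that is norm continuous is a strong one: pairing with the total set `S`
identifies `ξ` with a primitive of `ζ`. -/
theorem hasDerivAt_of_hasDerivAt_inner {X : Type*} [NormedAddCommGroup X] [InnerProductSpace ℝ X]
    [CompleteSpace X] {ξ ζ : ℝ → X} {S : Set X} (hS : ∀ w : X, (∀ s ∈ S, inner ℝ w s = 0) → w = 0)
    (hζ : ContinuousOn ζ (Ioi 0))
    (h : ∀ s ∈ S, ∀ t, 0 < t → HasDerivAt (fun t => inner ℝ s (ξ t)) (inner ℝ s (ζ t)) t)
    {t : ℝ} (ht : 0 < t) : HasDerivAt ξ (ζ t) t := by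
  have hsub : ∀ {x}, 0 < x → uIcc (t / 2) x ⊆ Ioi 0 := fun {x} hx y hy =>
    (lt_min (half_pos ht) hx).trans_le hy.1
  have hint : ∀ {x}, 0 < x → IntervalIntegrable ζ volume (t / 2) x := fun hx =>
    (hζ.mono (hsub hx)).intervalIntegrable
  have e : ∀ x, 0 < x → ξ x = ξ (t / 2) + ∫ y in (t / 2)..x, ζ y := fun x hx => by
    rw [← sub_eq_zero]
    refine hS _ fun s hs => ?_
    have h1 : ∫ y in (t / 2)..x, (inner ℝ s (ζ y) : ℝ) = inner ℝ s (∫ y in (t / 2)..x, ζ y) :=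
      (innerSL ℝ s).intervalIntegral_comp_comm (hint hx)
    have h2 := intervalIntegral.integral_eq_sub_of_hasDerivAt (fun y hy => h s hs y (hsub hx hy))
      ((continuousOn_const.inner (hζ.mono (hsub hx))).intervalIntegrable)
    rw [real_inner_comm, inner_sub_right, inner_add_right, ← h1, h2]
    ring
  have h3 : HasDerivAt (fun x => ξ (t / 2) + ∫ y in (t / 2)..x, ζ y) (ζ t) t :=
    (intervalIntegral.integral_hasDerivAt_right (hint ht)
      (hζ.stronglyMeasurableAtFilter isOpen_Ioi t ht) (hζ.continuousAt (Ioi_mem_nhds ht))).const_add _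
  refine h3.congr_of_eventuallyEq ?_
  filter_upwards [Ioi_mem_nhds ht] with x hx using e x hx

/-- Tested against `φ` in the `H¹` inner product, the equation reads `(J* w)' = -v + J* u - J* w`
with `J v = u`, and the right side is continuous into `H¹`. Applying `J` gives the required form. -/
theorem IsSolution.isDampedWave {u₀ u₁ : L2 n} {u : ℝ → L2 n} (h : IsSolution u₀ u₁ u) :
    IsDampedWave (sobolevEmb n) (fun t => sobolevLift (u t)) u (dt u) where
  eq t ht := (sobolevEmb_lift (h.energy.memH1 t ht)).symm
  cont := h.energy.diff.continuousOn
  cont' := h.energy.cont_dt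
  deriv t ht := (h.energy.diff t ht.le).hasDerivWithinAt.hasDerivAt (Ici_mem_nhds ht)
  deriv' t ht := by
    set J := sobolevEmb n
    have hc : ContinuousOn (fun t => -sobolevLift (u t) + J.adjoint (u t) - J.adjoint (dt u t)) (Ioi 0) :=
      ((h.energy.continuousOn_lift.neg.add
        (J.adjoint.continuous.comp_continuousOn h.energy.diff.continuousOn)).sub
        (J.adjoint.continuous.comp_continuousOn h.energy.cont_dt)).mono Ioi_subset_Ici_self
    have key : HasDerivAt (fun t => J.adjoint (dt u t))
        (-sobolevLift (u t) + J.adjoint (u t) - J.adjoint (dt u t)) t := by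
      refine hasDerivAt_of_hasDerivAt_inner (S := {s | ∃ φ, ∃ hφ : IsTest φ, s = sobolevTest hφ})
        (fun w hw => eq_zero_of_inner_sobolevTest fun φ hφ => hw _ ⟨φ, hφ, rfl⟩) hc ?_ ht
      rintro _ ⟨φ, hφ, rfl⟩ t ht
      have e1 : ∀ f : L2 n, inner ℝ (sobolevTest hφ) (J.adjoint f) = ∫ p, f p * φ p := fun f => by
        rw [ContinuousLinearMap.adjoint_inner_right, real_inner_comm, ← inner_toLp f hφ.memLp]
        rfl
      simp only [inner_sub_right, inner_add_right, inner_neg_right, e1]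
      refine (h.equation φ hφ t ht).congr_deriv ?_
      have hm := h.energy.memH1 t ht.le
      rw [real_inner_comm, inner_sobolevTest, sobolevEmb_lift hm, integral_mul_subLaplacian hm hφ,
        sobolevLift_eq hm]
      simp only [sobolevMk_some]
      ring
    have := J.hasFDerivAt.comp_hasDerivAt t key
    simp only [one_sub_defect_apply]
    refine this.congr_deriv ?_
    have e2 : J (sobolevLift (u t)) = u t := sobolevEmb_lift (h.energy.memH1 t ht.le)
    rw [map_sub, map_add, map_neg, e2, ← one_sub_defect_apply J (u t)]
    simp only [sub_apply, one_apply_eq_self]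
    abel

theorem le_rpow_of_sq_mul_pow_le {x B C M t e : ℝ} (k : ℕ) (he : e = -(k / 2)) (ht : 0 ≤ t)
    (hB : 0 ≤ B) (hCM : C ≤ M) (hM : 1 ≤ M) (h : x ^ 2 * (1 + t) ^ k ≤ C * B ^ 2) :
    x ≤ M * (1 + t) ^ e * B := by
  have h0 : 0 < 1 + t := by linarith
  have hy : ((1 + t) ^ e) ^ 2 * (1 + t) ^ k = 1 := by
    rw [← Real.rpow_natCast ((1 + t) ^ e), ← Real.rpow_mul h0.le, ← Real.rpow_natCast (1 + t) k,
      ← Real.rpow_add h0, he]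
    norm_num
  have hM2 : M ≤ M ^ 2 := by nlinarith
  refine le_of_sq_le_sq ?_ (by positivity)
  refine le_of_mul_le_mul_right ?_ (pow_pos h0 k)
  calc x ^ 2 * (1 + t) ^ k ≤ C * B ^ 2 := h
    _ ≤ M ^ 2 * B ^ 2 := mul_le_mul_of_nonneg_right (hCM.trans hM2) (sq_nonneg B)
    _ = M ^ 2 * B ^ 2 * (((1 + t) ^ e) ^ 2 * (1 + t) ^ k) := by rw [hy, mul_one]
    _ = (M * (1 + t) ^ e * B) ^ 2 * (1 + t) ^ k := by ring

theorem heatForm_zero_le {E : Type*} [NormedAddCommGroup E] [InnerProductSpace ℝ E] [CompleteSpace E]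
    {D : E →L[ℝ] E} (hD : IsUnitInterval D) {t : ℝ} (ht : 0 ≤ t) (x : E) :
    heatForm D 0 t x ≤ ‖x‖ ^ 2 := by
  rw [← heatForm_zero_zero D x]
  exact heatForm_antitone hD 0 x ht

theorem sq_add_sq_le_of_add_le {a b c : ℝ} (ha : 0 ≤ a) (hb : 0 ≤ b) (h : a + b ≤ c) :
    a ^ 2 + b ^ 2 ≤ c ^ 2 := by
  nlinarith [mul_nonneg ha hb]

theorem gradNorm_nonneg (v : L2 n) : 0 ≤ gradNorm v := Real.sqrt_nonneg _

/-! ### Decay estimates for solutions -/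

variable {u₀ u₁ : L2 n} {u : ℝ → L2 n}

theorem IsSolution.norm_decay (h : IsSolution u₀ u₁ u) (a : ℕ) {B : ℝ}
    (hu₀ : ∀ t, 0 ≤ t → heatForm (defect (sobolevEmb n)) 0 t u₀ * (1 + t) ^ a ≤ B)
    (hu₁ : ∀ t, 0 ≤ t → heatForm (defect (sobolevEmb n)) 0 t u₁ * (1 + t) ^ a ≤ B)
    {t : ℝ} (ht : 0 ≤ t) : ‖u t‖ ^ 2 * (1 + t) ^ a ≤ 22 * 2 ^ a * B :=
  norm_sq_decay norm_sobolevEmb_le h.isDampedWave a (by rwa [h.init]) (by rwa [h.init_dt]) ht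

theorem exists_solution_decay (n a : ℕ) : ∃ C : ℝ, 0 < C ∧
    ∀ {u₀ u₁ : L2 n} {u : ℝ → L2 n}, IsSolution u₀ u₁ u → ∀ B : ℝ,
      (∀ t, 0 ≤ t → heatForm (defect (sobolevEmb n)) 0 t u₀ * (1 + t) ^ a ≤ B) →
      (∀ t, 0 ≤ t → heatForm (defect (sobolevEmb n)) 0 t u₁ * (1 + t) ^ a ≤ B) →
      ‖u₀‖ ^ 2 + gradNorm u₀ ^ 2 ≤ B → ∀ t, 0 ≤ t →
        gradNorm (u t) ^ 2 * (1 + t) ^ (a + 1) ≤ C * B ∧ ‖dt u t‖ ^ 2 * (1 + t) ^ (a + 2) ≤ C * B := by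
  obtain ⟨C, hC, hd⟩ := exists_energy_decay a
  refine ⟨C, hC, fun {u₀ u₁ u} h B h0 h1 hB t ht => ?_⟩
  have hm := h.energy.memH1
  have := hd norm_sobolevEmb_le injective_sobolevEmb denseRange_sobolevEmb h.isDampedWave B
    (by rwa [h.init]) (by rwa [h.init_dt])
    (by rw [norm_sq_sobolevLift (hm 0 le_rfl), h.init]; exact hB) t ht
  rw [← sobolevGrad_sq, sobolevGrad_lift (hm t ht)] at this
  exact this

theorem exists_bound (n : ℕ) : ∃ C : ℝ, ∀ M, C ≤ M → 1 ≤ M →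
    ∀ {u₀ u₁ : L2 n} {u : ℝ → L2 n}, IsSolution u₀ u₁ u → ∀ t : ℝ, 0 ≤ t →
      ‖u t‖ ≤ M * (‖u₀‖ + ‖u₁‖) ∧
      gradNorm (u t) ≤ M * (1 + t) ^ (-(1 / 2) : ℝ) * (‖u₀‖ + gradNorm u₀ + ‖u₁‖) ∧
      ‖dt u t‖ ≤ M * (1 + t) ^ (-1 : ℝ) * (‖u₀‖ + gradNorm u₀ + ‖u₁‖) := by
  obtain ⟨C, hC, hd⟩ := exists_solution_decay n 0
  refine ⟨C + 22, fun M hM1 hM u₀ u₁ u h t ht => ?_⟩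
  have hD := isUnitInterval_sobolev (n := n)
  have hb : ∀ (f : L2 n) (B : ℝ), ‖f‖ ≤ B → ∀ t, 0 ≤ t →
      heatForm (defect (sobolevEmb n)) 0 t f * (1 + t) ^ 0 ≤ B ^ 2 := fun f B hf t ht => by
    rw [pow_zero, mul_one]
    exact (heatForm_zero_le hD ht f).trans (by gcongr)
  have n0 := norm_nonneg u₀
  have n1 := norm_nonneg u₁
  have ng := gradNorm_nonneg u₀
  have h2 := hd h ((‖u₀‖ + gradNorm u₀ + ‖u₁‖) ^ 2) (hb _ _ (by linarith)) (hb _ _ (by linarith))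
    (by nlinarith [mul_nonneg n0 ng, mul_nonneg n0 n1, mul_nonneg n1 ng]) t ht
  refine ⟨?_, ?_, ?_⟩
  · have h1 := h.norm_decay 0 (hb _ (‖u₀‖ + ‖u₁‖) (by linarith)) (hb _ _ (by linarith)) ht
    have := le_rpow_of_sq_mul_pow_le (x := ‖u t‖) (B := ‖u₀‖ + ‖u₁‖) (e := 0) 0 (by norm_num) ht (by positivity)
      (by linarith : (22 : ℝ) ≤ M) hM (by simpa using h1)
    simpa using this
  · exact le_rpow_of_sq_mul_pow_le 1 (by norm_num) ht (by positivity) (by linarith) hM h2.1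
  · exact le_rpow_of_sq_mul_pow_le 2 (by norm_num) ht (by positivity) (by linarith) hM h2.2

theorem exists_bound_of_integrable {n : ℕ} (hn : 1 ≤ n) : ∃ C : ℝ, ∀ M, C ≤ M → 1 ≤ M →
    ∀ {u₀ u₁ : L2 n} {u : ℝ → L2 n}, MemH1 u₀ → IsSolution u₀ u₁ u → Integrable u₀ volume →
      Integrable u₁ volume → ∀ t : ℝ, 0 ≤ t →
        ‖u t‖ ≤ M * (1 + t) ^ (-(Q n / 4)) * (L1norm u₀ + ‖u₀‖ + L1norm u₁ + ‖u₁‖) ∧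
        gradNorm (u t) ≤ M * (1 + t) ^ (-(Q n / 4) - 1 / 2) *
          (L1norm u₀ + gradNorm u₀ + L1norm u₁ + ‖u₁‖) ∧
        ‖dt u t‖ ≤ M * (1 + t) ^ (-(Q n / 4) - 1) *
          (L1norm u₀ + gradNorm u₀ + L1norm u₁ + ‖u₁‖) := by
  obtain ⟨C₁, hC₁, h₁⟩ := exists_heatForm_decay_of_integrable hn
  obtain ⟨C₂, hC₂, h₂⟩ := exists_solution_decay n (n + 1)
  set A : ℝ := (2 * n + 4) ^ 2 + 1 with hA
  have hA1 : 1 ≤ A := by rw [hA]; nlinarith [sq_nonneg (2 * (n : ℝ) + 4)]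
  refine ⟨22 * 2 ^ (n + 1) * C₁ + C₂ * ((C₁ + 1) * (2 * A)), fun M hM1 hM u₀ u₁ u hm h i₀ i₁ t ht => ?_⟩
  have n0 := norm_nonneg u₀
  have n1 := norm_nonneg u₁
  have ng := gradNorm_nonneg u₀
  have l0 := L1norm_nonneg u₀
  have l1 := L1norm_nonneg u₁
  have hb : ∀ f : L2 n, Integrable f volume → ∀ B, ‖f‖ ^ 2 + L1norm f ^ 2 ≤ B → ∀ t, 0 ≤ t →
      heatForm (defect (sobolevEmb n)) 0 t f * (1 + t) ^ (n + 1) ≤ C₁ * B :=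
    fun f hf B hB t ht => (h₁ f hf t ht).trans (mul_le_mul_of_nonneg_left hB hC₁.le)
  have hp1 : 0 ≤ 22 * 2 ^ (n + 1) * C₁ := by positivity
  have hp2 : 0 ≤ C₂ * ((C₁ + 1) * (2 * A)) := by positivity
  set S := L1norm u₀ + ‖u₀‖ + L1norm u₁ + ‖u₁‖ with hS
  set S' := L1norm u₀ + gradNorm u₀ + L1norm u₁ + ‖u₁‖ with hS'
  have hS'0 : 0 ≤ S' := by positivity
  have e1 := h.norm_decay (n + 1) 
    (hb u₀ i₀ (S ^ 2) (sq_add_sq_le_of_add_le n0 l0 (by linarith)))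
    (hb u₁ i₁ _ (sq_add_sq_le_of_add_le n1 l1 (by linarith))) ht
  -- The gradient and time derivative bounds do not involve `‖u₀‖`; the Nash inequality at scale `r
  -- = 1` recovers it from the gradient and the `L¹` norm.
  have e2 : ‖u₀‖ ≤ (2 * n + 4) * S' := by
    have h3 := norm_sobolevEmb_le_of_integrable hn (sobolevLift u₀) (by rwa [sobolevEmb_lift hm])
    rw [sobolevEmb_lift hm, sobolevGrad_lift hm] at h3
    have h4 : gradNorm u₀ + L1norm u₀ ≤ S' := by linarith
    have h5 := mul_le_mul_of_nonneg_left h4 (by positivity : 0 ≤ 2 * (n : ℝ) + 4)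
    have h6 : 0 ≤ (2 * (n : ℝ) + 3) * L1norm u₀ := by positivity
    linarith
  have e3 : ‖u₀‖ ^ 2 ≤ (2 * n + 4) ^ 2 * S' ^ 2 := by rw [← mul_pow]; gcongr
  have e4 : ∀ x, 0 ≤ x → x ≤ S' → x ^ 2 ≤ S' ^ 2 := fun x hx hxS => by gcongr
  have hu : ‖u₀‖ ^ 2 + L1norm u₀ ^ 2 ≤ A * S' ^ 2 := by
    have := e4 _ l0 (by linarith)
    rw [hA]; linarith
  have hg : ‖u₀‖ ^ 2 + gradNorm u₀ ^ 2 ≤ A * S' ^ 2 := by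
    have := e4 _ ng (by linarith)
    rw [hA]; linarith
  have hw : ‖u₁‖ ^ 2 + L1norm u₁ ^ 2 ≤ 2 * (A * S' ^ 2) := by
    have := e4 _ l1 (by linarith)
    have := e4 _ n1 (by linarith)
    have := mul_le_mul_of_nonneg_right hA1 (sq_nonneg S')
    linarith
  have hAS : 0 ≤ A * S' ^ 2 := by positivity
  have hCAS : 0 ≤ C₁ * (A * S' ^ 2) := by positivity
  have hB : (C₁ + 1) * (2 * A) * S' ^ 2 = 2 * (C₁ * (A * S' ^ 2)) + 2 * (A * S' ^ 2) := by ring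
  have e5 := h₂ h ((C₁ + 1) * (2 * A) * S' ^ 2)
    (fun t ht => (hb u₀ i₀ _ hu t ht).trans (by rw [hB]; linarith))
    (fun t ht => (hb u₁ i₁ _ hw t ht).trans (by rw [hB]; linarith))
    (hg.trans (by rw [hB]; linarith)) t ht
  rw [← mul_assoc] at e1 e5
  refine ⟨?_, ?_, ?_⟩
  -- The squared norms decay at rates `n + 1`, `n + 2`, `n + 3`, and `(n + 1) / 2 = Q / 4`.
  · exact le_rpow_of_sq_mul_pow_le (n + 1) (by rw [Q]; push_cast; ring) ht (by positivity)
      (by linarith) hM e1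
  · exact le_rpow_of_sq_mul_pow_le (n + 1 + 1) (by rw [Q]; push_cast; ring) ht hS'0
      (by linarith) hM e5.1
  · exact le_rpow_of_sq_mul_pow_le (n + 1 + 2) (by rw [Q]; push_cast; ring) ht hS'0
      (by linarith) hM e5.2

end Heisenberg

end

theorem theorem1 (n : ℕ) (hn : 1 ≤ n) :
    ∃ C : ℝ, 0 < C ∧
      ∀ (u₀ u₁ : Heisenberg.L2 n) (u : ℝ → Heisenberg.L2 n),
        Heisenberg.MemH1 u₀ → Heisenberg.IsSolution u₀ u₁ u →
          (∀ t : ℝ, 0 ≤ t →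
            ‖u t‖ ≤ C * (‖u₀‖ + ‖u₁‖) ∧
            Heisenberg.gradNorm (u t) ≤
              C * (1 + t) ^ (-(1 / 2) : ℝ) * (‖u₀‖ + Heisenberg.gradNorm u₀ + ‖u₁‖) ∧
            ‖Heisenberg.dt u t‖ ≤
              C * (1 + t) ^ (-1 : ℝ) * (‖u₀‖ + Heisenberg.gradNorm u₀ + ‖u₁‖)) ∧
          (MeasureTheory.Integrable u₀ MeasureTheory.volume →
            MeasureTheory.Integrable u₁ MeasureTheory.volume →
            ∀ t : ℝ, 0 ≤ t →
              ‖u t‖ ≤ C * (1 + t) ^ (-(Heisenberg.Q n / 4)) *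
                (Heisenberg.L1norm u₀ + ‖u₀‖ + Heisenberg.L1norm u₁ + ‖u₁‖) ∧
              Heisenberg.gradNorm (u t) ≤ C * (1 + t) ^ (-(Heisenberg.Q n / 4) - 1 / 2) *
                (Heisenberg.L1norm u₀ + Heisenberg.gradNorm u₀ +
                  Heisenberg.L1norm u₁ + ‖u₁‖) ∧
              ‖Heisenberg.dt u t‖ ≤ C * (1 + t) ^ (-(Heisenberg.Q n / 4) - 1) *
                (Heisenberg.L1norm u₀ + Heisenberg.gradNorm u₀ +
                  Heisenberg.L1norm u₁ + ‖u₁‖)) := by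
  obtain ⟨C₁, h₁⟩ := Heisenberg.exists_bound n
  obtain ⟨C₂, h₂⟩ := Heisenberg.exists_bound_of_integrable hn
  have hM₁ : C₁ ≤ max 1 (max C₁ C₂) := (le_max_left _ _).trans (le_max_right _ _)
  have hM₂ : C₂ ≤ max 1 (max C₁ C₂) := (le_max_right _ _).trans (le_max_right _ _)
  have hM : 1 ≤ max 1 (max C₁ C₂) := le_max_left _ _
  exact ⟨max 1 (max C₁ C₂), by positivity, fun u₀ u₁ u hm h =>
    ⟨h₁ _ hM₁ hM h, h₂ _ hM₂ hM hm h⟩⟩
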